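/- Let $L$ be an even non-degenerate integral lattice with bilinear form $(\cdot,\cdot)$, of signature $(b^+,b^-)$; put $\dim L=b^++b^-$ and $\mathrm{sgn}\,L=b^+-b^-$. For $r\ge 1$ let $L(r)$ be $L$ with the form $r(\cdot,\cdot)$, let $A(r)=L(r)'/L\subset (L\otimes\mathbb{Q})/L$ and $q_r(x)=\frac r2(x,x)$ on $A(r)$ (with values in $\mathbb{Q}/\mathbb{Z}$), and let $A=A(1)$, $q=q_1$, $\mathbf e(x)=e^{2\pi i x}$. For $kl=r$ put $\Delta_r(\mu,k)=1$ if $\mu\in A(l)$ and $0$ otherwise. Let $\widetilde{\mathrm{GL}}{}_2^+(\mathbb{Q})$ be the group of pairs $(M,\phi)$, where $M=\begin{pmatrix}a&b\\c&d\end{pmatrix}$ is a rational matrix with positive determinant, $\phi$ is holomorphic on $\mathbb{H}$ and $\phi(\tau)^2=c\tau+d$, and let $\mathrm{Mp}_2(\mathbb{Z})$ be the subgroup with $M\in\mathrm{SL}_2(\mathbb{Z})$. There is a unique representation $\rho_L$ of $\mathrm{Mp}_2(\mathbb{Z})$ on $\mathbb{C}[A]$ (the Weil representation) with $\rho_L(T)e_\lambda=\mathbf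 e(q(\lambda))e_\lambda$ and $\rho_L(S)e_\lambda=\frac{\mathbf e(-\mathrm{sgn}(L)/8)}{\sqrt{|A|}}\sum_{\mu\in A}\mathbf e(-(\lambda,\mu))e_\mu$, where $T=\left(\begin{pmatrix}1&1\\0&1\end{pmatrix},1\right)$ and $S=\left(\begin{pmatrix}0&-1\\1&0\end{pmatrix},\sqrt\tau\right)$. Let $p$ be an odd prime and $l\ge 1$. Put $\alpha=\left(\begin{pmatrix}p^{2l}&0\\0&1\end{pmatrix},1\right)$, $\beta_{b,a}=\left(\begin{pmatrix}p^{2l-a}&b\\0&p^a\end{pmatrix},\sqrt{p^a}\right)$, $\gamma_b=\left(\begin{pmatrix}1&b\\0&p^{2l}\end{pmatrix},p^l\right)$. (1) Setting $\rho_L^{-1}(\alpha)e_\lambda=e_{p^l\lambda}$ and $\rho_L^{-1}(\gamma\alpha\gamma')=\rho_L^{-1}(\gamma')\rho_L^{-1}(\alpha)\rho_L^{-1}(\gamma)$ for $\gamma,\gamma'\in\mathrm{Mp}_2(\mathbb{Z})$ gives a well-defined map on $D=\mathrm{Mp}_2(\mathbb{Z})\,\alpha\,\mathrm{Mp}_2(\mathbb{Z})$.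 (2) $D$ is the disjoint union of the cosets $\mathrm{Mp}_2(\mathbb{Z})\alpha$, $\mathrm{Mp}_2(\mathbb{Z})\beta_{b,a}$ ($0<a<2l$, $b\in(\mathbb{Z}/p^a\mathbb{Z})^*$) and $\mathrm{Mp}_2(\mathbb{Z})\gamma_b$ ($b\in\mathbb{Z}/p^{2l}\mathbb{Z}$). (3) For $\lambda\in A$ and $b\in\mathbb{Z}$ one has $\rho_L^{-1}(\gamma_b)e_\lambda=\sum_{\nu\in A,\,p^l\nu=\lambda}\mathbf e(-bq(\nu))e_\nu$, and for $0<a<2l$ and $p\nmid b$ $$\rho_L^{-1}(\beta_{b,a})e_\lambda=\begin{cases}p^{-\frac a2\dim L}\displaystyle\sum_{\delta\in A(p^a),\ p^a\delta=\lambda}\mathbf e(-bq_{p^a}(\delta))\,e_{p^{l-a}\lambda}& (a\le l),\\ p^{-\frac a2\dim L}\displaystyle\sum_{\nu\in A,\ p^{a-l}\nu=\lambda}\ \sum_{\delta\in A(p^l),\ p^l\delta=\nu}\mathbf e(-bp^{a-l}q_{p^l}(\delta))\,e_\nu&(a>l).\end{cases}$$ (4) Let $k\in\frac12\mathbb{Z}$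 and let $\psi=\sum_{\lambda\in A}\psi_\lambda e_\lambda$ be holomorphic on $\mathbb{H}$ with $\psi(M\tau)=\phi(\tau)^{2k}\rho_L(M,\phi)\psi(\tau)$ for all $(M,\phi)\in\mathrm{Mp}_2(\mathbb{Z})$. For $\delta\in D$ put $$C^{(BS)}_\delta(\tau)=p^{2l(k-1)}\sum_{\lambda\in A}\phi_\delta(\tau)^{-2k}\psi_\lambda(\delta\tau)\,\rho_L^{-1}(\delta)e_\lambda ,$$ and let $T^{(BS)}_{p^{2l}}[\psi]=\sum_i C^{(BS)}_{\delta_i}$ for a system $(\delta_i)$ of representatives of the cosets $\mathrm{Mp}_2(\mathbb{Z})\delta$ in $D$. Let $\mathcal{H}_{n^2}=\mathcal{P}_{n^2}\circ\mathcal{T}_{n^2}$, where $\mathcal{P}_{n^2}$ takes $\sum_{\gamma\in A(n^2)}f_\gamma e_\gamma$ to $n^{-\dim L}\sum_{\lambda\in A}\big(\sum_{\gamma\in A(n^2),\,n\gamma=\lambda}\Delta_{n^2}(\gamma,n)f_\gamma\big)e_\lambda$ and $\mathcal{T}_r$ is taken in its double-coset variant $$\mathcal{T}_r[\psi](\tau)=r^{k+\frac12\dim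 L-1}\sum_{\mu\in A(r)}\ \sum_{mn=r}\ n^{-k-\frac12\dim L}\sum_{\substack{0\le s<n\\ \gcd(m,n,s)=1}}\Delta_r(\mu,m)\,\mathbf e\!\left(-\tfrac smq_r(\mu)\right)\psi_{n\mu}\!\left(\tfrac{m\tau+s}{n}\right)e_\mu .$$ For $0\le a\le 2l$ and $b\in\mathbb{Z}$ put $$C_{a,b}(\tau)=p^{(2l-a)k-2l-\frac a2\dim L}\sum_{\lambda\in A}\ \sum_{\substack{\gamma\in A(p^{2l})\\p^l\gamma=\lambda}}\Delta_{p^{2l}}(\gamma,p^l)\Delta_{p^{2l}}(\gamma,p^{2l-a})\,\mathbf e\!\left(-\tfrac{b}{p^{2l-a}}q_{p^{2l}}(\gamma)\right)\psi_{p^a\gamma}\!\left(\tfrac{p^{2l-a}\tau+b}{p^a}\right)e_\lambda .$$ Then $\mathcal{H}_{p^{2l}}[\psi]=C_{0,0}+\sum_{a=1}^{2l-1}\sum_{b\in(\mathbb{Z}/p^a\mathbb{Z})^*}C_{a,b}+\sum_{b=0}^{p^{2l}-1}C_{2l,b}$ (with representatives $0\le b<p^a$ of $(\mathbb{Z}/p^a\mathbb{Z})^*$).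 The two operators match coset by coset: $C^{(BS)}_\alpha=C_{0,0}$, $C^{(BS)}_{\beta_{b,a}}=C_{a,b}$ for $0<a<2l$ and $p\nmid b$, and $C^{(BS)}_{\gamma_b}=C_{2l,b}$ for all $b\in\mathbb{Z}$. Consequently, for every system of representatives, $$\mathcal{H}_{p^{2l}}[\psi]=T^{(BS)}_{p^{2l}}[\psi].$$ -/

import Mathlib

open UpperHalfPlane Matrix
open scoped MatrixGroups Manifold Classical

noncomputable section

namespace WeilHecke

/-- `𝐞(x) = exp(2πix)`. -/
def e (x : ℚ) : ℂ := Complex.exp (2 * Real.pi * Complex.I * (x : ℂ))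

/-- The complex number `n ^ x`, for a natural number `n` and a real exponent `x`. -/
def rp (n : ℕ) (x : ℝ) : ℂ := (((n : ℝ) ^ x : ℝ) : ℂ)

/-! ### The metaplectic groups -/

/-- The metaplectic double cover of `GL₂⁺(ℚ)`: pairs `(M, φ)` of a rational matrix
`M = (a b; c d)` of positive determinant and a holomorphic function `φ` on the upper half-plane
with `φ(τ)² = cτ + d`. -/
@[ext]
structure MetaGL where
  mat : GL (Fin 2) ℚ
  det_pos : 0 < mat.det.val
  φ : ℍ → ℂ
  holo : MDiff φ
  sq : ∀ τ : ℍ, φ τ ^ 2 = denom (GeneralLinearGroup.map (algebraMap ℚ ℝ) mat) τ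

namespace MetaGL

/-- The underlying real matrix. -/
def real (g : MetaGL) : GL (Fin 2) ℝ := GeneralLinearGroup.map (algebraMap ℚ ℝ) g.mat

theorem real_det_pos (g : MetaGL) : 0 < g.real.det.val := by
  have h := g.det_pos
  have h2 : g.real.det.val = ((g.mat.det.val : ℚ) : ℝ) := by
    simp [real, GeneralLinearGroup.map, Matrix.det_fin_two]
  rw [h2]
  exact_mod_cast h

theorem φ_ne_zero (g : MetaGL) (τ : ℍ) : g.φ τ ≠ 0 := fun h => by
  have := g.sq τ
  rw [h, zero_pow two_ne_zero] at this
  exact denom_ne_zero _ τ this.symm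

/-- Möbius action on the upper half-plane. -/
instance : SMul MetaGL ℍ := ⟨fun g τ => g.real • τ⟩

theorem smul_def (g : MetaGL) (τ : ℍ) : g • τ = g.real • τ := rfl

instance : One MetaGL :=
  ⟨{ mat := 1
     det_pos := by simp
     φ := fun _ => 1
     holo := mdifferentiable_const
     sq := by intro τ; simp }⟩

/-- `(M₁, φ₁)(M₂, φ₂) = (M₁M₂, φ₁(M₂τ)φ₂(τ))`. -/
instance : Mul MetaGL :=
  ⟨fun g h =>
   { mat := g.mat * h.mat
     det_pos := by
       have := mul_pos g.det_pos h.det_pos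
       simpa using this
     φ := fun τ => g.φ (h • τ) * h.φ τ
     holo := (g.holo.comp (mdifferentiable_smul h.real_det_pos)).mul h.holo
     sq := by
       intro τ
       have h1 := g.sq (h • τ)
       have h2 := h.sq τ
       rw [map_mul, denom_cocycle_σ, mul_pow, h1, h2]
       congr 1
       have : σ (GeneralLinearGroup.map (algebraMap ℚ ℝ) h.mat) = ContinuousAlgEquiv.refl ℝ ℂ :=
         if_pos h.real_det_pos
       rw [this]
       rfl }⟩

instance : Inv MetaGL :=
  ⟨fun g =>
   { mat := g.mat⁻¹
     det_pos := by
       have := inv_pos.mpr g.det_pos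
       simpa using this
     φ := fun τ => (g.φ (g.real⁻¹ • τ))⁻¹
     holo := by
       have hd : 0 < (g.real⁻¹).det.val := by
         have := inv_pos.mpr g.real_det_pos
         simpa using this
       have h1 : MDiff (fun τ : ℍ => g.φ (g.real⁻¹ • τ)) :=
         g.holo.comp (mdifferentiable_smul hd)
       rw [UpperHalfPlane.mdifferentiable_iff] at h1 ⊢
       exact h1.inv fun z _ => g.φ_ne_zero _
     sq := by
       intro τ
       have h1 := g.sq (g.real⁻¹ • τ)
       have h2 := denom_cocycle_σ g.real g.real⁻¹ τ
       have hs : σ (g.real⁻¹) = ContinuousAlgEquiv.refl ℝ ℂ := by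
         refine if_pos ?_
         have := inv_pos.mpr g.real_det_pos
         simpa using this
       rw [mul_inv_cancel, denom_one, hs] at h2
       rw [inv_pow, h1, map_inv]
       exact (eq_inv_of_mul_eq_one_right h2.symm).symm }⟩

@[simp] theorem mul_mat (g h : MetaGL) : (g * h).mat = g.mat * h.mat := rfl
@[simp] theorem one_mat : (1 : MetaGL).mat = 1 := rfl
@[simp] theorem inv_mat (g : MetaGL) : (g⁻¹).mat = g.mat⁻¹ := rfl
theorem mul_φ (g h : MetaGL) (τ : ℍ) : (g * h).φ τ = g.φ (h.real • τ) * h.φ τ := rfl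
theorem one_φ (τ : ℍ) : (1 : MetaGL).φ τ = 1 := rfl
theorem inv_φ (g : MetaGL) (τ : ℍ) : (g⁻¹).φ τ = (g.φ (g.real⁻¹ • τ))⁻¹ := rfl
theorem mul_real (g h : MetaGL) : (g * h).real = g.real * h.real := by
  simp [real]
theorem one_real : (1 : MetaGL).real = 1 := by
  simp [real]

instance : Group MetaGL where
  mul_assoc g h k := by
    ext1
    · simp [mul_assoc]
    · funext τ
      simp only [mul_φ, mul_real, mul_smul, mul_assoc]
  one_mul g := by
    ext1
    · simp
    · funext τ
      simp only [mul_φ, one_φ, one_mul]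
  mul_one g := by
    ext1
    · simp
    · funext τ
      simp only [mul_φ, one_φ, one_real, one_smul, mul_one]
  inv_mul_cancel g := by
    ext1
    · simp
    · funext τ
      simp only [mul_φ, one_φ, inv_φ, inv_smul_smul]
      exact inv_mul_cancel₀ (g.φ_ne_zero τ)

/-- The projection `(M, φ) ↦ M`. -/
def matHom : MetaGL →* GL (Fin 2) ℚ where
  toFun := mat
  map_one' := rfl
  map_mul' _ _ := rfl

/-- The element `((a b; 0 d), √d)`. -/
def tri (a d : ℕ) [ha : NeZero a] [hd : NeZero d] (b : ℤ) : MetaGL where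
  mat := GeneralLinearGroup.mkOfDetNeZero !![(a : ℚ), (b : ℚ); 0, (d : ℚ)]
    (by simp [Matrix.det_fin_two, ha.out, hd.out])
  det_pos := by
    have h1 : (0 : ℚ) < a := by exact_mod_cast Nat.pos_of_ne_zero ha.out
    have h2 : (0 : ℚ) < d := by exact_mod_cast Nat.pos_of_ne_zero hd.out
    simpa [GeneralLinearGroup.mkOfDetNeZero, Matrix.det_fin_two] using mul_pos h1 h2
  φ := fun _ => ((Real.sqrt d : ℝ) : ℂ)
  holo := mdifferentiable_const
  sq := by
    intro τ
    have : ((Real.sqrt d : ℝ) : ℂ) ^ 2 = (d : ℂ) := by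
      rw [← Complex.ofReal_pow, Real.sq_sqrt (Nat.cast_nonneg d)]
      simp
    simp [this, denom, GeneralLinearGroup.map, GeneralLinearGroup.mkOfDetNeZero]

end MetaGL

/-- `Mp₂(ℤ)`: the pairs `(M, φ)` with `M ∈ SL₂(ℤ)`. -/
def Mp2Z : Subgroup MetaGL := (SpecialLinearGroup.mapGL (R := ℤ) (n := Fin 2) ℚ).range.comap
  MetaGL.matHom

/-- `T = ((1 1; 0 1), 1)`. -/
def mpT : Mp2Z :=
  ⟨MetaGL.tri 1 1 1, ModularGroup.T, by
    ext i j
    change algebraMap ℤ ℚ (ModularGroup.T i j) =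
      !![((1 : ℕ) : ℚ), ((1 : ℤ) : ℚ); 0, ((1 : ℕ) : ℚ)] i j
    fin_cases i <;> fin_cases j <;> simp [ModularGroup.T]⟩

/-- `S = ((0 -1; 1 0), √τ)`, with the principal branch of the square root. -/
def mpS : Mp2Z :=
  ⟨{ mat := SpecialLinearGroup.mapGL ℚ ModularGroup.S
     det_pos := by simp
     φ := fun τ => (τ : ℂ) ^ (1 / 2 : ℂ)
     holo := by
       rw [UpperHalfPlane.mdifferentiable_iff]
       intro z hz
       have h1 : DifferentiableAt ℂ (fun z : ℂ => z ^ (1 / 2 : ℂ)) z :=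
         (differentiableAt_id).cpow (differentiableAt_const _)
           (Complex.mem_slitPlane_iff.2 (Or.inr (ne_of_gt hz)))
       refine (h1.congr_of_eventuallyEq ?_).differentiableWithinAt
       filter_upwards [isOpen_upperHalfPlaneSet.mem_nhds hz] with y hy
       simp [Function.comp, ofComplex_apply_of_im_pos hy]
     sq := by
       intro τ
       have : ((τ : ℂ) ^ (1 / 2 : ℂ)) ^ 2 = τ := by
         rw [← Complex.cpow_nat_mul]
         norm_num
       rw [this]
       change _ = ((algebraMap ℚ ℝ (algebraMap ℤ ℚ (ModularGroup.S 1 0)) : ℝ) : ℂ) * τ +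
         ((algebraMap ℚ ℝ (algebraMap ℤ ℚ (ModularGroup.S 1 1)) : ℝ) : ℂ)
       simp [ModularGroup.S] },
   ModularGroup.S, rfl⟩

/-! ### Lattices and discriminant forms -/

/-- An even non-degenerate integral lattice `L`, realized inside the rational quadratic space
`V = L ⊗ ℚ`. -/
structure EvenLattice (V : Type*) [AddCommGroup V] [Module ℚ V] where
  /-- the bilinear form on `L ⊗ ℚ` -/
  form : LinearMap.BilinForm ℚ V
  /-- the lattice -/
  lat : Submodule ℤ V
  symm : form.IsSymm
  nondegenerate : form.Nondegenerate
  fg : lat.FG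
  span_eq_top : Submodule.span ℚ (lat : Set V) = ⊤
  even : ∀ x ∈ lat, ∃ n : ℤ, form x x = 2 * n

namespace EvenLattice

variable {V : Type*} [AddCommGroup V] [Module ℚ V] (L : EvenLattice V)

/-- `dim L = b⁺ + b⁻`. -/
def dim (_L : EvenLattice V) : ℕ := Module.finrank ℚ V

/-- `sgn L = b⁺ - b⁻`. -/
def sgn : ℤ :=
  (sigPos L.form.toQuadraticMap : ℤ) - (sigNeg L.form.toQuadraticMap : ℤ)

/-- The dual `L(r)'` of the rescaled lattice `L(r)`, that is, of `L` with the form `r(·,·)`. -/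
def dual (r : ℕ) : Submodule ℤ V := ((r : ℚ) • L.form).dualSubmodule L.lat

/-- The discriminant group `A(r) = L(r)'/L`, as a subgroup of `(L ⊗ ℚ)/L`. In this way
`A(l) ⊆ A(r)` whenever `l` divides `r`. The discriminant group of `L` itself is `A = A(1)`. -/
def disc (r : ℕ) : Submodule ℤ (V ⧸ L.lat) := (L.dual r).map L.lat.mkQ

/-- A representative in `L ⊗ ℚ` of a class modulo `L`. -/
def lift (x : V ⧸ L.lat) : V := Function.surjInv L.lat.mkQ_surjective x

/-- The quadratic form `q_r(x) = r(x,x)/2`, through a representative; on `A(r)` its class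
modulo `ℤ` does not depend on the representative, see `q_congr`. -/
def q (r : ℕ) (x : V ⧸ L.lat) : ℚ := r * L.form (L.lift x) (L.lift x) / 2

/-- The bilinear form on `(L ⊗ ℚ)/L`, through representatives; on `A` its class
modulo `ℤ` does not depend on the representatives, see `pair_congr`. -/
def pair (x y : V ⧸ L.lat) : ℚ := L.form (L.lift x) (L.lift y)

theorem mem_dual {r : ℕ} {v : V} :
    v ∈ L.dual r ↔ ∀ y ∈ L.lat, ∃ n : ℤ, r * L.form v y = n := by
  simp only [dual, LinearMap.BilinForm.mem_dualSubmodule, LinearMap.smul_apply, smul_eq_mul,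
    Submodule.mem_one]
  refine forall₂_congr fun y _ => exists_congr fun n => ?_
  simp [eq_comm]

theorem lift_sub_mem (v : V) : L.lift (L.lat.mkQ v) - v ∈ L.lat := by
  have h : L.lat.mkQ (L.lift (L.lat.mkQ v)) = L.lat.mkQ v := Function.surjInv_eq _ _
  exact (Submodule.Quotient.eq L.lat).1 h

theorem q_congr {r : ℕ} {v : V} (hv : v ∈ L.dual r) :
    ∃ n : ℤ, L.q r (L.lat.mkQ v) = r * L.form v v / 2 + n := by
  obtain ⟨y, hy, h⟩ : ∃ y ∈ L.lat, L.lift (L.lat.mkQ v) = v + y :=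
    ⟨_, L.lift_sub_mem v, by abel⟩
  obtain ⟨n, hn⟩ := L.mem_dual.1 hv y hy
  obtain ⟨m, hm⟩ := L.even y hy
  refine ⟨n + r * m, ?_⟩
  have hs : L.form y v = L.form v y := L.symm.eq y v
  rw [q, h]
  simp only [map_add, LinearMap.add_apply, hs, hm]
  push_cast
  linear_combination hn

theorem integral {x y : V} (hx : x ∈ L.lat) (hy : y ∈ L.lat) : ∃ n : ℤ, L.form x y = n := by
  obtain ⟨a, ha⟩ := L.even x hx
  obtain ⟨b, hb⟩ := L.even y hy
  obtain ⟨c, hc⟩ := L.even (x + y) (L.lat.add_mem hx hy)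
  have hs : L.form y x = L.form x y := L.symm.eq y x
  simp only [map_add, LinearMap.add_apply, hs, ha, hb] at hc
  refine ⟨c - a - b, ?_⟩
  push_cast
  linear_combination hc / 2

theorem pair_congr {v v' : V} (hv : v ∈ L.dual 1) (hv' : v' ∈ L.dual 1) :
    ∃ n : ℤ, L.pair (L.lat.mkQ v) (L.lat.mkQ v') = L.form v v' + n := by
  obtain ⟨y, hy, h⟩ : ∃ y ∈ L.lat, L.lift (L.lat.mkQ v) = v + y :=
    ⟨_, L.lift_sub_mem v, by abel⟩
  obtain ⟨y', hy', h'⟩ : ∃ y ∈ L.lat, L.lift (L.lat.mkQ v') = v' + y :=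
    ⟨_, L.lift_sub_mem v', by abel⟩
  obtain ⟨a, ha⟩ := L.mem_dual.1 hv y' hy'
  obtain ⟨b, hb⟩ := L.mem_dual.1 hv' y hy
  obtain ⟨c, hc⟩ := L.integral hy hy'
  have hs : L.form y v' = L.form v' y := L.symm.eq y v'
  refine ⟨a + b + c, ?_⟩
  rw [pair, h, h']
  simp only [map_add, LinearMap.add_apply, hs]
  push_cast
  push_cast at ha hb
  linear_combination ha + hb + hc

theorem dual_fg (r : ℕ) [hr : NeZero r] : (L.dual r).FG := by
  obtain ⟨G, hG⟩ := L.fg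
  have hr0 : (r : ℚ) ≠ 0 := by exact_mod_cast hr.out
  have hGmem : ∀ g : G, (g : V) ∈ L.lat := fun g => hG ▸ Submodule.subset_span g.2
  choose f hf using fun (x : L.dual r) (g : G) => L.mem_dual.1 x.2 g (hGmem g)
  let F : L.dual r →ₗ[ℤ] (G → ℤ) :=
    AddMonoidHom.toIntLinearMap
      { toFun := f
        map_zero' := by
          funext g
          have := hf 0 g
          simp only [Submodule.coe_zero, map_zero, LinearMap.zero_apply, mul_zero] at this
          exact_mod_cast this.symm
        map_add' := by
          intro x y
          funext g
          have h1 := hf (x + y) g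
          have h2 := hf x g
          have h3 := hf y g
          simp only [Submodule.coe_add, map_add, LinearMap.add_apply, mul_add] at h1
          rw [h2, h3] at h1
          exact_mod_cast h1.symm }
  have hinj : Function.Injective F := by
    rw [← LinearMap.ker_eq_bot, LinearMap.ker_eq_bot']
    intro x hx
    have h0 : ∀ g : G, L.form x g = 0 := by
      intro g
      have h1 := hf x g
      have h2 : f x g = 0 := congrFun hx g
      rw [h2] at h1
      simpa [hr0] using h1
    have h1 : ∀ y ∈ L.lat, L.form x y = 0 := by
      intro y hy
      rw [← hG] at hy
      induction hy using Submodule.span_induction with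
      | mem y hy => exact h0 ⟨y, hy⟩
      | zero => simp
      | add a b _ _ ha hb => simp [ha, hb]
      | smul n a _ ha => simp [ha]
    have h2 : ∀ y : V, L.form x y = 0 := by
      intro y
      have hy : y ∈ Submodule.span ℚ (L.lat : Set V) := by rw [L.span_eq_top]; trivial
      induction hy using Submodule.span_induction with
      | mem y hy => exact h1 y hy
      | zero => simp
      | add a b _ _ ha hb => simp [ha, hb]
      | smul n a _ ha => simp [ha]
    exact Subtype.ext (L.nondegenerate.1 _ h2)
  have : Module.Finite ℤ (L.dual r) := Module.Finite.of_injective F hinj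
  exact Module.Finite.iff_fg.1 this

instance (r : ℕ) [NeZero r] : Finite (L.disc r) := by
  have : Module.Finite ℤ (L.disc r) := Module.Finite.iff_fg.2 ((L.dual_fg r).map _)
  refine Module.finite_of_fg_torsion _ ?_
  have key : ∀ v : V, ∃ n : ℤ, n ≠ 0 ∧ n • v ∈ L.lat := by
    intro v
    have hv : v ∈ Submodule.span ℚ (L.lat : Set V) := by rw [L.span_eq_top]; trivial
    induction hv using Submodule.span_induction with
    | mem y hy => exact ⟨1, one_ne_zero, by simpa using hy⟩
    | zero => exact ⟨1, one_ne_zero, by simp⟩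
    | add a b _ _ ha hb =>
      obtain ⟨n, hn, h1⟩ := ha
      obtain ⟨m, hm, h2⟩ := hb
      refine ⟨n * m, mul_ne_zero hn hm, ?_⟩
      rw [smul_add]
      refine L.lat.add_mem ?_ ?_
      · rw [mul_comm, mul_smul]; exact L.lat.smul_mem m h1
      · rw [mul_smul]; exact L.lat.smul_mem n h2
    | smul c a _ ha =>
      obtain ⟨n, hn, h1⟩ := ha
      refine ⟨n * c.den, mul_ne_zero hn (by exact_mod_cast c.den_ne_zero), ?_⟩
      have : (n * (c.den : ℤ)) • c • a = c.num • n • a := by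
        simp only [← Int.cast_smul_eq_zsmul ℚ, smul_smul]
        congr 1
        have := Rat.mul_den_eq_num c
        push_cast
        linear_combination (n : ℚ) * this
      rw [this]
      exact L.lat.smul_mem _ h1
  rintro ⟨_, v, hv, rfl⟩
  obtain ⟨n, hn, h⟩ := key v
  refine ⟨⟨n, mem_nonZeroDivisors_of_ne_zero hn⟩, ?_⟩
  ext
  change n • L.lat.mkQ v = 0
  rw [← map_smul]
  exact (Submodule.Quotient.mk_eq_zero _).2 h

instance (r : ℕ) [NeZero r] : Fintype (L.disc r) := Fintype.ofFinite _

/-- The standard basis vector `e_μ` of `ℂ[A(r)]`, the latter being realized as the space of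
functions `A(r) → ℂ`. -/
def basisVec {r : ℕ} (μ : L.disc r) : L.disc r → ℂ := Pi.single μ 1

/-- The set of all `γ ∈ A(r)` with `nγ = x`. -/
def fiber (r n : ℕ) [NeZero r] (x : V ⧸ L.lat) : Finset (L.disc r) :=
  Finset.univ.filter fun γ => n • γ.1 = x

/-- The coefficient `f_x`, set to be `0` for `x ∉ A(r)`. -/
def coeff {r : ℕ} (f : L.disc r → ℂ) (x : V ⧸ L.lat) : ℂ :=
  if h : x ∈ L.disc r then f ⟨x, h⟩ else 0

/-- `Δ_r(μ, k)` for `k ∣ r`: with `r = kl`, it is `1` if `μ ∈ A(l)` and `0` otherwise. -/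
def Δ (r k : ℕ) (μ : V ⧸ L.lat) : ℂ := if μ ∈ L.disc (r / k) then 1 else 0

/-! ### The Weil representation and modular forms -/

/-- The defining formulas of the Weil representation of `Mp₂(ℤ)` on `ℂ[A]`. -/
structure IsWeilRep (ρ : Representation ℂ Mp2Z (L.disc 1 → ℂ)) : Prop where
  T : ∀ μ : L.disc 1, ρ mpT (L.basisVec μ) = e (L.q 1 μ) • L.basisVec μ
  S : ∀ μ : L.disc 1, ρ mpS (L.basisVec μ) =
    (e (-(L.sgn : ℚ) / 8) / ((Real.sqrt (Nat.card (L.disc 1)) : ℝ) : ℂ)) •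
      ∑ ν : L.disc 1, e (-L.pair μ ν) • L.basisVec ν

/-- The Weil representation `ρ_L`: the representation with these values at `S` and `T`. -/
def weilRep : Representation ℂ Mp2Z (L.disc 1 → ℂ) := Classical.epsilon L.IsWeilRep

/-- Holomorphic vector-valued modular forms of weight `k = w/2` and type `ρ_L`; no condition at
the cusps is imposed. -/
structure IsModularForm (w : ℤ) (ψ : ℍ → L.disc 1 → ℂ) : Prop where
  holo : ∀ μ, MDiff (fun τ => ψ τ μ)
  modular : ∀ (g : Mp2Z) (τ : ℍ), ψ (g.1 • τ) = g.1.φ τ ^ w • L.weilRep g (ψ τ)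

/-! ### The Hecke operators `ℋ` -/

/-- The double coset variant of the Hecke operator `𝒯_r` in weight `k = w/2`: in
`r^{k + dim/2 - 1} ∑_{mn = r} n^{-k - dim/2} ∑_{s mod n}` only those `s` are kept for which the
matrix `(m s; 0 n)` is primitive. -/
def heckeT (r : ℕ) (w : ℤ) (ψ : ℍ → L.disc 1 → ℂ) (τ : ℍ) : L.disc r → ℂ := fun μ =>
  rp r ((w : ℝ) / 2 + (L.dim : ℝ) / 2 - 1) *
    ∑ mn ∈ r.divisorsAntidiagonal,
      rp mn.2 (-((w : ℝ) / 2 + (L.dim : ℝ) / 2)) *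
        ∑ s ∈ Finset.range mn.2 with Nat.gcd (Nat.gcd mn.1 mn.2) s = 1,
          L.Δ r mn.1 μ * e (-((s : ℚ) / mn.1) * L.q r μ) *
            L.coeff (ψ (ofComplex ((mn.1 * (τ : ℂ) + s) / mn.2))) (mn.2 • (μ : V ⧸ L.lat))

/-- The projection operator `𝒫_{n²}`. -/
def proj (n : ℕ) [NeZero n] (ψ : ℍ → L.disc (n ^ 2) → ℂ) (τ : ℍ) : L.disc 1 → ℂ := fun μ =>
  ((n : ℂ) ^ L.dim)⁻¹ *
    ∑ γ ∈ L.fiber (n ^ 2) n μ, L.Δ (n ^ 2) n γ * ψ τ γ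

/-- The operator `ℋ_{n²} = 𝒫_{n²} ∘ 𝒯_{n²}`, in its double coset variant. -/
def heckeH (n : ℕ) [NeZero n] (w : ℤ) (ψ : ℍ → L.disc 1 → ℂ) : ℍ → L.disc 1 → ℂ :=
  L.proj n (L.heckeT (n ^ 2) w ψ)

/-- The contribution of `(p^{2l-a} b; 0 p^a)` to `ℋ_{p^{2l}}`. It is `C_α` for
`a = b = 0`, it is `C_{β_{b,a}}` for `0 < a < 2l`, and it is `C_{γ_b}` for `a = 2l`. -/
def heckeTerm (p l : ℕ) [NeZero p] (w : ℤ) (a : ℕ) (b : ℤ) (ψ : ℍ → L.disc 1 → ℂ) (τ : ℍ) :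
    L.disc 1 → ℂ := fun μ =>
  rp p ((2 * l - a) * ((w : ℝ) / 2) - 2 * l - (a : ℝ) / 2 * L.dim) *
    ∑ γ ∈ L.fiber (p ^ (2 * l)) (p ^ l) μ,
      L.Δ (p ^ (2 * l)) (p ^ l) γ * L.Δ (p ^ (2 * l)) (p ^ (2 * l - a)) γ *
        e (-((b : ℚ) / (p : ℚ) ^ (2 * l - a)) * L.q (p ^ (2 * l)) γ) *
          L.coeff (ψ (ofComplex (((p : ℂ) ^ (2 * l - a) * (τ : ℂ) + b) / (p : ℂ) ^ a)))
            (p ^ a • (γ : V ⧸ L.lat))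

/-! ### The Bruinier–Stein operators -/

end EvenLattice

/-- `α = ((p^{2l} 0; 0 1), 1)`. -/
def alpha (p l : ℕ) [NeZero p] : MetaGL := MetaGL.tri (p ^ (2 * l)) 1 0

/-- `β_{b,a} = ((p^{2l-a} b; 0 p^a), √(p^a))`. -/
def beta (p l : ℕ) [NeZero p] (a : ℕ) (b : ℤ) : MetaGL :=
  MetaGL.tri (p ^ (2 * l - a)) (p ^ a) b

/-- `γ_b = ((1 b; 0 p^{2l}), p^l)`. -/
def gamma (p l : ℕ) [NeZero p] (b : ℤ) : MetaGL := MetaGL.tri 1 (p ^ (2 * l)) b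

/-- A complete system of representatives of the left cosets `Mp₂(ℤ) δ` in the double coset
`Mp₂(ℤ) α Mp₂(ℤ)`, each coset being represented exactly once. -/
def IsCosetSystem (p l : ℕ) [NeZero p] {ι : Type*} (δ : ι → MetaGL) : Prop :=
  (∀ i, δ i ∈ DoubleCoset.doubleCoset (alpha p l) (Mp2Z : Set MetaGL) (Mp2Z : Set MetaGL)) ∧
  ∀ g ∈ DoubleCoset.doubleCoset (alpha p l) (Mp2Z : Set MetaGL) (Mp2Z : Set MetaGL),
    ∃! i, ∃ h : Mp2Z, g = h * δ i

/-- The representatives `α`, `β_{b,a}` with `0 < a < 2l` and `b ∈ (ℤ/p^aℤ)ˣ`, and `γ_b` with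
`b ∈ ℤ/p^{2l}ℤ`. -/
def cosetRep (p l : ℕ) [NeZero p] :
    Unit ⊕ (Σ a : Finset.Ioo 0 (2 * l), (ZMod (p ^ (a : ℕ)))ˣ) ⊕ ZMod (p ^ (2 * l)) → MetaGL
  | .inl _ => alpha p l
  | .inr (.inl ⟨a, b⟩) => beta p l a (b : ZMod (p ^ (a : ℕ))).val
  | .inr (.inr b) => gamma p l b.val

namespace EvenLattice

variable {V : Type*} [AddCommGroup V] [Module ℚ V] (L : EvenLattice V)

/-- The operator `ρ_L⁻¹(α) : e_μ ↦ e_{p^l μ}`. -/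
def alphaOp (p l : ℕ) : (L.disc 1 → ℂ) →ₗ[ℂ] (L.disc 1 → ℂ) :=
  (Pi.basisFun ℂ (L.disc 1)).constr ℂ fun μ => L.basisVec (p ^ l • μ)

/-- The extension of the Weil representation to the double coset:
`ρ_L⁻¹(γ α γ') = ρ_L⁻¹(γ') ρ_L⁻¹(α) ρ_L⁻¹(γ)` for `γ, γ' ∈ Mp₂(ℤ)`. A decomposition
`γ α γ'` is chosen here; outside the double coset the value is `0`. -/
def weilInv (p l : ℕ) [NeZero p] (δ : MetaGL) : (L.disc 1 → ℂ) →ₗ[ℂ] (L.disc 1 → ℂ) :=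
  if h : ∃ g : Mp2Z × Mp2Z, δ = g.1 * alpha p l * g.2 then
    L.weilRep h.choose.2⁻¹ ∘ₗ L.alphaOp p l ∘ₗ L.weilRep h.choose.1⁻¹
  else 0

/-- The contribution of the coset of `δ` to the Bruinier–Stein operator, in weight `k = w/2`:
`p^{2l(k-1)} ∑_μ φ_δ(τ)^{-2k} ψ_μ(δτ) ρ_L⁻¹(δ) e_μ`. -/
def bsTerm (p l : ℕ) [NeZero p] (w : ℤ) (δ : MetaGL) (ψ : ℍ → L.disc 1 → ℂ) (τ : ℍ) :
    L.disc 1 → ℂ :=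
  rp p (2 * l * ((w : ℝ) / 2 - 1)) •
    ∑ μ : L.disc 1, (δ.φ τ ^ (-w) * ψ (δ • τ) μ) • L.weilInv p l δ (L.basisVec μ)

/-- The Bruinier–Stein operator `T_{p^{2l}}`, computed with the system `δ` of representatives. -/
def bsHecke (p l : ℕ) [NeZero p] (w : ℤ) {ι : Type*} [Fintype ι] (δ : ι → MetaGL)
    (ψ : ℍ → L.disc 1 → ℂ) (τ : ℍ) : L.disc 1 → ℂ :=
  ∑ i, L.bsTerm p l w (δ i) ψ τ

end EvenLattice

end WeilHecke

end

open WeilHecke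

noncomputable section

namespace WeilHecke

/-! ### Generators of `Mp₂(ℤ)` -/

namespace MetaGL

/-! The Weil representation is realised on theta functions, where the action extends from `Mp₂(ℤ)`
to the whole metaplectic group. An orthogonal rational basis of `L ⊗ ℚ` splits the kernel of `L(r)`
into one-variable Gaussians, holomorphic in `τ` for negative and antiholomorphic for positive
diagonal entries. A vector `f` of `ℂ[A(r)]` gives a function `theta r f` of `(τ, z)`. All levels `r`
use one slash action, since its automorphy factor depends only on the signs of the weights; the
variable `z` makes `theta r` injective.

Poisson summation gives the action of `S` on these functions (`slashRep_mpS_theta`), and the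
substitution `v ↦ Dv` gives the action of every upper triangular element (`slash_tri_theta`). Hence
the image of `theta r` carries a representation `thetaRep r` of `Mp₂(ℤ)`, which for `r = 1` is the
Weil representation; this also proves that the latter exists.

Now put `r = p^{2l}`. Slashing `theta 1 f` by `α` gives the theta function of level `r` of the
extension of `f` by zero, and `e_γ ↦ e_{p^l γ}` intertwines `thetaRep r` with `thetaRep 1`
(`projMap_comp_thetaRep`). Their composite is `ρ_L⁻¹(α)`. So `ρ_L⁻¹(δ) f` is obtained by slashing
`theta 1 f` with `δ`, reading off the coefficient vector and projecting. Only `δ` enters, not a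
factorisation `γαγ'`: this is the well-definedness. For upper triangular `δ` the triangular formula
gives the values without any factorisation (`weilInv_tri`).

The coset decomposition is Hermite normal form together with primitivity. The operator `ℋ` is the
same slash-and-project recipe, so each coset contribution agrees with a Bruinier–Stein term
(`bsTerm_tri`). Modularity of `ψ` is needed only to change representatives (`bsTerm_mul`). -/

theorem smul_φ_cont (g : MetaGL) : Continuous g.φ := g.holo.continuous

/-- Both functions are continuous square roots of the same nowhere vanishing function on the
connected space `ℍ`. -/
theorem eq_of_mat_eq_of_sign {g h : MetaGL} (hm : g.mat = h.mat) :
    (∀ τ, g.φ τ = h.φ τ) ∨ (∀ τ, g.φ τ = -h.φ τ) := by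
  have := (isPreconnected_univ (α := ℍ)).eq_or_eq_neg_of_sq_eq (f := g.φ) (g := h.φ)
    g.smul_φ_cont.continuousOn h.smul_φ_cont.continuousOn
    (fun τ _ => by simp [g.sq τ, h.sq τ, hm]) (fun _ => h.φ_ne_zero _)
  rcases this with h1 | h1
  · exact Or.inl fun τ => h1 (Set.mem_univ τ)
  · exact Or.inr fun τ => h1 (Set.mem_univ τ)

end MetaGL

theorem mpS_mat : mpS.1.mat = SpecialLinearGroup.mapGL ℚ ModularGroup.S := rfl

theorem mpT_mat : mpT.1.mat = SpecialLinearGroup.mapGL ℚ ModularGroup.T := by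
  ext i j
  change !![((1 : ℕ) : ℚ), ((1 : ℤ) : ℚ); 0, ((1 : ℕ) : ℚ)] i j = algebraMap ℤ ℚ (ModularGroup.T i j)
  fin_cases i <;> fin_cases j <;> simp [ModularGroup.T]

/-- The nontrivial element of the kernel of `Mp₂(ℤ) → SL₂(ℤ)` is `S⁴`. -/
theorem mpS_pow_four : (mpS ^ 4).1.mat = 1 ∧ ∀ τ, (mpS ^ 4).1.φ τ = -1 := by
  have hS2 : (mpS.1 * mpS.1).mat = SpecialLinearGroup.mapGL ℚ (ModularGroup.S * ModularGroup.S) := by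
    rw [MetaGL.mul_mat, mpS_mat, map_mul]
  have hSS : ModularGroup.S * ModularGroup.S = -1 := by
    decide
  have h4 : (mpS ^ 4).1 = (mpS.1 * mpS.1) * (mpS.1 * mpS.1) := by
    simp [pow_succ, mul_assoc]
  -- `S²` lies over `-1`, so it fixes every `τ` and its `φ` squares to the lower right entry `-1`.
  -- The cocycle relation then gives `φ(S⁴) = φ(S²)² = -1`.
  have hd : ∀ τ, (mpS.1 * mpS.1).φ τ ^ 2 = -1 := by
    intro τ
    rw [MetaGL.sq, hS2, hSS]
    simp [denom]
  have hact : ∀ τ : ℍ, (mpS.1 * mpS.1).real • τ = τ := by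
    intro τ
    have : (mpS.1 * mpS.1).real = -1 := by
      rw [MetaGL.real, hS2, hSS]
      ext i j; fin_cases i <;> fin_cases j <;> simp
    rw [this]
    simp
  refine ⟨?_, fun τ => ?_⟩
  · rw [h4, MetaGL.mul_mat, hS2, hSS, ← map_mul]; simp
  · rw [h4, MetaGL.mul_φ, hact, ← sq, hd]

theorem eq_one_or_eq_of_mat_eq_one (g : Mp2Z) (h : g.1.mat = 1) : g = 1 ∨ g = mpS ^ 4 := by
  have h1 : g.1.mat = (1 : MetaGL).mat := by simpa using h
  rcases MetaGL.eq_of_mat_eq_of_sign h1 with h2 | h2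
  · left; ext1; exact MetaGL.ext h1 (funext h2)
  · right; ext1
    refine MetaGL.ext (by rw [h, mpS_pow_four.1]) (funext fun τ => ?_)
    rw [h2, mpS_pow_four.2, MetaGL.one_φ]

/-- If two elements of the metaplectic group have the same matrix, they differ by `Mp₂(ℤ)`. -/
theorem exists_eq_mul_of_mat_eq {g h : MetaGL} (hm : g.mat = h.mat) :
    ∃ k : Mp2Z, k.1.mat = 1 ∧ g = k * h := by
  have hk : (g * h⁻¹).mat = 1 := by simp [hm]
  exact ⟨⟨g * h⁻¹, 1, by simp [MetaGL.matHom, hm]⟩, hk, by simp⟩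

/-- The lift is kept inside the subgroup generated by `S` and `T`, because `closure_mpS_mpT` is
deduced from it. -/
theorem exists_mp2Z_lift (A : SL(2, ℤ)) :
    ∃ g ∈ Subgroup.closure {mpS, mpT}, g.1.mat = SpecialLinearGroup.mapGL ℚ A := by
  have hA : A ∈ Subgroup.closure {ModularGroup.S, ModularGroup.T} := by
    rw [SpecialLinearGroup.SL2Z_generators]; trivial
  induction hA using Subgroup.closure_induction with
  | mem x hx =>
    rcases hx with rfl | rfl
    · exact ⟨mpS, Subgroup.subset_closure (by simp), mpS_mat⟩
    · exact ⟨mpT, Subgroup.subset_closure (by simp), mpT_mat⟩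
  | one => exact ⟨1, one_mem _, by simp⟩
  | mul x y _ _ hx hy =>
    obtain ⟨g, hg, h1⟩ := hx
    obtain ⟨h, hh, h2⟩ := hy
    exact ⟨g * h, mul_mem hg hh, by simp [h1, h2]⟩
  | inv x _ hx =>
    obtain ⟨g, hg, h1⟩ := hx
    exact ⟨g⁻¹, inv_mem hg, by simp [h1]⟩

/-- A word in `S` and `T` reaches the right matrix; the remaining discrepancy lies over the
identity, hence is `1` or `S⁴`, again a word in `S`. -/
theorem closure_mpS_mpT : Subgroup.closure {mpS, mpT} = ⊤ := by
  rw [eq_top_iff]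
  intro g _
  obtain ⟨A, hA⟩ := g.2
  obtain ⟨h, hh, h1⟩ := exists_mp2Z_lift A
  have hmat : (g * h⁻¹).1.mat = 1 := by
    have : g.1.mat = SpecialLinearGroup.mapGL ℚ A := hA.symm
    simp [this, h1]
  have hS : mpS ∈ Subgroup.closure {mpS, mpT} := Subgroup.subset_closure (by simp)
  have : g * h⁻¹ ∈ Subgroup.closure {mpS, mpT} := by
    rcases eq_one_or_eq_of_mat_eq_one _ hmat with h2 | h2 <;> rw [h2]
    · exact one_mem _
    · exact pow_mem hS 4
  simpa using mul_mem this hh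

/-! ### The slash action on functions of theta type -/

namespace MetaGL

/-- `GL₂⁺(ℚ)~` acts on `ℍ × ℂⁿ` by `(τ, z) ↦ (gτ, det(g) z / φ(τ)²)`. -/
def act {n : ℕ} (g : MetaGL) (x : ℍ × (Fin n → ℂ)) : ℍ × (Fin n → ℂ) :=
  (g • x.1, fun i => (g.mat.det.val : ℂ) * x.2 i / g.φ x.1 ^ 2)

theorem act_mul {n : ℕ} (g h : MetaGL) (x : ℍ × (Fin n → ℂ)) :
    (g * h).act x = g.act (h.act x) := by
  ext1
  · simp only [act, smul_def, mul_real, mul_smul]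
  · funext i
    simp only [act, mul_φ, mul_mat, map_mul, Units.val_mul, smul_def]
    have h1 := g.φ_ne_zero (h.real • x.1)
    have h2 := h.φ_ne_zero x.1
    push_cast
    field_simp

theorem act_one {n : ℕ} (x : ℍ × (Fin n → ℂ)) : (1 : MetaGL).act x = x := by
  ext1
  · simp [act, smul_def, one_real]
  · funext i; simp [act, one_φ]

/-- The automorphy factor: one factor `φ` for each negative weight and one factor `conj φ` for
each positive weight. -/
def factor {n : ℕ} (c : Fin n → ℝ) (g : MetaGL) (τ : ℍ) : ℂ :=
  ∏ i, if c i < 0 then g.φ τ else (starRingEnd ℂ) (g.φ τ)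

theorem factor_mul {n : ℕ} (c : Fin n → ℝ) (g h : MetaGL) (τ : ℍ) :
    (g * h).factor c τ = g.factor c (h • τ) * h.factor c τ := by
  simp only [factor, ← Finset.prod_mul_distrib]
  refine Finset.prod_congr rfl fun i _ => ?_
  split_ifs <;> simp [mul_φ, smul_def]

theorem factor_one {n : ℕ} (c : Fin n → ℝ) (τ : ℍ) : (1 : MetaGL).factor c τ = 1 := by
  simp [factor, one_φ]

/-- The slash operator `F ↦ F|g`. -/
def slash {n : ℕ} (c : Fin n → ℝ) (g : MetaGL) :
    (ℍ × (Fin n → ℂ) → ℂ) →ₗ[ℂ] (ℍ × (Fin n → ℂ) → ℂ) where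
  toFun F x := (g.factor c x.1)⁻¹ * F (g.act x)
  map_add' F G := by funext x; simp [mul_add]
  map_smul' a F := by funext x; simp; ring

theorem slash_apply {n : ℕ} (c : Fin n → ℝ) (g : MetaGL) (F : ℍ × (Fin n → ℂ) → ℂ)
    (x : ℍ × (Fin n → ℂ)) : g.slash c F x = (g.factor c x.1)⁻¹ * F (g.act x) := rfl

theorem slash_mul {n : ℕ} (c : Fin n → ℝ) (g h : MetaGL) (F : ℍ × (Fin n → ℂ) → ℂ) :
    (g * h).slash c F = h.slash c (g.slash c F) := by
  funext x
  simp only [slash_apply, act_mul, factor_mul, mul_inv]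
  rw [show (h.act x).1 = h • x.1 from rfl]
  ring

theorem slash_one {n : ℕ} (c : Fin n → ℝ) (F : ℍ × (Fin n → ℂ) → ℂ) :
    (1 : MetaGL).slash c F = F := by
  funext x
  simp [slash_apply, act_one, factor_one]

end MetaGL

/-- The right action `F|g`, turned into a representation `g ↦ (F ↦ F|g⁻¹)`. -/
def slashRep {n : ℕ} (c : Fin n → ℝ) : Representation ℂ MetaGL (ℍ × (Fin n → ℂ) → ℂ) where
  toFun g := (g⁻¹).slash c
  map_one' := by
    refine LinearMap.ext fun F => ?_
    rw [inv_one, MetaGL.slash_one]; rfl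
  map_mul' g h := by
    refine LinearMap.ext fun F => ?_
    rw [_root_.mul_inv_rev, MetaGL.slash_mul]; rfl

theorem slashRep_apply {n : ℕ} (c : Fin n → ℝ) (g : MetaGL) (F : ℍ × (Fin n → ℂ) → ℂ) :
    slashRep c g F = (g⁻¹).slash c F := rfl

/-! ### Gaussian kernels and Poisson summation -/

/-- The Gaussian `exp(πi a (x²τ + 2xz + uz))`, where `u = Im z / Im τ`. -/
def gaussKernel (a : ℝ) (τ : ℍ) (z : ℂ) (x : ℝ) : ℂ :=
  Complex.exp (Real.pi * Complex.I * a * (x ^ 2 * τ + 2 * x * z + (z.im / τ.im : ℝ) * z))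

/-- The Gaussian attached to the weight `c`, holomorphic in `τ` for `c < 0` and
antiholomorphic for `c > 0`. -/
def signedKernel (c : ℝ) (τ : ℍ) (z : ℂ) (x : ℝ) : ℂ :=
  if c < 0 then gaussKernel (-c) τ z x else (starRingEnd ℂ) (gaussKernel c τ z x)

/-- Under `z ↦ Az`, `x ↦ Dx` the ratio `Im z / Im τ` is multiplied by `D`. So all three terms of the
exponent scale by `AD`, and the translation `b` leaves only a phase. -/
theorem gaussKernel_tri {A D : ℝ} (hA : 0 < A) (hD : 0 < D) (b a : ℝ) (τ τ' : ℍ) (z z' : ℂ) (x : ℝ)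
    (hτ : (τ' : ℂ) = (A * τ + b) / D) (hz : z' = A * z) :
    gaussKernel a τ' z' (D * x) =
      Complex.exp (Real.pi * Complex.I * a * (x ^ 2 * b * D : ℝ)) *
        gaussKernel (A * D * a) τ z x := by
  have him : τ'.im = A / D * τ.im := by
    have := congrArg Complex.im hτ
    rw [show (A * (τ : ℂ) + b) / D = ((A / D : ℝ) : ℂ) * τ + ((b / D : ℝ) : ℂ) by
      push_cast; ring, Complex.add_im, Complex.im_ofReal_mul, Complex.ofReal_im, add_zero] at this
    simpa using this
  have hτ0 := τ.im_pos.ne'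
  have hzim : (z'.im / τ'.im : ℝ) = D * (z.im / τ.im) := by
    rw [him, hz, Complex.im_ofReal_mul]
    field_simp
  rw [gaussKernel, gaussKernel, hzim, hτ, hz, ← Complex.exp_add]
  congr 1
  have hDc : (D : ℂ) ≠ 0 := by exact_mod_cast hD.ne'
  push_cast
  field_simp
  ring

/-- This is the reason for the non-holomorphic term `uz` in the kernel: it absorbs the factor
`exp(πi z²/τ)` of Jacobi's inversion formula, so that the slash action needs no further exponential
factor. -/
theorem gaussKernel_im_u (τ τ' : ℍ) (z z' : ℂ) (hτ : (τ' : ℂ) = -1 / τ) (hz : z' = -z / τ) :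
    ((z'.im / τ'.im : ℝ) : ℂ) * z' + z ^ 2 / τ = ((z.im / τ.im : ℝ) : ℂ) * z := by
  have hτ0 : (τ : ℂ) ≠ 0 := ne_zero τ
  have hy : (τ.im : ℝ) ≠ 0 := τ.im_pos.ne'
  have hn : Complex.normSq τ ≠ 0 := by simpa using hτ0
  have h1 : τ'.im = τ.im / Complex.normSq τ := by
    rw [← coe_im, hτ, neg_div, one_div, Complex.neg_im, Complex.inv_im, coe_im]; ring
  have h2 : z'.im = -(z.im * τ.re - z.re * τ.im) / Complex.normSq τ := by
    rw [hz, Complex.div_im, Complex.neg_im, Complex.neg_re, coe_im, coe_re]; ring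
  have h3 : z'.im / τ'.im = -(z.im * τ.re - z.re * τ.im) / τ.im := by
    rw [h1, h2]; field_simp
  have hzc : z = z.re + z.im * Complex.I := (Complex.re_add_im z).symm
  have hτc : (τ : ℂ) = τ.re + τ.im * Complex.I := (Complex.re_add_im (τ : ℂ)).symm
  have hyc : (τ.im : ℂ) ≠ 0 := by exact_mod_cast hy
  have key : ((z.im * τ.re - z.re * τ.im : ℝ) : ℂ) + z * τ.im = τ * z.im := by
    apply Complex.ext <;> simp <;> ring
  rw [h3, hz]
  push_cast at key ⊢
  field_simp
  linear_combination z * key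

theorem tsum_gaussKernel_inversion {a : ℝ} (ha : 0 < a) (τ τ' : ℍ) (z z' : ℂ) (s : ℝ)
    (hτ : (τ' : ℂ) = -1 / τ) (hz : z' = -z / τ) :
    ∑' n : ℤ, gaussKernel a τ' z' (s + n) =
      (-Complex.I * (τ / a)) ^ (1 / 2 : ℂ) *
        ∑' n : ℤ, Complex.exp (2 * Real.pi * Complex.I * (n * s)) * gaussKernel a τ z (n / a) := by
  have hτ0 : (τ : ℂ) ≠ 0 := ne_zero τ
  have hac : (a : ℂ) ≠ 0 := by exact_mod_cast ha.ne'
  have hu := gaussKernel_im_u τ τ' z z' hτ hz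
  have hR : ∑' n : ℤ, Complex.exp (2 * Real.pi * Complex.I * (n * s)) * gaussKernel a τ z (n / a) =
      Complex.exp (Real.pi * Complex.I * a * ((z.im / τ.im : ℝ) * z)) *
        jacobiTheta₂ (z + s) (τ / a) := by
    rw [jacobiTheta₂, ← tsum_mul_left]
    refine tsum_congr fun n => ?_
    rw [gaussKernel, jacobiTheta₂_term, ← Complex.exp_add, ← Complex.exp_add]
    congr 1
    push_cast
    field_simp
    ring
  -- The sum is reindexed by `n ↦ -n` to match the sign of the argument in Jacobi's theta series;
  -- the functional equation is then applied at `z + s` and `τ/a`.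
  have hL : ∑' n : ℤ, gaussKernel a τ' z' (s + n) =
      Complex.exp (Real.pi * Complex.I * a * ((z.im / τ.im : ℝ) * z)) *
        (Complex.exp (-Real.pi * Complex.I * (z + s) ^ 2 / (τ / a)) *
          jacobiTheta₂ ((z + s) / (τ / a)) (-1 / (τ / a))) := by
    rw [jacobiTheta₂, ← tsum_mul_left, ← tsum_mul_left, ← (Equiv.neg ℤ).tsum_eq]
    refine tsum_congr fun n => ?_
    rw [gaussKernel, jacobiTheta₂_term, ← Complex.exp_add, ← Complex.exp_add, ← hu]
    congr 1
    rw [hτ, hz]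
    simp only [Equiv.neg_apply]
    push_cast
    field_simp
    ring
  have hw : (-Complex.I * (τ / a)) ^ (1 / 2 : ℂ) ≠ 0 := by
    rw [Complex.cpow_ne_zero_iff]
    left
    simp [hτ0, ha.ne']
  rw [hR, hL, jacobiTheta₂_functional_equation (z + s)]
  generalize jacobiTheta₂ ((z + s) / (τ / a)) _ = j at *
  generalize (-Complex.I * (τ / a)) ^ (1 / 2 : ℂ) = w at *
  field_simp

theorem summable_gaussKernel {a : ℝ} (ha : 0 < a) (τ : ℍ) (z : ℂ) (s : ℝ) {t : ℝ} (ht : t ≠ 0) :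
    Summable fun n : ℤ => ‖gaussKernel a τ z (s + n * t)‖ := by
  have him : 0 < ((a * t ^ 2 : ℝ) * (τ : ℂ)).im := by
    rw [Complex.im_ofReal_mul]
    have := τ.im_pos
    rw [← coe_im] at this
    positivity
  have := ((summable_jacobiTheta₂_term_iff (a * t * (z + s * τ)) ((a * t ^ 2 : ℝ) * (τ : ℂ))).2 him).norm
  refine (this.mul_left ‖Complex.exp (Real.pi * Complex.I * a *
    (s ^ 2 * τ + 2 * s * z + (z.im / τ.im : ℝ) * z))‖).congr fun n => ?_
  rw [← norm_mul, gaussKernel, jacobiTheta₂_term, ← Complex.exp_add]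
  congr 2
  push_cast
  ring

/-- With `w = -iτ`, which has positive real part, `-1/τ = i/w`. The arguments stay in the principal
range, so the logarithms add and `w` cancels. One eighth root of unity remains for each diagonal
entry; together they give `𝐞(-sgn(L)/8)`. -/
theorem sqrt_inversion {a : ℝ} (ha : 0 < a) (τ : ℍ) :
    (-1 / (τ : ℂ)) ^ (1 / 2 : ℂ) * (-Complex.I * (τ / a)) ^ (1 / 2 : ℂ) =
      Complex.exp (Real.pi * Complex.I / 4) / (Real.sqrt a : ℝ) := by
  set w : ℂ := -Complex.I * τ with hw
  have hτ0 : (τ : ℂ) ≠ 0 := ne_zero τ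
  have hw0 : w ≠ 0 := by simp [hw, hτ0]
  have hwre : 0 < w.re := by simpa [hw] using τ.im_pos
  have harg := (Complex.abs_arg_lt_pi_div_two_iff (z := w)).2 (Or.inl hwre)
  rw [abs_lt] at harg
  have harg1 : w.arg ≠ Real.pi := by have := Real.pi_pos; intro h; linarith [harg.2]
  have h1 : (-1 / (τ : ℂ)) = Complex.I * w⁻¹ := by
    rw [hw]; field_simp
  have h2 : -Complex.I * ((τ : ℂ) / a) = ((a⁻¹ : ℝ) : ℂ) * w := by
    rw [hw]; push_cast; ring
  have hl1 : Complex.log (Complex.I * w⁻¹) = Real.pi / 2 * Complex.I - Complex.log w := by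
    rw [(Complex.log_mul_eq_add_log_iff Complex.I_ne_zero (inv_ne_zero hw0)).2, Complex.log_I,
      Complex.log_inv _ harg1]
    · ring
    · rw [Complex.arg_I, Complex.arg_inv, if_neg harg1]
      constructor <;> linarith [harg.1, harg.2]
  have hl2 : Complex.log (((a⁻¹ : ℝ) : ℂ) * w) = -(Real.log a : ℝ) + Complex.log w := by
    rw [Complex.log_ofReal_mul (inv_pos.2 ha) hw0, Real.log_inv]; push_cast; ring
  have hs : ((Real.sqrt a : ℝ) : ℂ) = Complex.exp ((Real.log a : ℝ) / 2) := by
    have : Real.sqrt a = Real.exp (Real.log a / 2) := by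
      rw [Real.exp_half, Real.exp_log ha]
    rw [this]; push_cast; rfl
  have ha0 : (((a⁻¹ : ℝ) : ℂ) * w) ≠ 0 :=
    mul_ne_zero (by simpa using ha.ne') hw0
  rw [h1, h2, Complex.cpow_def_of_ne_zero (mul_ne_zero Complex.I_ne_zero (inv_ne_zero hw0)),
    Complex.cpow_def_of_ne_zero ha0, hl1, hl2, hs, ← Complex.exp_add, ← Complex.exp_sub]
  congr 1
  ring

theorem signedKernel_tri {A D : ℝ} (hA : 0 < A) (hD : 0 < D) (b c : ℝ) (τ τ' : ℍ) (z z' : ℂ)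
    (x : ℝ) (hτ : (τ' : ℂ) = (A * τ + b) / D) (hz : z' = A * z) :
    signedKernel c τ' z' (D * x) =
      Complex.exp (-(Real.pi * Complex.I * (c * x ^ 2 * b * D : ℝ))) *
        signedKernel (A * D * c) τ z x := by
  have hiff : A * D * c < 0 ↔ c < 0 := by
    have : 0 < A * D := by positivity
    constructor <;> intro h <;> nlinarith
  rw [signedKernel, signedKernel]
  by_cases hc : c < 0
  · rw [if_pos hc, if_pos (hiff.2 hc), gaussKernel_tri hA hD b (-c) τ τ' z z' x hτ hz,
      show A * D * -c = -(A * D * c) by ring]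
    congr 2
    push_cast
    ring
  · rw [if_neg hc, if_neg (hiff.not.2 hc), gaussKernel_tri hA hD b c τ τ' z z' x hτ hz, map_mul,
      ← Complex.exp_conj]
    congr 2
    simp only [map_mul, Complex.conj_ofReal, Complex.conj_I]
    push_cast
    ring

theorem signedKernel_neg (c : ℝ) (τ : ℍ) (z : ℂ) (x : ℝ) :
    signedKernel c τ (-z) x = signedKernel c τ z (-x) := by
  have : ∀ a, gaussKernel a τ (-z) x = gaussKernel a τ z (-x) := by
    intro a
    rw [gaussKernel, gaussKernel, Complex.neg_im]
    congr 1
    push_cast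
    ring
  simp [signedKernel, this]

/-- For real `z` the term `uz` vanishes and `z` enters only through a character of `x`. This lets
finite Fourier analysis in `z` separate the coefficients of a theta function. -/
theorem signedKernel_ofReal (c : ℝ) (τ : ℍ) (t x : ℝ) :
    signedKernel c τ t x =
      Complex.exp (-(2 * Real.pi * Complex.I * (c * x * t : ℝ))) * signedKernel c τ 0 x := by
  have : ∀ a, gaussKernel a τ t x =
      Complex.exp (2 * Real.pi * Complex.I * (a * x * t : ℝ)) * gaussKernel a τ 0 x := by
    intro a
    rw [gaussKernel, gaussKernel, ← Complex.exp_add]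
    congr 1
    simp
    ring
  rw [signedKernel, signedKernel]
  split_ifs with hc
  · rw [this]
    congr 2
    push_cast
    ring
  · rw [this, map_mul, ← Complex.exp_conj]
    congr 2
    simp only [map_mul, Complex.conj_ofReal, Complex.conj_I, Complex.conj_ofNat]
    ring

/-- Both branches become the same positive Gaussian; this positivity prevents cancellation in the
injectivity proof for theta functions. -/
theorem signedKernel_I_zero (c : ℝ) (x : ℝ) :
    signedKernel c UpperHalfPlane.I 0 x = (Real.exp (-(Real.pi * |c| * x ^ 2)) : ℝ) := by
  have : ∀ a : ℝ, gaussKernel a UpperHalfPlane.I 0 x =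
      (Real.exp (-(Real.pi * a * x ^ 2)) : ℝ) := by
    intro a
    rw [gaussKernel]
    push_cast
    congr 1
    linear_combination (Real.pi * a * x ^ 2 : ℂ) * Complex.I_sq
  rw [signedKernel]
  split_ifs with hc
  · rw [this, abs_of_neg hc]
  · rw [this, abs_of_nonneg (not_lt.1 hc), Complex.conj_ofReal]

theorem summable_signedKernel {c : ℝ} (hc : c ≠ 0) (τ : ℍ) (z : ℂ) (s : ℝ) {t : ℝ} (ht : t ≠ 0) :
    Summable fun n : ℤ => ‖signedKernel c τ z (s + n * t)‖ := by
  unfold signedKernel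
  split_ifs with h
  · exact summable_gaussKernel (neg_pos.2 h) τ z s ht
  · exact (summable_gaussKernel (lt_of_le_of_ne (not_lt.1 h) hc.symm) τ z s ht).congr fun _ =>
      (RCLike.norm_conj _).symm

/-- The factor in the inversion formula for `signedKernel c`. -/
def inversionFactor (c : ℝ) (τ : ℍ) : ℂ :=
  if c < 0 then (-Complex.I * (τ / |c|)) ^ (1 / 2 : ℂ)
  else (starRingEnd ℂ) ((-Complex.I * (τ / |c|)) ^ (1 / 2 : ℂ))

theorem tsum_signedKernel_inversion {c : ℝ} (hc : c ≠ 0) (τ τ' : ℍ) (z z' : ℂ) (s : ℝ)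
    (hτ : (τ' : ℂ) = -1 / τ) (hz : z' = -z / τ) :
    ∑' n : ℤ, signedKernel c τ' z' (s + n) =
      inversionFactor c τ *
        ∑' n : ℤ, Complex.exp (-(2 * Real.pi * Complex.I * (n * s))) * signedKernel c τ z (n / c) := by
  simp only [signedKernel, inversionFactor]
  split_ifs with h
  · rw [tsum_gaussKernel_inversion (neg_pos.2 h) τ τ' z z' s hτ hz, abs_of_neg h,
      ← (Equiv.neg ℤ).tsum_eq]
    simp only [Equiv.neg_apply]
    congr 1
    refine tsum_congr fun n => ?_
    congr 2
    · push_cast; ring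
    · push_cast; field_simp
  · have hpos : 0 < c := lt_of_le_of_ne (not_lt.1 h) hc.symm
    rw [← Complex.conj_tsum, tsum_gaussKernel_inversion hpos τ τ' z z' s hτ hz, abs_of_pos hpos,
      map_mul, Complex.conj_tsum]
    congr 1
    refine tsum_congr fun n => ?_
    rw [map_mul, ← Complex.exp_conj]
    congr 2
    simp only [map_mul, Complex.conj_ofReal, Complex.conj_I, Complex.conj_ofNat, map_intCast]
    ring

/-! ### Products -/

theorem summable_tsum_fin_prod {n : ℕ} {f : Fin n → ℤ → ℂ} (hf : ∀ i, Summable fun k => ‖f i k‖) :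
    (Summable fun k : Fin n → ℤ => ‖∏ i, f i (k i)‖) ∧
      ∑' k : Fin n → ℤ, ∏ i, f i (k i) = ∏ i, ∑' k, f i k := by
  induction n with
  | zero =>
    refine ⟨summable_of_hasFiniteSupport (Set.toFinite _), ?_⟩
    rw [tsum_eq_single default (fun b hb => absurd (Subsingleton.elim b _) hb)]
    simp
  | succ n ih =>
    obtain ⟨h1, h2⟩ := ih (f := fun i => f i.succ) (fun i => hf i.succ)
    let E := Fin.consEquiv (fun _ : Fin (n + 1) => ℤ)
    have hE : ∀ x : ℤ × (Fin n → ℤ), ∏ i, f i (E x i) = f 0 x.1 * ∏ i, f i.succ (x.2 i) := by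
      intro x
      rw [Fin.prod_univ_succ]
      rfl
    refine ⟨?_, ?_⟩
    · rw [← E.summable_iff]
      have := (hf 0).mul_norm h1
      refine this.congr fun x => ?_
      rw [Function.comp, hE]
    · rw [← E.tsum_eq, Fin.prod_univ_succ, ← h2, tsum_mul_tsum_of_summable_norm (hf 0) h1]
      exact tsum_congr hE

/-- The kernel of the theta functions: a product of Gaussians. -/
def prodKernel {n : ℕ} (c : Fin n → ℝ) (τ : ℍ) (z : Fin n → ℂ) (x : Fin n → ℝ) : ℂ :=
  ∏ i, signedKernel (c i) τ (z i) (x i)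

theorem prodKernel_tri {n : ℕ} {A D : ℝ} (hA : 0 < A) (hD : 0 < D) (b : ℝ) (c : Fin n → ℝ)
    (τ τ' : ℍ) (z z' : Fin n → ℂ) (x : Fin n → ℝ) (hτ : (τ' : ℂ) = (A * τ + b) / D)
    (hz : ∀ i, z' i = A * z i) :
    prodKernel c τ' z' (fun i => D * x i) =
      Complex.exp (-(Real.pi * Complex.I * ((∑ i, c i * x i ^ 2) * b * D : ℝ))) *
        prodKernel (fun i => A * D * c i) τ z x := by
  rw [prodKernel, prodKernel, Finset.prod_congr rfl fun i _ =>
    signedKernel_tri hA hD b (c i) τ τ' (z i) (z' i) (x i) hτ (hz i), Finset.prod_mul_distrib,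
    ← Complex.exp_sum]
  congr 2
  push_cast
  rw [Finset.sum_mul, Finset.sum_mul, Finset.mul_sum, Finset.sum_neg_distrib]

theorem prodKernel_neg {n : ℕ} (c : Fin n → ℝ) (τ : ℍ) (z : Fin n → ℂ) (x : Fin n → ℝ) :
    prodKernel c τ (-z) x = prodKernel c τ z (-x) := by
  simp [prodKernel, signedKernel_neg]

theorem prodKernel_ofReal {n : ℕ} (c : Fin n → ℝ) (τ : ℍ) (t x : Fin n → ℝ) :
    prodKernel c τ (fun i => (t i : ℂ)) x =
      Complex.exp (-(2 * Real.pi * Complex.I * ((∑ i, c i * x i * t i : ℝ) : ℂ))) *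
        prodKernel c τ 0 x := by
  rw [prodKernel, prodKernel, Finset.prod_congr rfl fun i _ => signedKernel_ofReal (c i) τ (t i) (x i),
    Finset.prod_mul_distrib, ← Complex.exp_sum]
  congr 2
  push_cast
  rw [Finset.mul_sum, Finset.sum_neg_distrib]

theorem prodKernel_I_zero {n : ℕ} (c x : Fin n → ℝ) :
    prodKernel c UpperHalfPlane.I 0 x =
      (∏ i, Real.exp (-(Real.pi * |c i| * x i ^ 2)) : ℝ) := by
  rw [prodKernel]
  push_cast
  exact Finset.prod_congr rfl fun i _ => by simpa using signedKernel_I_zero (c i) (x i)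

theorem summable_prodKernel {n : ℕ} {c : Fin n → ℝ} (hc : ∀ i, c i ≠ 0) (τ : ℍ) (z : Fin n → ℂ)
    (s : Fin n → ℝ) {t : Fin n → ℝ} (ht : ∀ i, t i ≠ 0) :
    Summable fun k : Fin n → ℤ => ‖prodKernel c τ z (fun i => s i + k i * t i)‖ :=
  (summable_tsum_fin_prod fun i => summable_signedKernel (hc i) τ (z i) (s i) (ht i)).1

theorem tsum_prodKernel_inversion {n : ℕ} {c : Fin n → ℝ} (hc : ∀ i, c i ≠ 0) (τ τ' : ℍ)
    (z z' : Fin n → ℂ) (s : Fin n → ℝ) (hτ : (τ' : ℂ) = -1 / τ) (hz : ∀ i, z' i = -z i / τ) :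
    ∑' k : Fin n → ℤ, prodKernel c τ' z' (fun i => s i + k i) =
      (∏ i, inversionFactor (c i) τ) * ∑' k : Fin n → ℤ,
        Complex.exp (-(2 * Real.pi * Complex.I * ((∑ i, k i * s i : ℝ) : ℂ))) *
          prodKernel c τ z (fun i => k i / c i) := by
  have h1 := (summable_tsum_fin_prod fun i =>
    summable_signedKernel (hc i) τ' (z' i) (s i) one_ne_zero).2
  have h2 := (summable_tsum_fin_prod (f := fun i (m : ℤ) =>
    Complex.exp (-(2 * Real.pi * Complex.I * (m * s i))) * signedKernel (c i) τ (z i) (m / c i))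
    fun i => by
      have := summable_signedKernel (hc i) τ (z i) 0 (inv_ne_zero (hc i))
      refine this.congr fun m => ?_
      rw [norm_mul, zero_add, div_eq_mul_inv]
      have : ‖Complex.exp (-(2 * Real.pi * Complex.I * (m * s i)))‖ = 1 := by
        rw [show -(2 * Real.pi * Complex.I * (m * s i)) = ((-(2 * Real.pi * (m * s i)) : ℝ) : ℂ) *
          Complex.I by push_cast; ring, Complex.norm_exp_ofReal_mul_I]
      rw [this, one_mul]).2
  simp only [mul_one] at h1
  simp only [prodKernel]
  rw [h1, Finset.prod_congr rfl fun i _ =>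
    tsum_signedKernel_inversion (hc i) τ τ' (z i) (z' i) (s i) hτ (hz i), Finset.prod_mul_distrib,
    ← h2]
  congr 1
  refine tsum_congr fun k => ?_
  rw [Finset.prod_mul_distrib, ← Complex.exp_sum]
  congr 2
  push_cast
  rw [Finset.mul_sum, Finset.sum_neg_distrib]

/-! ### The character `𝐞` -/

theorem e_add (x y : ℚ) : e (x + y) = e x * e y := by
  rw [e, e, e, ← Complex.exp_add]
  congr 1
  push_cast
  ring

theorem e_zero : e 0 = 1 := by simp [e]

theorem e_int (n : ℤ) : e n = 1 := by
  rw [e, ← Complex.exp_int_mul_two_pi_mul_I n]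
  congr 1
  push_cast
  ring

theorem e_add_int (x : ℚ) (n : ℤ) : e (x + n) = e x := by
  rw [e_add, e_int, mul_one]

theorem norm_e (x : ℚ) : ‖e x‖ = 1 := by
  rw [e, show 2 * (Real.pi : ℂ) * Complex.I * (x : ℂ) = ((2 * Real.pi * x : ℝ) : ℂ) * Complex.I by
    push_cast; ring, Complex.norm_exp_ofReal_mul_I]

theorem e_eq_one_iff (x : ℚ) : e x = 1 ↔ ∃ n : ℤ, x = n := by
  constructor
  · intro h
    obtain ⟨n, hn⟩ := Complex.exp_eq_one_iff.1 h
    refine ⟨n, ?_⟩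
    have h2 : (2 * Real.pi * Complex.I : ℂ) ≠ 0 := Complex.two_pi_I_ne_zero
    have : (x : ℂ) = n := mul_left_cancel₀ h2 (by rw [hn]; ring)
    exact_mod_cast this
  · rintro ⟨n, rfl⟩
    exact e_int n

/-! ### Orthogonal bases inside a lattice -/

namespace EvenLattice

variable {V : Type*} [AddCommGroup V] [Module ℚ V] (L : EvenLattice V)

theorem finiteDimensional (L : EvenLattice V) : FiniteDimensional ℚ V := by
  obtain ⟨G, hG⟩ := L.fg
  refine ⟨⟨G, ?_⟩⟩
  rw [eq_top_iff, ← L.span_eq_top, Submodule.span_le]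
  intro x hx
  rw [← hG] at hx
  exact Submodule.span_subset_span ℤ ℚ _ hx

theorem exists_zsmul_mem_of_span {M : Submodule ℤ V} (hM : Submodule.span ℚ (M : Set V) = ⊤)
    (v : V) : ∃ n : ℤ, n ≠ 0 ∧ n • v ∈ M := by
  have hv : v ∈ Submodule.span ℚ (M : Set V) := by rw [hM]; trivial
  induction hv using Submodule.span_induction with
  | mem y hy => exact ⟨1, one_ne_zero, by simpa using hy⟩
  | zero => exact ⟨1, one_ne_zero, by simp⟩
  | add a b _ _ ha hb =>
    obtain ⟨n, hn, h1⟩ := ha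
    obtain ⟨m, hm, h2⟩ := hb
    refine ⟨n * m, mul_ne_zero hn hm, ?_⟩
    rw [smul_add]
    refine M.add_mem ?_ ?_
    · rw [mul_comm, mul_smul]; exact M.smul_mem m h1
    · rw [mul_smul]; exact M.smul_mem n h2
  | smul c a _ ha =>
    obtain ⟨n, hn, h1⟩ := ha
    refine ⟨n * c.den, mul_ne_zero hn (by exact_mod_cast c.den_ne_zero), ?_⟩
    have : (n * (c.den : ℤ)) • c • a = c.num • n • a := by
      simp only [← Int.cast_smul_eq_zsmul ℚ, smul_smul]
      congr 1
      have := Rat.mul_den_eq_num c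
      push_cast
      linear_combination (n : ℚ) * this
    rw [this]
    exact M.smul_mem _ h1

theorem exists_zsmul_mem (v : V) : ∃ n : ℤ, n ≠ 0 ∧ n • v ∈ L.lat :=
  exists_zsmul_mem_of_span L.span_eq_top v

/-- An orthogonal basis of `L ⊗ ℚ` consisting of vectors of `L`. -/
structure OrthoBasis where
  basis : Module.Basis (Fin L.dim) ℚ V
  ortho : ∀ i j, i ≠ j → L.form (basis i) (basis j) = 0
  mem : ∀ i, basis i ∈ L.lat

/-- The form is diagonalised over `ℚ` and denominators are cleared. The basis then spans a
sublattice of finite index in `L`, for which Poisson summation is a product of one-variable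
formulas. -/
theorem exists_orthoBasis : Nonempty L.OrthoBasis := by
  have := L.finiteDimensional
  have : Invertible (2 : ℚ) := invertibleOfNonzero two_ne_zero
  obtain ⟨v, hv⟩ : ∃ v : Module.Basis (Fin L.dim) ℚ V,
      ∀ i j, i ≠ j → L.form (v i) (v j) = 0 := by
    obtain ⟨v, hv⟩ := LinearMap.BilinForm.exists_orthogonal_basis (LinearMap.BilinForm.isSymm_iff.1 L.symm)
    exact ⟨v, fun i j h => hv h⟩
  choose m hm hmem using fun i => L.exists_zsmul_mem (v i)
  have hu : ∀ i, IsUnit ((m i : ℤ) : ℚ) := fun i => isUnit_iff_ne_zero.2 (by exact_mod_cast hm i)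
  refine ⟨⟨v.isUnitSMul hu, fun i j hij => ?_, fun i => ?_⟩⟩
  · have := hv i j hij
    simp [Module.Basis.isUnitSMul_apply, this]
  · rw [Module.Basis.isUnitSMul_apply, Int.cast_smul_eq_zsmul]
    exact hmem i

namespace OrthoBasis

variable {L} (b : L.OrthoBasis)

/-- The diagonal entries of the form. -/
def diag (i : Fin L.dim) : ℚ := L.form (b.basis i) (b.basis i)

theorem form_basis (x : V) (i : Fin L.dim) : L.form x (b.basis i) = b.basis.repr x i * b.diag i := by
  conv_lhs => rw [← b.basis.sum_repr x]
  rw [map_sum, LinearMap.sum_apply, Finset.sum_eq_single i]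
  · simp [diag]
  · intro j _ hj
    simp [b.ortho j i hj]
  · simp

theorem form_eq (x y : V) :
    L.form x y = ∑ i, b.diag i * b.basis.repr x i * b.basis.repr y i := by
  conv_lhs => rw [← b.basis.sum_repr y]
  rw [map_sum]
  refine Finset.sum_congr rfl fun i _ => ?_
  rw [map_smul, b.form_basis, smul_eq_mul]
  ring

theorem diag_ne_zero (i : Fin L.dim) : b.diag i ≠ 0 := by
  intro h
  refine b.basis.ne_zero i (L.nondegenerate.2 _ fun x => ?_)
  rw [b.form_basis, h, mul_zero]

/-- The weights of the theta kernel of `L(r)`. -/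
def weight (r : ℕ) (i : Fin L.dim) : ℝ := r * (b.diag i : ℝ)

theorem weight_ne_zero (r : ℕ) [hr : NeZero r] (i : Fin L.dim) : b.weight r i ≠ 0 :=
  mul_ne_zero (by exact_mod_cast hr.out) (by exact_mod_cast b.diag_ne_zero i)

theorem weight_neg_iff (r : ℕ) [hr : NeZero r] (i : Fin L.dim) : b.weight r i < 0 ↔ b.diag i < 0 := by
  have h1 : (0 : ℝ) < r := by exact_mod_cast Nat.pos_of_ne_zero hr.out
  have h2 : ((b.diag i : ℝ) < 0) ↔ b.diag i < 0 := by exact_mod_cast Iff.rfl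
  rw [weight, ← h2]
  constructor <;> intro h <;> nlinarith

/-- Real coordinates. -/
def coord (x : V) (i : Fin L.dim) : ℝ := (b.basis.repr x i : ℝ)

theorem sum_weight (r : ℕ) (x y : V) :
    ∑ i, b.weight r i * b.coord x i * b.coord y i = ((r * L.form x y : ℚ) : ℝ) := by
  rw [b.form_eq]
  push_cast
  rw [Finset.mul_sum]
  exact Finset.sum_congr rfl fun i _ => by simp only [weight, coord]; ring

/-- The theta kernel of `L(r)`. -/
def ker (r : ℕ) (x : ℍ × (Fin L.dim → ℂ)) (v : V) : ℂ :=
  prodKernel (b.weight r) x.1 x.2 (b.coord v)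

theorem ker_tri (s A D r : ℕ) [hA : NeZero A] [hD : NeZero D] (h : A * D * s = r) (m : ℤ)
    (x x' : ℍ × (Fin L.dim → ℂ)) (hτ : (x'.1 : ℂ) = (A * x.1 + m) / D)
    (hz : ∀ i, x'.2 i = A * x.2 i) (v : V) :
    b.ker s x' ((D : ℚ) • v) = e (-(m * (s * (D * L.form v v / 2)))) * b.ker r x v := by
  have h1 : (0 : ℝ) < A := by exact_mod_cast Nat.pos_of_ne_zero hA.out
  have h2 : (0 : ℝ) < D := by exact_mod_cast Nat.pos_of_ne_zero hD.out
  have h3 : b.coord ((D : ℚ) • v) = fun i => (D : ℝ) * b.coord v i := by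
    funext i
    simp [coord]
  have h4 : (fun i => (A : ℝ) * D * b.weight s i) = b.weight r := by
    funext i
    rw [weight, weight, ← h]
    push_cast
    ring
  rw [ker, ker, h3, prodKernel_tri h1 h2 m (b.weight s) x.1 x'.1 x.2 x'.2 _ (by simpa using hτ)
    (by simpa using hz), h4]
  congr 1
  rw [e]
  congr 1
  have := b.sum_weight s v v
  simp only [sq, ← mul_assoc]
  rw [this]
  push_cast
  ring

theorem ker_neg (r : ℕ) (τ : ℍ) (z : Fin L.dim → ℂ) (v : V) :
    b.ker r (τ, -z) v = b.ker r (τ, z) (-v) := by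
  rw [ker, prodKernel_neg, ker]
  congr 1
  funext i
  simp [coord]

theorem ker_coord (r : ℕ) (τ : ℍ) (t v : V) :
    b.ker r (τ, fun i => (b.coord t i : ℂ)) v = e (-(r * L.form v t)) * b.ker r (τ, 0) v := by
  rw [ker, prodKernel_ofReal, b.sum_weight, ker, e]
  congr 2
  push_cast
  ring

theorem ker_I_zero (r : ℕ) (v : V) : ∃ t : ℝ, 0 < t ∧ b.ker r (UpperHalfPlane.I, 0) v = t :=
  ⟨_, Finset.prod_pos fun _ _ => Real.exp_pos _, prodKernel_I_zero _ _⟩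

/-- The lattice spanned by the orthogonal basis. -/
def sub : Submodule ℤ V := Submodule.span ℤ (Set.range b.basis)

theorem sub_le : b.sub ≤ L.lat :=
  Submodule.span_le.2 (by rintro _ ⟨i, rfl⟩; exact b.mem i)

theorem mem_sub {v : V} : v ∈ b.sub ↔ ∃ k : Fin L.dim → ℤ, v = ∑ i, (k i : ℚ) • b.basis i := by
  rw [sub, Module.Basis.mem_span_iff_repr_mem]
  constructor
  · intro h
    choose k hk using h
    refine ⟨k, ?_⟩
    conv_lhs => rw [← b.basis.sum_repr v]
    refine Finset.sum_congr rfl fun i _ => ?_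
    rw [← hk]
    simp
  · rintro ⟨k, rfl⟩ i
    refine ⟨k i, ?_⟩
    rw [Module.Basis.repr_sum_self]
    simp

/-- The dual of the lattice spanned by the orthogonal basis, with respect to the form scaled
by `r`. -/
def subDual (r : ℕ) : Set V := {v | ∀ i, ∃ n : ℤ, r * L.form v (b.basis i) = n}

theorem dual_subset_subDual (r : ℕ) {v : V} (hv : v ∈ L.dual r) : v ∈ b.subDual r :=
  fun i => L.mem_dual.1 hv _ (b.mem i)

theorem mem_subDual (r : ℕ) [hr : NeZero r] {v : V} : v ∈ b.subDual r ↔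
    ∃ k : Fin L.dim → ℤ, v = ∑ i, ((k i : ℚ) / (r * b.diag i)) • b.basis i := by
  have hr0 : (r : ℚ) ≠ 0 := by exact_mod_cast hr.out
  constructor
  · intro h
    choose k hk using h
    refine ⟨k, ?_⟩
    conv_lhs => rw [← b.basis.sum_repr v]
    refine Finset.sum_congr rfl fun i _ => ?_
    congr 1
    have := hk i
    rw [b.form_basis] at this
    have := b.diag_ne_zero i
    field_simp
    linarith
  · rintro ⟨k, rfl⟩ i
    refine ⟨k i, ?_⟩
    rw [b.form_basis, Module.Basis.repr_sum_self]
    have := b.diag_ne_zero i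
    field_simp

/-- In the orthogonal basis the points of `subDual r` have coordinates `k / weight` with `k`
integral, so the series is dominated by a product of absolutely convergent one-variable series. -/
theorem summable_ker (r : ℕ) [NeZero r] (x : ℍ × (Fin L.dim → ℂ)) {f : V → ℂ} {B : ℝ}
    (hB : ∀ v, ‖f v‖ ≤ B) (hf : ∀ v, v ∉ b.subDual r → f v = 0) :
    Summable fun v => f v * b.ker r x v := by
  let j : (Fin L.dim → ℤ) → V := fun k => ∑ i, ((k i : ℚ) / (r * b.diag i)) • b.basis i
  have hj : Function.Injective j := by
    intro k k' h
    funext i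
    have h1 := congrArg (fun v => b.basis.repr v i) h
    simp only [j, Module.Basis.repr_sum_self] at h1
    have hr0 : (r : ℚ) ≠ 0 := by exact_mod_cast NeZero.ne r
    have := b.diag_ne_zero i
    field_simp at h1
    exact_mod_cast h1
  refine (hj.summable_iff fun v hv => ?_).1 ?_
  · rw [hf v, zero_mul]
    intro h
    obtain ⟨k, hk⟩ := (b.mem_subDual r).1 h
    exact hv ⟨k, hk.symm⟩
  · have h1 := summable_prodKernel (b.weight_ne_zero r) x.1 x.2 0
      (fun i => inv_ne_zero (b.weight_ne_zero r i))
    refine Summable.of_norm_bounded (h1.mul_left B) fun k => ?_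
    rw [Function.comp, norm_mul]
    have : b.ker r x (j k) = prodKernel (b.weight r) x.1 x.2
        (fun i => (0 : Fin L.dim → ℝ) i + k i * (b.weight r i)⁻¹) := by
      rw [ker]
      congr 1
      funext i
      simp only [coord, j, Module.Basis.repr_sum_self, weight, Pi.zero_apply]
      push_cast
      rw [zero_add, div_eq_mul_inv]
    rw [this]
    exact mul_le_mul_of_nonneg_right (hB _) (norm_nonneg _)

/-- Poisson summation for the lattice spanned by the orthogonal basis. -/
theorem tsum_ker_sub (r : ℕ) [NeZero r] (x x' : ℍ × (Fin L.dim → ℂ)) (hτ : (x'.1 : ℂ) = -1 / x.1)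
    (hz : ∀ i, x'.2 i = -x.2 i / x.1) (v₀ : V) :
    ∑' v, (if v - v₀ ∈ b.sub then 1 else 0) * b.ker r x' v =
      (∏ i, inversionFactor (b.weight r i) x.1) *
        ∑' v, (if v ∈ b.subDual r then e (-(r * L.form v₀ v)) else 0) * b.ker r x v := by
  have hr0 : (r : ℚ) ≠ 0 := by exact_mod_cast NeZero.ne r
  let j : (Fin L.dim → ℤ) → V := fun k => ∑ i, ((k i : ℚ) / (r * b.diag i)) • b.basis i
  have hj : Function.Injective j := by
    intro k k' h
    funext i
    have h1 := congrArg (fun v => b.basis.repr v i) h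
    simp only [j, Module.Basis.repr_sum_self] at h1
    have := b.diag_ne_zero i
    field_simp at h1
    exact_mod_cast h1
  let j' : (Fin L.dim → ℤ) → V := fun k => v₀ + ∑ i, (k i : ℚ) • b.basis i
  have hj' : Function.Injective j' := by
    intro k k' h
    funext i
    have h1 := congrArg (fun v => b.basis.repr v i) (add_left_cancel h)
    simp only [Module.Basis.repr_sum_self] at h1
    exact_mod_cast h1
  have h1 := tsum_prodKernel_inversion (b.weight_ne_zero r) x.1 x'.1 x.2 x'.2 (b.coord v₀) hτ hz
  -- Both sums over `V` are supported on lattice points: the left one on `v₀ + sub`, the right one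
  -- on `subDual r`. Each is parametrised by integer vectors, as in the product formula.
  rw [← hj'.tsum_eq, ← hj.tsum_eq]
  · convert h1 using 1
    · refine tsum_congr fun k => ?_
      rw [if_pos, one_mul, ker]
      · congr 1
        funext i
        simp only [j', coord, map_add, Finsupp.add_apply, Module.Basis.repr_sum_self]
        push_cast
        rfl
      · exact b.mem_sub.2 ⟨k, by simp [j']⟩
    · congr 1
      refine tsum_congr fun k => ?_
      rw [if_pos ((b.mem_subDual r).2 ⟨k, rfl⟩)]
      have hc : b.coord (j k) = fun i => k i / b.weight r i := by
        funext i
        simp only [coord, j, Module.Basis.repr_sum_self, weight]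
        push_cast
        rfl
      have hs : ((r * L.form v₀ (j k) : ℚ) : ℝ) = ∑ i, k i * b.coord v₀ i := by
        rw [← b.sum_weight, hc]
        refine Finset.sum_congr rfl fun i _ => ?_
        have := b.weight_ne_zero r i
        field_simp
      rw [ker, hc, ← hs, e]
      congr 2
      push_cast
      ring
  · intro v hv
    by_cases h : v ∈ b.subDual r
    · obtain ⟨k, hk⟩ := (b.mem_subDual r).1 h
      exact ⟨k, hk.symm⟩
    · simp [h] at hv
  · intro v hv
    by_cases h : v - v₀ ∈ b.sub
    · obtain ⟨k, hk⟩ := b.mem_sub.1 h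
      exact ⟨k, by simp [j', ← hk]⟩
    · simp [h] at hv

end OrthoBasis

end EvenLattice

namespace EvenLattice

variable {V : Type*} [AddCommGroup V] [Module ℚ V] (L : EvenLattice V)

/-! ### Lattices and their duals -/

theorem form_comm (x y : V) : L.form x y = L.form y x := L.symm.eq x y

theorem exists_latticeBasis :
    ∃ B : Module.Basis (Fin L.dim) ℚ V, Submodule.span ℤ (Set.range B) = L.lat := by
  have : Module.Finite ℤ L.lat := Module.Finite.iff_fg.2 L.fg
  have : Module.IsTorsionFree ℤ V := Module.IsTorsionFree.trans_faithfulSMul ℤ ℚ V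
  have : Module.Free ℤ L.lat := Module.free_of_finite_type_torsion_free'
  let β := Module.finBasis ℤ L.lat
  have hli : LinearIndependent ℤ (fun i => (β i : V)) :=
    β.linearIndependent.map' L.lat.subtype (Submodule.ker_subtype _)
  have hspan : Submodule.span ℤ (Set.range fun i => (β i : V)) = L.lat := by
    have h1 : (Set.range fun i => (β i : V)) = L.lat.subtype '' Set.range β := by
      rw [← Set.range_comp]; rfl
    rw [h1, ← Submodule.map_span, β.span_eq, Submodule.map_top, Submodule.range_subtype]
  have hliQ : LinearIndependent ℚ (fun i => (β i : V)) :=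
    (LinearIndependent.iff_fractionRing ℤ ℚ).1 hli
  have hsp : ⊤ ≤ Submodule.span ℚ (Set.range fun i => (β i : V)) := by
    rw [← L.span_eq_top, Submodule.span_le]
    intro x hx
    have hx' : x ∈ Submodule.span ℤ (Set.range fun i => (β i : V)) := by rw [hspan]; exact hx
    exact Submodule.span_subset_span ℤ ℚ _ hx'
  let B := Module.Basis.mk hliQ hsp
  have hcard : Module.finrank ℤ L.lat = L.dim := by
    rw [dim, Module.finrank_eq_card_basis B, Fintype.card_fin]
  refine ⟨B.reindex (finCongr hcard), ?_⟩
  rw [Module.Basis.range_reindex, Module.Basis.coe_mk, hspan]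

theorem lat_le_dual (r : ℕ) : L.lat ≤ L.dual r := by
  intro x hx
  rw [mem_dual]
  intro y hy
  obtain ⟨n, hn⟩ := L.integral hx hy
  exact ⟨r * n, by rw [hn]; push_cast; ring⟩

/-- Double duality for the form `r(·,·)`: as `L` has a `ℤ`-basis that is a `ℚ`-basis of `V`, it
equals the dual of its dual. -/
theorem mem_lat_of_forall_dual (r : ℕ) [hr : NeZero r] {y : V}
    (h : ∀ t ∈ L.dual r, ∃ n : ℤ, r * L.form t y = n) : y ∈ L.lat := by
  obtain ⟨B, hB⟩ := L.exists_latticeBasis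
  have hr0 : (r : ℚ) ≠ 0 := by exact_mod_cast hr.out
  have hnd : ((r : ℚ) • L.form).Nondegenerate := by
    refine ⟨fun x hx => L.nondegenerate.1 x fun z => ?_, fun x hx => L.nondegenerate.2 x fun z => ?_⟩
    · simpa [hr0] using hx z
    · simpa [hr0] using hx z
  have hsymm : ((r : ℚ) • L.form).IsSymm := ⟨fun x z => by simp [L.form_comm x z]⟩
  have := LinearMap.BilinForm.dualSubmodule_dualSubmodule_of_basis (R := ℤ) _ hnd hsymm B
  rw [hB] at this
  rw [← this, LinearMap.BilinForm.mem_dualSubmodule]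
  intro t ht
  obtain ⟨n, hn⟩ := h t ht
  rw [Submodule.mem_one]
  refine ⟨n, ?_⟩
  rw [LinearMap.smul_apply, LinearMap.smul_apply, smul_eq_mul, L.form_comm, hn]
  rfl

theorem mkQ_mem_disc {r : ℕ} {v : V} : L.lat.mkQ v ∈ L.disc r ↔ v ∈ L.dual r := by
  constructor
  · rintro ⟨u, hu, h⟩
    have h1 : v - u ∈ L.lat := (Submodule.Quotient.eq L.lat).1 h.symm
    simpa using (L.dual r).add_mem (L.lat_le_dual r h1) hu
  · exact fun h => ⟨v, h, rfl⟩

theorem mkQ_lift (x : V ⧸ L.lat) : L.lat.mkQ (L.lift x) = x := Function.surjInv_eq _ _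

theorem lift_mem_dual {r : ℕ} {x : V ⧸ L.lat} : L.lift x ∈ L.dual r ↔ x ∈ L.disc r := by
  rw [← mkQ_mem_disc, mkQ_lift]

theorem mkQ_eq_iff {u v : V} : L.lat.mkQ u = L.lat.mkQ v ↔ u - v ∈ L.lat :=
  Submodule.Quotient.eq L.lat

/-! ### Character sums over finite quotients -/

theorem finite_quotient_of_span {M N : Submodule ℤ V} (hN : N.FG)
    (hM : Submodule.span ℚ (M : Set V) = ⊤) : Finite (N ⧸ M.submoduleOf N) := by
  have : Module.Finite ℤ N := Module.Finite.iff_fg.2 hN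
  refine Module.finite_of_fg_torsion _ ?_
  intro x
  obtain ⟨v, rfl⟩ := Submodule.mkQ_surjective _ x
  obtain ⟨n, hn, h⟩ := exists_zsmul_mem_of_span hM (v : V)
  refine ⟨⟨n, mem_nonZeroDivisors_of_ne_zero hn⟩, ?_⟩
  change n • (M.submoduleOf N).mkQ v = 0
  rw [← map_smul, Submodule.mkQ_apply, Submodule.Quotient.mk_eq_zero]
  exact h

/-- Orthogonality of characters on `N/M`. -/
theorem sum_e_quotient (r : ℕ) {M N : Submodule ℤ V} [Fintype (N ⧸ M.submoduleOf N)] {y : V}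
    (hy : ∀ t ∈ M, ∃ n : ℤ, r * L.form t y = n) :
    ∑ s : N ⧸ M.submoduleOf N,
      e (-(r * L.form (Function.surjInv (M.submoduleOf N).mkQ_surjective s : N) y)) =
    if ∀ t ∈ N, ∃ n : ℤ, r * L.form t y = n then (Fintype.card (N ⧸ M.submoduleOf N) : ℂ) else 0 := by
  set ρ := Function.surjInv (M.submoduleOf N).mkQ_surjective with hρ
  have hρe : ∀ s, (M.submoduleOf N).mkQ (ρ s) = s := Function.surjInv_eq _
  split_ifs with h
  · rw [Finset.sum_congr rfl fun s _ => show _ = (1 : ℂ) from ?_]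
    · simp
    · obtain ⟨n, hn⟩ := h _ (ρ s).2
      rw [hn, ← Int.cast_neg, e_int]
  · push Not at h
    obtain ⟨t, ht, hne⟩ := h
    have hne1 : e (-(r * L.form t y)) ≠ 1 := by
      rw [Ne, e_eq_one_iff]
      rintro ⟨n, hn⟩
      exact hne (-n) (by push_cast; linarith)
    set τ := (M.submoduleOf N).mkQ ⟨t, ht⟩
    -- Translation by the class of `t`, on which the character is not `1`, permutes the quotient and
    -- multiplies the sum by that value, so the sum is zero.
    have hshift : ∀ s, e (-(r * L.form (ρ (s + τ) : N) y)) =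
        e (-(r * L.form t y)) * e (-(r * L.form (ρ s : N) y)) := by
      intro s
      have h1 : (M.submoduleOf N).mkQ (ρ (s + τ)) = (M.submoduleOf N).mkQ (ρ s + ⟨t, ht⟩) := by
        rw [map_add, hρe, hρe]
      have h2 : ((ρ (s + τ) : N) : V) - (ρ s + t) ∈ M := by
        have := (Submodule.Quotient.eq _).1 h1
        exact this
      obtain ⟨n, hn⟩ := hy _ h2
      rw [← e_add, ← e_add_int _ n]
      congr 1
      rw [map_sub, map_add, LinearMap.sub_apply, LinearMap.add_apply] at hn
      linear_combination -hn
    have hsum : ∑ s, e (-(r * L.form (ρ s : N) y)) =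
        e (-(r * L.form t y)) * ∑ s, e (-(r * L.form (ρ s : N) y)) := by
      rw [Finset.mul_sum, ← Equiv.sum_comp (Equiv.addRight τ)]
      exact Finset.sum_congr rfl fun s _ => hshift s
    have : (1 - e (-(r * L.form t y))) * ∑ s, e (-(r * L.form (ρ s : N) y)) = 0 := by
      rw [sub_mul, one_mul, ← hsum, sub_self]
    exact (mul_eq_zero.1 this).resolve_left (sub_ne_zero.2 hne1.symm)

/-! ### Poisson summation for `L`, and injectivity of the theta map -/

namespace OrthoBasis

variable {L} (b : L.OrthoBasis)

theorem span_sub : Submodule.span ℚ (b.sub : Set V) = ⊤ := by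
  rw [eq_top_iff, ← b.basis.span_eq]
  exact Submodule.span_mono Submodule.subset_span

/-- The index of the span of the orthogonal basis in the lattice. -/
def index : ℕ := Nat.card (L.lat ⧸ b.sub.submoduleOf L.lat)

theorem index_pos : 0 < b.index := by
  have := finite_quotient_of_span L.fg b.span_sub
  exact Nat.card_pos

theorem norm_ite_le (p : Prop) [Decidable p] (z : ℂ) : ‖(if p then z else 0)‖ ≤ ‖z‖ := by
  split_ifs <;> simp

/-- Poisson summation for the cosets of `L` in the dual lattice. -/
theorem tsum_ker_lat (r : ℕ) [NeZero r] (x x' : ℍ × (Fin L.dim → ℂ)) (hτ : (x'.1 : ℂ) = -1 / x.1)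
    (hz : ∀ i, x'.2 i = -x.2 i / x.1) {v₀ : V} (hv₀ : v₀ ∈ L.dual r) :
    ∑' v, (if v - v₀ ∈ L.lat then 1 else 0) * b.ker r x' v =
      (∏ i, inversionFactor (b.weight r i) x.1) * (b.index *
        ∑' v, (if v ∈ L.dual r then e (-(r * L.form v₀ v)) else 0) * b.ker r x v) := by
  have hfin := finite_quotient_of_span L.fg b.span_sub
  let _ : Fintype (L.lat ⧸ b.sub.submoduleOf L.lat) := Fintype.ofFinite _
  set Q := L.lat ⧸ b.sub.submoduleOf L.lat
  set ρ : Q → L.lat := Function.surjInv (b.sub.submoduleOf L.lat).mkQ_surjective with hρ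
  have hρe : ∀ s, (b.sub.submoduleOf L.lat).mkQ (ρ s) = s := Function.surjInv_eq _
  -- The coset `v₀ + L` is a disjoint union of cosets of the diagonal sublattice, to which the
  -- product formula applies.
  have hsplit : ∀ v, (if v - v₀ ∈ L.lat then (1 : ℂ) else 0) =
      ∑ s : Q, if v - (v₀ + ρ s) ∈ b.sub then 1 else 0 := by
    intro v
    split_ifs with h
    · rw [Finset.sum_eq_single ((b.sub.submoduleOf L.lat).mkQ ⟨v - v₀, h⟩), if_pos]
      · have := (Submodule.Quotient.eq _).1 (Function.surjInv_eq
          (b.sub.submoduleOf L.lat).mkQ_surjective ((b.sub.submoduleOf L.lat).mkQ ⟨v - v₀, h⟩)).symm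
        have h2 : v - v₀ - ρ ((b.sub.submoduleOf L.lat).mkQ ⟨v - v₀, h⟩) ∈ b.sub := this
        rwa [sub_sub] at h2
      · intro s _ hs
        rw [if_neg]
        intro h2
        apply hs
        rw [← sub_sub] at h2
        have h3 : (b.sub.submoduleOf L.lat).mkQ ⟨v - v₀, h⟩ = (b.sub.submoduleOf L.lat).mkQ (ρ s) :=
          (Submodule.Quotient.eq _).2 h2
        rw [h3, hρe]
      · simp
    · rw [Finset.sum_eq_zero]
      intro s _
      rw [if_neg]
      intro h2
      refine h ?_
      have := L.lat.add_mem (b.sub_le h2) (ρ s).2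
      convert this using 1
      abel
  have hmem : ∀ (v : V) (s : Q), v - (v₀ + ρ s) ∈ b.sub → v ∈ b.subDual r := by
    intro v s h
    refine b.dual_subset_subDual r ?_
    have h1 := (L.dual r).add_mem (L.lat_le_dual r (b.sub_le h))
      ((L.dual r).add_mem hv₀ (L.lat_le_dual r (ρ s).2))
    simpa using h1
  have hsum1 : ∀ s ∈ (Finset.univ : Finset Q), Summable fun v =>
      (if v - (v₀ + ρ s) ∈ b.sub then (1 : ℂ) else 0) * b.ker r x' v := by
    intro s _
    refine b.summable_ker r x' (B := 1) (fun v => (norm_ite_le _ _).trans (by simp)) fun v hv => ?_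
    rw [if_neg fun h => hv (hmem v s h)]
  have hsum2 : ∀ s ∈ (Finset.univ : Finset Q), Summable fun v =>
      (if v ∈ b.subDual r then e (-(r * L.form (v₀ + ρ s) v)) else 0) * b.ker r x v := by
    intro s _
    refine b.summable_ker r x (B := 1)
      (fun v => (norm_ite_le _ _).trans (by rw [norm_e])) fun v hv => ?_
    rw [if_neg hv]
  rw [tsum_congr fun v => by rw [hsplit v, Finset.sum_mul], Summable.tsum_finsetSum hsum1,
    Finset.sum_congr rfl fun s _ => b.tsum_ker_sub r x x' hτ hz (v₀ + ρ s), ← Finset.mul_sum,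
    ← Summable.tsum_finsetSum hsum2]
  congr 1
  rw [← tsum_mul_left]
  refine tsum_congr fun v => ?_
  rw [← Finset.sum_mul, ← mul_assoc]
  congr 1
  by_cases hv : v ∈ b.subDual r
  · have hy : ∀ t ∈ b.sub, ∃ n : ℤ, r * L.form t v = n := by
      intro t ht
      induction ht using Submodule.span_induction with
      | mem y hy =>
        obtain ⟨i, rfl⟩ := hy
        rw [L.form_comm]
        exact hv i
      | zero => exact ⟨0, by simp⟩
      | add y y' _ _ h1 h2 =>
        obtain ⟨n, hn⟩ := h1
        obtain ⟨m, hm⟩ := h2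
        exact ⟨n + m, by rw [map_add, LinearMap.add_apply, mul_add, hn, hm]; push_cast; rfl⟩
      | smul a y _ h1 =>
        obtain ⟨n, hn⟩ := h1
        refine ⟨a * n, ?_⟩
        rw [← Int.cast_smul_eq_zsmul ℚ, map_smul, LinearMap.smul_apply, smul_eq_mul, mul_left_comm,
          hn]
        push_cast
        rfl
    -- Character orthogonality on `L/sub` kills the points of `subDual r` outside `L(r)'` and
    -- contributes the index at the others.
    have hS := L.sum_e_quotient r (M := b.sub) (N := L.lat) hy
    have hiff : (∀ t ∈ L.lat, ∃ n : ℤ, r * L.form t v = n) ↔ v ∈ L.dual r := by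
      rw [mem_dual]
      simp only [L.form_comm v]
    simp only [if_pos hv, map_add, LinearMap.add_apply, mul_add, neg_add, e_add]
    rw [← Finset.mul_sum, hS, index, Nat.card_eq_fintype_card]
    by_cases h : v ∈ L.dual r
    · rw [if_pos (hiff.2 h), if_pos h, mul_comm]
    · rw [if_neg (hiff.not.2 h), if_neg h, mul_zero, mul_zero]
  · have : v ∉ L.dual r := fun h => hv (b.dual_subset_subDual r h)
    simp [hv, this]

/-! ### Theta functions -/

theorem summable_coeff_ker (r : ℕ) [NeZero r] (f : L.disc r → ℂ) (x : ℍ × (Fin L.dim → ℂ)) :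
    Summable fun v => L.coeff f (L.lat.mkQ v) * b.ker r x v := by
  refine b.summable_ker r x (B := ∑ μ, ‖f μ‖) (fun v => ?_) fun v hv => ?_
  · rw [coeff]
    split_ifs with h
    · exact Finset.single_le_sum (f := fun μ => ‖f μ‖) (fun _ _ => norm_nonneg _)
        (Finset.mem_univ (⟨_, h⟩ : L.disc r))
    · simpa using Finset.sum_nonneg fun _ _ => norm_nonneg _
  · rw [coeff, dif_neg]
    exact fun h => hv (b.dual_subset_subDual r (L.mkQ_mem_disc.1 h))

theorem coeff_add {r : ℕ} (f g : L.disc r → ℂ) (x : V ⧸ L.lat) :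
    L.coeff (f + g) x = L.coeff f x + L.coeff g x := by
  simp only [coeff]; split_ifs <;> simp

theorem coeff_smul {r : ℕ} (a : ℂ) (f : L.disc r → ℂ) (x : V ⧸ L.lat) :
    L.coeff (a • f) x = a * L.coeff f x := by
  simp only [coeff]; split_ifs <;> simp

/-- The theta function of `L(r)` attached to an element of `ℂ[A(r)]`. -/
def theta (r : ℕ) [NeZero r] : (L.disc r → ℂ) →ₗ[ℂ] (ℍ × (Fin L.dim → ℂ) → ℂ) where
  toFun f x := ∑' v, L.coeff f (L.lat.mkQ v) * b.ker r x v
  map_add' f g := by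
    funext x
    rw [Pi.add_apply, ← (b.summable_coeff_ker r f x).tsum_add (b.summable_coeff_ker r g x)]
    exact tsum_congr fun v => by rw [coeff_add, add_mul]
  map_smul' a f := by
    funext x
    rw [Pi.smul_apply, smul_eq_mul, RingHom.id_apply, ← tsum_mul_left]
    exact tsum_congr fun v => by rw [coeff_smul, mul_assoc]

theorem theta_apply (r : ℕ) [NeZero r] (f : L.disc r → ℂ) (x : ℍ × (Fin L.dim → ℂ)) :
    b.theta r f x = ∑' v, L.coeff f (L.lat.mkQ v) * b.ker r x v := rfl

theorem coeff_basisVec {r : ℕ} (μ : L.disc r) (v : V) :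
    L.coeff (L.basisVec μ) (L.lat.mkQ v) = if v - L.lift μ.1 ∈ L.lat then 1 else 0 := by
  rw [coeff, basisVec, ← mkQ_eq_iff, mkQ_lift]
  by_cases h : L.lat.mkQ v = μ
  · rw [if_pos h, dif_pos (h ▸ μ.2), Pi.single_apply, if_pos (Subtype.ext h)]
  · rw [if_neg h]
    split_ifs with h2
    · rw [Pi.single_apply, if_neg fun h3 => h (congrArg Subtype.val h3)]
    · rfl

/-- A theta function that vanishes at `τ = i` and all rational points is attached to `0`. -/
theorem eq_zero_of_theta_eq_zero (r : ℕ) [NeZero r] (f : L.disc r → ℂ)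
    (h : ∀ t : V, b.theta r f (UpperHalfPlane.I, fun i => (b.coord t i : ℂ)) = 0) : f = 0 := by
  funext μ
  have hfin := finite_quotient_of_span (L.dual_fg r) L.span_eq_top
  let _ : Fintype (L.dual r ⧸ L.lat.submoduleOf (L.dual r)) := Fintype.ofFinite _
  set Q := L.dual r ⧸ L.lat.submoduleOf (L.dual r)
  set ρ : Q → L.dual r := Function.surjInv (L.lat.submoduleOf (L.dual r)).mkQ_surjective with hρ
  set v₀ := L.lift μ.1
  have hv₀ : v₀ ∈ L.dual r := L.lift_mem_dual.2 μ.2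
  -- At `z` equal to the coordinates of `t` in `L(r)'`, the theta value is twisted by the character
  -- `v ↦ 𝐞(-r(v,t))`. Multiplying by `𝐞(r(t,v₀))` and summing over `t` modulo `L` isolates the
  -- coset `v₀ + L`, by double duality.
  have h1 : ∀ s : Q, ∑' v, e (-(r * L.form (ρ s : L.dual r) (v - v₀))) *
      (L.coeff f (L.lat.mkQ v) * b.ker r (UpperHalfPlane.I, 0) v) = 0 := by
    intro s
    have := h (ρ s)
    rw [theta_apply] at this
    rw [← mul_zero (e (r * L.form (ρ s : L.dual r) v₀)), ← this, ← tsum_mul_left]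
    refine tsum_congr fun v => ?_
    rw [b.ker_coord, map_sub, mul_sub, neg_sub, sub_eq_add_neg, e_add, L.form_comm v]
    ring
  have hs : ∀ s ∈ (Finset.univ : Finset Q), Summable fun v =>
      e (-(r * L.form (ρ s : L.dual r) (v - v₀))) *
      (L.coeff f (L.lat.mkQ v) * b.ker r (UpperHalfPlane.I, 0) v) := by
    intro s _
    refine Summable.of_norm ?_
    simp only [norm_mul, norm_e, one_mul]
    simpa only [norm_mul] using (b.summable_coeff_ker r f (UpperHalfPlane.I, 0)).norm
  have h2 : ∑' v, (Fintype.card Q * f μ) *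
      ((if v - v₀ ∈ L.lat then 1 else 0) * b.ker r (UpperHalfPlane.I, 0) v) = 0 := by
    have h0 := Finset.sum_eq_zero (fun s (_ : s ∈ (Finset.univ : Finset Q)) => h1 s)
    rw [← Summable.tsum_finsetSum hs] at h0
    refine Eq.trans (tsum_congr fun v => ?_) h0
    rw [← Finset.sum_mul]
    by_cases hv : v ∈ L.dual r
    · have hsub : v - v₀ ∈ L.dual r := (L.dual r).sub_mem hv hv₀
      rw [L.sum_e_quotient r (M := L.lat) (N := L.dual r) (y := v - v₀) fun t ht => by
        rw [L.form_comm]; exact L.mem_dual.1 hsub t ht]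
      by_cases hl : v - v₀ ∈ L.lat
      · have hμ : L.lat.mkQ v = μ.1 := by rw [L.mkQ_eq_iff.2 hl, mkQ_lift]
        rw [if_pos hl, if_pos fun t ht => L.mem_dual.1 ht _ hl, hμ, coeff, dif_pos μ.2]
        ring
      · rw [if_neg hl, if_neg fun h => hl (L.mem_lat_of_forall_dual r h)]
        ring
    · have hl : v - v₀ ∉ L.lat := fun hl => hv (by
        simpa using (L.dual r).add_mem (L.lat_le_dual r hl) hv₀)
      rw [if_neg hl, coeff, dif_neg fun h => hv (L.mkQ_mem_disc.1 h)]
      ring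
  choose κ hκ hker using b.ker_I_zero r
  have h3 : Summable fun v : V => ((if v - v₀ ∈ L.lat then 1 else 0) * κ v : ℝ) := by
    have := (b.summable_coeff_ker r (L.basisVec μ) (UpperHalfPlane.I, 0)).norm
    refine this.congr fun v => ?_
    rw [coeff_basisVec, hker, norm_mul, Complex.norm_of_nonneg (hκ v).le]
    split_ifs <;> simp
  -- What multiplies `f μ` is, up to the number of classes, a sum of positive reals over `v₀ + L`,
  -- hence non-zero.
  have h4 : 0 < ∑' v : V, ((if v - v₀ ∈ L.lat then 1 else 0) * κ v : ℝ) := by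
    refine h3.tsum_pos (fun v => ?_) v₀ ?_
    · split_ifs <;> simp [(hκ v).le]
    · simpa using hκ v₀
  have h5 : ∑' v, ((if v - v₀ ∈ L.lat then 1 else 0) * b.ker r (UpperHalfPlane.I, 0) v) =
      ((∑' v : V, ((if v - v₀ ∈ L.lat then 1 else 0) * κ v : ℝ) : ℝ) : ℂ) := by
    rw [Complex.ofReal_tsum]
    refine tsum_congr fun v => ?_
    rw [hker]
    split_ifs <;> simp
  rw [tsum_mul_left, h5] at h2
  have h6 : (Fintype.card Q : ℂ) ≠ 0 := by exact_mod_cast Fintype.card_ne_zero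
  have h7 : ((∑' v : V, ((if v - v₀ ∈ L.lat then 1 else 0) * κ v : ℝ) : ℝ) : ℂ) ≠ 0 := by
    exact_mod_cast h4.ne'
  exact (mul_eq_zero.1 ((mul_eq_zero.1 h2).resolve_right h7)).resolve_left h6

theorem theta_injective (r : ℕ) [NeZero r] : Function.Injective (b.theta r) := by
  rw [← LinearMap.ker_eq_bot, LinearMap.ker_eq_bot']
  intro f hf
  exact b.eq_zero_of_theta_eq_zero r f fun t => by rw [hf]; rfl

end OrthoBasis

end EvenLattice

/-! ### Action of `S⁻¹` and of upper triangular elements -/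

namespace MetaGL

theorem coe_smul_eq (g : MetaGL) (τ : ℍ) :
    ((g • τ : ℍ) : ℂ) = (((g.mat 0 0 : ℚ) : ℂ) * τ + ((g.mat 0 1 : ℚ) : ℂ)) /
      (((g.mat 1 0 : ℚ) : ℂ) * τ + ((g.mat 1 1 : ℚ) : ℂ)) := by
  rw [smul_def, coe_smul_of_det_pos g.real_det_pos]
  simp [num, denom, real]

theorem tri_mat (A D : ℕ) [NeZero A] [NeZero D] (m : ℤ) :
    ((tri A D m).mat : Matrix (Fin 2) (Fin 2) ℚ) = !![(A : ℚ), (m : ℚ); 0, (D : ℚ)] := rfl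

theorem tri_φ (A D : ℕ) [NeZero A] [NeZero D] (m : ℤ) (τ : ℍ) :
    (tri A D m).φ τ = ((Real.sqrt D : ℝ) : ℂ) := rfl

theorem coe_tri_smul (A D : ℕ) [NeZero A] [NeZero D] (m : ℤ) (τ : ℍ) :
    ((tri A D m • τ : ℍ) : ℂ) = (A * τ + m) / D := by
  rw [coe_smul_eq]
  simp [tri_mat]

theorem sqrt_natCast_sq (D : ℕ) : ((Real.sqrt D : ℝ) : ℂ) ^ 2 = D := by
  rw [← Complex.ofReal_pow, Real.sq_sqrt (Nat.cast_nonneg D)]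
  simp

theorem tri_act {n : ℕ} (A D : ℕ) [NeZero A] [hD : NeZero D] (m : ℤ) (x : ℍ × (Fin n → ℂ))
    (i : Fin n) : ((tri A D m).act x).2 i = A * x.2 i := by
  have hdet : (tri A D m).mat.det.val = A * D := by
    rw [GeneralLinearGroup.val_det_apply, tri_mat, Matrix.det_fin_two]
    simp
  have hD0 : (D : ℂ) ≠ 0 := by exact_mod_cast hD.out
  simp only [act, hdet, tri_φ, sqrt_natCast_sq]
  push_cast
  field_simp

theorem tri_factor {n : ℕ} (c : Fin n → ℝ) (A D : ℕ) [NeZero A] [NeZero D] (m : ℤ) (τ : ℍ) :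
    (tri A D m).factor c τ = ((Real.sqrt D : ℝ) : ℂ) ^ n := by
  simp [factor, tri_φ]

end MetaGL

theorem mpS_inv_mat : ((mpS.1⁻¹).mat : Matrix (Fin 2) (Fin 2) ℚ) = !![0, 1; -1, 0] := by
  have h : ModularGroup.S⁻¹ = ⟨!![0, 1; -1, 0], by simp [Matrix.det_fin_two]⟩ :=
    inv_eq_of_mul_eq_one_right (by decide)
  rw [MetaGL.inv_mat, mpS_mat, ← map_inv, h]
  ext i j
  change algebraMap ℤ ℚ (!![0, 1; -1, 0] i j) = _
  fin_cases i <;> fin_cases j <;> simp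

theorem coe_mpS_inv_smul (τ : ℍ) : ((mpS.1⁻¹ • τ : ℍ) : ℂ) = -1 / τ := by
  have := ne_zero τ
  rw [MetaGL.coe_smul_eq, mpS_inv_mat]
  simp
  field_simp

theorem mpS_inv_φ (τ : ℍ) : (mpS.1⁻¹).φ τ = ((-1 / (τ : ℂ)) ^ (1 / 2 : ℂ))⁻¹ := by
  rw [← coe_mpS_inv_smul, MetaGL.inv_φ]
  have : mpS.1.real⁻¹ = (mpS.1⁻¹).real := by simp [MetaGL.real]
  rw [this]
  rfl

theorem mpS_inv_act {n : ℕ} (x : ℍ × (Fin n → ℂ)) (i : Fin n) :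
    ((mpS.1⁻¹).act x).2 i = -x.2 i / x.1 := by
  have hdet : (mpS.1⁻¹).mat.det.val = 1 := by
    rw [GeneralLinearGroup.val_det_apply, mpS_inv_mat, Matrix.det_fin_two]
    simp
  have hφ : (mpS.1⁻¹).φ x.1 ^ 2 = -x.1 := by
    rw [MetaGL.sq]
    simp [denom, mpS_inv_mat, -MetaGL.inv_mat]
  simp only [MetaGL.act, hdet, hφ]
  simp [div_neg, neg_div]

theorem e_eighth : e (1 / 8) = Complex.exp (Real.pi * Complex.I / 4) := by
  rw [e]
  congr 1
  push_cast
  ring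

theorem conj_e (x : ℚ) : (starRingEnd ℂ) (e x) = e (-x) := by
  rw [e, e, ← Complex.exp_conj]
  congr 1
  simp only [map_mul, Complex.conj_ofReal, Complex.conj_I, Complex.conj_ofNat]
  push_cast
  rw [← Complex.ofReal_ratCast, Complex.conj_ofReal]
  ring

/-- The automorphy factor sees only the signs of the weights, so `c` (the weights of `L`) may differ
from `c'` (those of `L(r)`). Positive weights give the conjugate eighth root of unity. -/
theorem factor_inversion {n : ℕ} (c c' : Fin n → ℝ) (h : ∀ i, c i < 0 ↔ c' i < 0)
    (h0 : ∀ i, c' i ≠ 0) (τ : ℍ) :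
    ((mpS.1⁻¹).factor c τ)⁻¹ * ∏ i, inversionFactor (c' i) τ =
      (∏ i, if c' i < 0 then e (1 / 8) else e (-(1 / 8))) / ∏ i, ((Real.sqrt |c' i| : ℝ) : ℂ) := by
  rw [MetaGL.factor, ← Finset.prod_inv_distrib, ← Finset.prod_mul_distrib, ← Finset.prod_div_distrib]
  refine Finset.prod_congr rfl fun i _ => ?_
  have key := sqrt_inversion (abs_pos.2 (h0 i)) τ
  rw [← e_eighth] at key
  rw [inversionFactor, mpS_inv_φ]
  by_cases hi : c' i < 0
  · rw [if_pos hi, if_pos hi, if_pos ((h i).2 hi), inv_inv, key]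
  · rw [if_neg hi, if_neg hi, if_neg ((h i).not.2 hi), map_inv₀, inv_inv, ← map_mul, key, map_div₀,
      conj_e, Complex.conj_ofReal]

theorem e_sum {ι : Type*} (s : Finset ι) (f : ι → ℚ) : e (∑ i ∈ s, f i) = ∏ i ∈ s, e (f i) := by
  classical
  induction s using Finset.induction_on with
  | empty => simp [e_zero]
  | insert a s ha ih => rw [Finset.sum_insert ha, Finset.prod_insert ha, e_add, ih]

/-! ### Transformation of theta functions under `S` and upper triangular elements -/

namespace EvenLattice

variable {V : Type*} [AddCommGroup V] [Module ℚ V] (L : EvenLattice V)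

namespace OrthoBasis

variable {L} (b : L.OrthoBasis)

theorem sgn_eq : (L.sgn : ℚ) = ∑ i, if b.diag i < 0 then -1 else 1 := by
  have : Invertible (2 : ℚ) := invertibleOfNonzero two_ne_zero
  have hQ : QuadraticMap.Equivalent L.form.toQuadraticMap
      (QuadraticMap.weightedSumSquares ℚ b.diag) := by
    refine ⟨⟨b.basis.equivFun, fun v => ?_⟩⟩
    rw [QuadraticMap.weightedSumSquares_apply, LinearMap.BilinMap.toQuadraticMap_apply, b.form_eq]
    refine Finset.sum_congr rfl fun i _ => ?_
    change b.diag i • (b.basis.equivFun v i * b.basis.equivFun v i) = _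
    rw [Module.Basis.equivFun_apply, smul_eq_mul, mul_assoc]
  rw [sgn, QuadraticForm.sigPos_of_equiv_weightedSumSquares hQ,
    QuadraticForm.sigNeg_of_equiv_weightedSumSquares hQ]
  have h1 : {i | 0 < b.diag i}.ncard = ∑ i, if b.diag i < 0 then 0 else 1 := by
    rw [Set.ncard_eq_toFinset_card', Finset.card_eq_sum_ones, Finset.sum_ite]
    simp only [Finset.sum_const_zero, zero_add]
    refine Finset.sum_congr ?_ fun _ _ => rfl
    ext i
    have := b.diag_ne_zero i
    simp only [Set.mem_toFinset, Set.mem_ofPred_eq, Finset.mem_filter, Finset.mem_univ, true_and,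
      not_lt]
    exact ⟨le_of_lt, fun h => lt_of_le_of_ne h this.symm⟩
  have h2 : {i | b.diag i < 0}.ncard = ∑ i, if b.diag i < 0 then 1 else 0 := by
    rw [Set.ncard_eq_toFinset_card', Finset.card_eq_sum_ones, Finset.sum_ite]
    simp only [Finset.sum_const_zero, add_zero]
    refine Finset.sum_congr ?_ fun _ _ => rfl
    ext i
    simp
  rw [h1, h2]
  push_cast
  rw [← Finset.sum_sub_distrib]
  exact Finset.sum_congr rfl fun i _ => by split_ifs <;> simp

theorem prod_e_eighth : (∏ i, if b.diag i < 0 then e (1 / 8) else e (-(1 / 8))) =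
    e (-(L.sgn : ℚ) / 8) := by
  rw [b.sgn_eq, neg_div, Finset.sum_div, ← Finset.sum_neg_distrib, e_sum]
  refine Finset.prod_congr rfl fun i _ => ?_
  split_ifs <;> norm_num

/-- The factor of the `S`-transformation, up to the eighth root of unity. -/
def const (r : ℕ) : ℝ := b.index / ∏ i, Real.sqrt |b.weight r i|

theorem const_pos (r : ℕ) [NeZero r] : 0 < b.const r :=
  div_pos (by exact_mod_cast b.index_pos)
    (Finset.prod_pos fun i _ => Real.sqrt_pos.2 (abs_pos.2 (b.weight_ne_zero r i)))

/-- The representation slashes by `S⁻¹`, which is `τ ↦ -1/τ`, so this is Poisson summation for `L`.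
The positive constant stays in terms of the basis here; `const_eq` identifies it. -/
theorem slashRep_mpS_theta (r : ℕ) [NeZero r] (μ : L.disc r) :
    slashRep (b.weight 1) mpS.1 (b.theta r (L.basisVec μ)) =
      b.theta r (fun ν => e (-(L.sgn : ℚ) / 8) * b.const r * e (-(r * L.pair μ ν))) := by
  funext x
  have hμ := L.lift_mem_dual.2 μ.2
  rw [slashRep_apply, MetaGL.slash_apply, theta_apply, theta_apply,
    tsum_congr fun v => by rw [coeff_basisVec],
    b.tsum_ker_lat r x _ (coe_mpS_inv_smul x.1) (mpS_inv_act x) hμ, ← mul_assoc,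
    factor_inversion (b.weight 1) (b.weight r)
      (fun i => by rw [b.weight_neg_iff, b.weight_neg_iff]) (b.weight_ne_zero r),
    Finset.prod_congr rfl fun i _ => by rw [if_congr (b.weight_neg_iff r i) rfl rfl],
    b.prod_e_eighth, ← mul_assoc, ← tsum_mul_left]
  refine tsum_congr fun v => ?_
  rw [← mul_assoc]
  congr 1
  rw [coeff]
  by_cases hv : v ∈ L.dual r
  · rw [if_pos hv, dif_pos (L.mkQ_mem_disc.2 hv), const]
    have hl : L.lift (L.lat.mkQ v) - v ∈ L.lat := L.lift_sub_mem v
    obtain ⟨n, hn⟩ := L.mem_dual.1 hμ _ hl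
    have : e (-(r * L.form (L.lift μ.1) v)) = e (-(r * L.pair μ (L.lat.mkQ v))) := by
      rw [← e_add_int _ (-n)]
      congr 1
      rw [pair]
      rw [map_sub] at hn
      push_cast
      linear_combination hn
    rw [this]
    push_cast
    ring
  · rw [if_neg hv, dif_neg (L.mkQ_mem_disc.not.2 hv), mul_zero]

theorem coeff_of_mem {r : ℕ} (f : L.disc r → ℂ) {x : V ⧸ L.lat} (h : x ∈ L.disc r) :
    L.coeff f x = f ⟨x, h⟩ := dif_pos h

/-- Substituting `Dv` for `v` turns the kernel of `L(s)` into that of `L(ADs)`. The phase is a value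
of `q_{sD}`, well defined modulo `ℤ` exactly where it is needed: the coefficient at `Dγ` vanishes
unless `γ` lies in `A(sD)`. -/
theorem slash_tri_theta (s A D r : ℕ) [NeZero s] [NeZero r] [NeZero A] [hD : NeZero D]
    (h : A * D * s = r) (m : ℤ) (f : L.disc s → ℂ) :
    (MetaGL.tri A D m).slash (b.weight 1) (b.theta s f) =
      b.theta r (fun γ => (((Real.sqrt D : ℝ) : ℂ) ^ L.dim)⁻¹ *
        (e (-m * L.q (s * D) γ) * L.coeff f (D • γ.1))) := by
  funext x
  have hD0 : (D : ℚ) ≠ 0 := by exact_mod_cast hD.out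
  have hD1 : D ≠ 0 := hD.out
  have hsmul : ∀ v : V, (D : ℚ) • v = D • v := fun v => Nat.cast_smul_eq_nsmul ℚ D v
  rw [MetaGL.slash_apply, theta_apply, theta_apply, MetaGL.tri_factor, ← tsum_mul_left]
  let E : V ≃ V := (LinearEquiv.smulOfNeZero ℚ V (D : ℚ) hD0).toEquiv
  rw [← E.tsum_eq]
  refine tsum_congr fun v => ?_
  change _ * (L.coeff f (L.lat.mkQ ((D : ℚ) • v)) * b.ker s _ ((D : ℚ) • v)) = _
  rw [b.ker_tri s A D r h m x _ (MetaGL.coe_tri_smul A D m x.1) (MetaGL.tri_act A D m x) v]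
  have hmk : L.lat.mkQ ((D : ℚ) • v) = D • L.lat.mkQ v := by rw [hsmul, map_nsmul]
  have hmem : D • L.lat.mkQ v ∈ L.disc s ↔ v ∈ L.dual (s * D) := by
    rw [← hmk, mkQ_mem_disc, mem_dual, mem_dual]
    refine forall₂_congr fun y _ => exists_congr fun n => ?_
    rw [map_smul, LinearMap.smul_apply, smul_eq_mul]
    push_cast
    rw [mul_assoc]
  by_cases hv : v ∈ L.dual (s * D)
  · have hvr : v ∈ L.dual r := by
      rw [mem_dual] at hv ⊢
      intro y hy
      obtain ⟨n, hn⟩ := hv y hy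
      refine ⟨A * n, ?_⟩
      rw [← h]
      push_cast at hn ⊢
      rw [← hn]
      ring
    rw [coeff_of_mem _ (L.mkQ_mem_disc.2 hvr), hmk]
    obtain ⟨n, hn⟩ := L.q_congr hv
    have : e (-(m * (s * (D * L.form v v / 2)))) = e (-m * L.q (s * D) (L.lat.mkQ v)) := by
      rw [hn, ← e_add_int _ (-(m * n))]
      congr 1
      push_cast
      ring
    rw [this]
    ring
  · have h1 : L.coeff f (D • L.lat.mkQ v) = 0 := by rw [coeff, dif_neg (hmem.not.2 hv)]
    rw [hmk, h1, coeff]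
    split_ifs with h2
    · rw [h1]; ring
    · ring

end OrthoBasis

end EvenLattice

/-! ### Subrepresentations -/

/-- A finite-dimensional subspace that is stable under generators of a group carries a
representation. -/
theorem exists_subrepresentation {G U W : Type*} [Group G] [AddCommGroup U] [Module ℂ U]
    [FiniteDimensional ℂ U] [AddCommGroup W] [Module ℂ W] (π : Representation ℂ G W)
    (θ : U →ₗ[ℂ] W) (hθ : Function.Injective θ) (S : Set G) (hS : Subgroup.closure S = ⊤)
    (h : ∀ g ∈ S, ∀ u, ∃ w, θ w = π g (θ u)) :
    ∃ ρ : Representation ℂ G U, ∀ g u, θ (ρ g u) = π g (θ u) := by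
  have hinj : ∀ g, Function.Injective (π g) := fun g x y hxy => by
    have := congrArg (π g⁻¹) hxy
    simpa only [← Module.End.mul_apply, ← map_mul, inv_mul_cancel, map_one, Module.End.one_apply]
      using this
  -- Stability under generators only gives an inclusion; equality of finite dimensions makes it an
  -- equality, which then passes to inverses and so to the whole group.
  have key : ∀ g, (LinearMap.range θ).map (π g) = LinearMap.range θ := by
    intro g
    have hg : g ∈ Subgroup.closure S := by rw [hS]; trivial
    induction hg using Subgroup.closure_induction with
    | mem g hg =>
      refine Submodule.eq_of_le_of_finrank_eq ?_ ?_
      · rintro _ ⟨_, ⟨u, rfl⟩, rfl⟩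
        obtain ⟨w, hw⟩ := h g hg u
        exact ⟨w, hw⟩
      · exact (Submodule.equivMapOfInjective (π g) (hinj g) _).finrank_eq.symm
    | one => rw [map_one]; exact Submodule.map_id _
    | mul x y _ _ hx hy =>
      rw [map_mul, Module.End.mul_eq_comp, Submodule.map_comp, hy, hx]
    | inv x _ hx =>
      conv_lhs => rw [← hx, ← Submodule.map_comp, ← Module.End.mul_eq_comp, ← map_mul,
        inv_mul_cancel, map_one]
      exact Submodule.map_id _
  -- A left inverse `Λ` of `θ` transports the action: `θ ∘ Λ` is the identity on the stable
  -- subspace, so `Λ ∘ π g ∘ θ` is multiplicative in `g`.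
  obtain ⟨Λ, hΛ⟩ := LinearMap.exists_leftInverse_of_injective θ (LinearMap.ker_eq_bot.2 hθ)
  have hΛ' : ∀ u, Λ (θ u) = u := fun u => LinearMap.congr_fun hΛ u
  have hstab : ∀ g u, θ (Λ (π g (θ u))) = π g (θ u) := by
    intro g u
    have : π g (θ u) ∈ LinearMap.range θ := by
      rw [← key g]
      exact ⟨_, ⟨u, rfl⟩, rfl⟩
    obtain ⟨w, hw⟩ := this
    rw [← hw, hΛ']
  refine ⟨⟨⟨fun g => Λ ∘ₗ π g ∘ₗ θ, ?_⟩, ?_⟩, fun g u => hstab g u⟩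
  · refine LinearMap.ext fun u => ?_
    simp [hΛ']
  · intro g g'
    refine LinearMap.ext fun u => hθ ?_
    simp only [Module.End.mul_apply, LinearMap.comp_apply, hstab, map_mul]

theorem tri_mul_tri (A D A' D' : ℕ) [NeZero A] [NeZero D] [NeZero A'] [NeZero D'] (m m' : ℤ) :
    ((MetaGL.tri A D m * MetaGL.tri A' D' m').mat : Matrix (Fin 2) (Fin 2) ℚ) =
      !![(A * A' : ℚ), (A * m' + m * D' : ℚ); 0, (D * D' : ℚ)] := by
  rw [MetaGL.mul_mat, Units.val_mul, MetaGL.tri_mat, MetaGL.tri_mat, Matrix.mul_fin_two]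
  simp

theorem mpT_inv : mpT.1⁻¹ = MetaGL.tri 1 1 (-1) := by
  refine inv_eq_of_mul_eq_one_right (MetaGL.ext (Units.ext ?_) (funext fun τ => ?_))
  · refine (tri_mul_tri 1 1 1 1 1 (-1)).trans ?_
    rw [MetaGL.one_mat, Units.val_one, Matrix.one_fin_two]
    norm_num
  · change ((Real.sqrt (1 : ℕ) : ℝ) : ℂ) * ((Real.sqrt (1 : ℕ) : ℝ) : ℂ) = 1
    simp

/-! ### The representation on theta functions is the Weil representation -/

namespace EvenLattice

variable {V : Type*} [AddCommGroup V] [Module ℚ V] (L : EvenLattice V)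

theorem e_pair {r : ℕ} {u v : V} (hu : u ∈ L.dual r) (hv : v ∈ L.dual r) :
    e (-(r * L.pair (L.lat.mkQ u) (L.lat.mkQ v))) = e (-(r * L.form u v)) := by
  obtain ⟨y, hy, h⟩ : ∃ y ∈ L.lat, L.lift (L.lat.mkQ u) = u + y :=
    ⟨_, L.lift_sub_mem u, by abel⟩
  obtain ⟨y', hy', h'⟩ : ∃ y ∈ L.lat, L.lift (L.lat.mkQ v) = v + y :=
    ⟨_, L.lift_sub_mem v, by abel⟩
  obtain ⟨a, ha⟩ := L.mem_dual.1 hu y' hy'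
  obtain ⟨b, hb⟩ := L.mem_dual.1 hv y hy
  obtain ⟨c, hc⟩ := L.integral hy hy'
  rw [← e_add_int _ (a + b + r * c)]
  congr 1
  rw [pair, h, h']
  simp only [map_add, LinearMap.add_apply, L.form_comm y v]
  push_cast
  linear_combination -ha - hb - r * hc

theorem eq_sum_basisVec {r : ℕ} [NeZero r] (f : L.disc r → ℂ) : f = ∑ μ, f μ • L.basisVec μ := by
  funext ν
  rw [Finset.sum_apply, Finset.sum_eq_single ν]
  · simp [basisVec]
  · intro μ _ h
    simp [basisVec, h.symm]
  · simp

theorem linearMap_ext {r : ℕ} [NeZero r] {M : Type*} [AddCommMonoid M] [Module ℂ M]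
    {F G : (L.disc r → ℂ) →ₗ[ℂ] M} (h : ∀ μ, F (L.basisVec μ) = G (L.basisVec μ)) : F = G := by
  refine LinearMap.ext fun f => ?_
  rw [L.eq_sum_basisVec f, map_sum, map_sum]
  exact Finset.sum_congr rfl fun μ _ => by rw [map_smul, map_smul, h]

/-- A representation of `Mp₂(ℤ)` on `ℂ[A(r)]` is determined by its values at `S` and `T`. -/
theorem representation_ext {U : Type*} [AddCommGroup U] [Module ℂ U]
    {ρ ρ' : Representation ℂ Mp2Z U} (hS : ρ mpS = ρ' mpS) (hT : ρ mpT = ρ' mpT) : ρ = ρ' := by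
  refine MonoidHom.eq_of_eqOn_dense closure_mpS_mpT ?_
  rintro _ (rfl | rfl)
  · exact hS
  · exact hT

namespace OrthoBasis

variable {L} (b : L.OrthoBasis)

theorem slashRep_mpT_theta (r : ℕ) [NeZero r] (f : L.disc r → ℂ) :
    slashRep (b.weight 1) mpT.1 (b.theta r f) = b.theta r (fun μ => e (L.q r μ) * f μ) := by
  rw [slashRep_apply, mpT_inv, b.slash_tri_theta r 1 1 r (by ring)]
  congr 1
  funext γ
  have h : L.coeff f (1 • γ.1) = f γ := by rw [one_smul, coeff_of_mem f γ.2]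
  rw [h]
  simp

theorem exists_thetaRep (r : ℕ) [NeZero r] : ∃ ρ : Representation ℂ Mp2Z (L.disc r → ℂ),
    ∀ g f, b.theta r (ρ g f) = slashRep (b.weight 1) g.1 (b.theta r f) := by
  refine exists_subrepresentation ((slashRep (b.weight 1)).comp Mp2Z.subtype) (b.theta r)
    (b.theta_injective r) _ closure_mpS_mpT ?_
  rintro _ (rfl | rfl) u
  · choose w hw using fun μ => (⟨_, (b.slashRep_mpS_theta r μ).symm⟩ :
      ∃ w, b.theta r w = slashRep (b.weight 1) mpS.1 (b.theta r (L.basisVec μ)))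
    refine ⟨∑ μ, u μ • w μ, ?_⟩
    conv_rhs => rw [L.eq_sum_basisVec u, map_sum, map_sum]
    rw [map_sum]
    refine Finset.sum_congr rfl fun μ _ => ?_
    rw [map_smul, map_smul, map_smul, hw]
    rfl
  · exact ⟨_, (b.slashRep_mpT_theta r u).symm⟩

/-- The representation of `Mp₂(ℤ)` on `ℂ[A(r)]` given by the action on theta functions. -/
def thetaRep (r : ℕ) [NeZero r] : Representation ℂ Mp2Z (L.disc r → ℂ) :=
  (b.exists_thetaRep r).choose

theorem theta_thetaRep (r : ℕ) [NeZero r] (g : Mp2Z) (f : L.disc r → ℂ) :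
    b.theta r (b.thetaRep r g f) = slashRep (b.weight 1) g.1 (b.theta r f) :=
  (b.exists_thetaRep r).choose_spec g f

theorem thetaRep_mpT (r : ℕ) [NeZero r] (f : L.disc r → ℂ) :
    b.thetaRep r mpT f = fun μ : L.disc r => e (L.q r μ) * f μ :=
  b.theta_injective r (by rw [theta_thetaRep, slashRep_mpT_theta])

theorem thetaRep_mpS_basisVec (r : ℕ) [NeZero r] (μ : L.disc r) :
    b.thetaRep r mpS (L.basisVec μ) =
      fun ν : L.disc r => e (-(L.sgn : ℚ) / 8) * b.const r * e (-(r * L.pair μ ν)) :=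
  b.theta_injective r (by rw [theta_thetaRep, slashRep_mpS_theta])

theorem thetaRep_mpS (r : ℕ) [NeZero r] (f : L.disc r → ℂ) (ν : L.disc r) :
    b.thetaRep r mpS f ν =
      e (-(L.sgn : ℚ) / 8) * b.const r * ∑ μ, f μ * e (-(r * L.pair μ ν)) := by
  conv_lhs => rw [L.eq_sum_basisVec f, map_sum, Finset.sum_apply]
  rw [Finset.mul_sum]
  refine Finset.sum_congr rfl fun μ _ => ?_
  rw [map_smul, thetaRep_mpS_basisVec, Pi.smul_apply, smul_eq_mul]
  ring

/-- `S⁻²` fixes `τ` and sends `z` to `-z`, with automorphy factor of absolute value `1`. The theta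
function of `e_0` is even in `z` because `v ↦ -v` preserves `L`. Comparison at `τ = i` suffices by
`eq_zero_of_theta_eq_zero`. -/
theorem theta_mpS_sq (r : ℕ) [NeZero r] : ∃ κ : ℂ, ‖κ‖ = 1 ∧
    b.thetaRep r (mpS * mpS) (L.basisVec 0) = κ • L.basisVec 0 := by
  set g : MetaGL := mpS.1⁻¹ * mpS.1⁻¹
  have hg : ((mpS * mpS : Mp2Z) : MetaGL)⁻¹ = g := by simp [g]
  have hsmul : mpS.1⁻¹ • mpS.1⁻¹ • (UpperHalfPlane.I : ℍ) = UpperHalfPlane.I := by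
    apply UpperHalfPlane.ext
    rw [coe_mpS_inv_smul, coe_mpS_inv_smul]
    simp
  have hact : ∀ z : Fin L.dim → ℂ, g.act (UpperHalfPlane.I, z) = (UpperHalfPlane.I, -z) := by
    intro z
    rw [MetaGL.act_mul]
    ext1
    · exact hsmul
    · funext i
      rw [mpS_inv_act, mpS_inv_act]
      change -(-z i / _) / ((mpS.1⁻¹ • (UpperHalfPlane.I : ℍ) : ℍ) : ℂ) = -z i
      rw [coe_mpS_inv_smul]
      have := ne_zero (UpperHalfPlane.I)
      field_simp
  have hφ : ‖g.φ UpperHalfPlane.I‖ = 1 := by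
    have h1 : ‖g.φ UpperHalfPlane.I‖ ^ 2 = 1 := by
      have h2 : ∀ τ, ‖(mpS.1⁻¹).φ τ‖ ^ 2 = ‖(τ : ℂ)‖ := by
        intro τ
        rw [← norm_pow, MetaGL.sq]
        simp [denom, mpS_inv_mat, -MetaGL.inv_mat]
      rw [MetaGL.mul_φ, norm_mul, mul_pow, h2, h2]
      rw [show (mpS.1⁻¹).real • UpperHalfPlane.I = mpS.1⁻¹ • UpperHalfPlane.I from rfl,
        coe_mpS_inv_smul]
      simp
    exact (pow_eq_one_iff_of_nonneg (norm_nonneg _) two_ne_zero).1 h1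
  refine ⟨(g.factor (b.weight 1) UpperHalfPlane.I)⁻¹, ?_, ?_⟩
  · rw [norm_inv, MetaGL.factor, norm_prod, Finset.prod_eq_one, inv_one]
    intro i _
    split_ifs
    · exact hφ
    · rw [RCLike.norm_conj]; exact hφ
  · rw [← sub_eq_zero]
    refine b.eq_zero_of_theta_eq_zero r _ fun t => ?_
    rw [map_sub, map_smul, Pi.sub_apply, Pi.smul_apply, theta_thetaRep, slashRep_apply, hg,
      MetaGL.slash_apply, hact, smul_eq_mul, ← mul_sub]
    convert mul_zero _
    rw [sub_eq_zero, theta_apply, theta_apply, ← (Equiv.neg V).tsum_eq]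
    refine tsum_congr fun v => ?_
    rw [Equiv.neg_apply, ker_neg, neg_neg, coeff_basisVec, coeff_basisVec]
    have h0 : L.lift (0 : L.disc r).1 ∈ L.lat := by
      have := L.lift_sub_mem 0
      simpa using this
    congr 2
    apply propext
    rw [L.lat.sub_mem_iff_left h0, L.lat.sub_mem_iff_left h0, L.lat.neg_mem_iff]

/-- The coefficient of `e_0` in `S² e_0` has absolute value `const² · |A(r)|` by the `S`-formula and
`1` by `theta_mpS_sq`. This replaces a computation of the discriminant from the diagonal entries and
the index. -/
theorem const_eq (r : ℕ) [NeZero r] : b.const r = (Real.sqrt (Nat.card (L.disc r)))⁻¹ := by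
  obtain ⟨κ, hκ, h⟩ := b.theta_mpS_sq r
  have h1 := congrFun h 0
  rw [map_mul, Module.End.mul_apply, thetaRep_mpS, thetaRep_mpS_basisVec] at h1
  have h0 : (0 : V) ∈ L.dual r := zero_mem _
  have h2 : ∀ μ : L.disc r, e (-(r * L.pair (0 : L.disc r).1 μ)) = 1 := by
    intro μ
    obtain ⟨v, hv, hvμ⟩ := μ.2
    rw [← hvμ, show ((0 : L.disc r) : V ⧸ L.lat) = L.lat.mkQ 0 by simp, L.e_pair h0 hv]
    simp [e_zero]
  have h3 : ∀ μ : L.disc r, e (-(r * L.pair μ (0 : L.disc r).1)) = 1 := by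
    intro μ
    obtain ⟨v, hv, hvμ⟩ := μ.2
    rw [← hvμ, show ((0 : L.disc r) : V ⧸ L.lat) = L.lat.mkQ 0 by simp, L.e_pair hv h0]
    simp [e_zero]
  simp only [h2, h3, mul_one, Finset.sum_const, Finset.card_univ] at h1
  have h4 := congrArg norm h1
  have hc := b.const_pos r
  rw [norm_mul, norm_mul, norm_e, nsmul_eq_mul, norm_mul, norm_mul, norm_e, Pi.smul_apply, basisVec,
    Pi.single_eq_same, smul_eq_mul, mul_one, hκ, Complex.norm_of_nonneg hc.le,
    Complex.norm_natCast] at h4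
  rw [Nat.card_eq_fintype_card]
  have h5 : (b.const r) ^ 2 = ((Fintype.card (L.disc r) : ℝ))⁻¹ := by
    refine eq_inv_of_mul_eq_one_left ?_
    linarith
  rw [← Real.sqrt_inv, ← h5, Real.sqrt_sq hc.le]

theorem isWeilRep_thetaRep : L.IsWeilRep (b.thetaRep 1) where
  T μ := by
    rw [thetaRep_mpT]
    funext ν
    rw [Pi.smul_apply, smul_eq_mul, basisVec]
    by_cases h : ν = μ
    · rw [h]
    · rw [Pi.single_eq_of_ne h, mul_zero, mul_zero]
  S μ := by
    rw [thetaRep_mpS_basisVec]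
    funext ν
    rw [Pi.smul_apply, Finset.sum_apply, Finset.sum_eq_single ν]
    · rw [const_eq, Pi.smul_apply, basisVec, Pi.single_eq_same]
      simp only [smul_eq_mul, mul_one, Nat.cast_one, one_mul]
      push_cast
      ring
    · intro μ' _ h
      rw [Pi.smul_apply, basisVec, Pi.single_eq_of_ne h.symm, smul_zero]
    · simp

end OrthoBasis

theorem IsWeilRep.eq {L : EvenLattice V} {ρ ρ' : Representation ℂ Mp2Z (L.disc 1 → ℂ)}
    (h : L.IsWeilRep ρ) (h' : L.IsWeilRep ρ') : ρ = ρ' :=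
  representation_ext (L.linearMap_ext fun μ => by rw [h.S, h'.S])
    (L.linearMap_ext fun μ => by rw [h.T, h'.T])

/-- The theta representation of level `1` is the existence witness that the choice in `weilRep`
requires. -/
theorem isWeilRep_weilRep : L.IsWeilRep L.weilRep := by
  obtain ⟨b⟩ := L.exists_orthoBasis
  exact Classical.epsilon_spec ⟨_, b.isWeilRep_thetaRep⟩

theorem OrthoBasis.thetaRep_one {L : EvenLattice V} (b : L.OrthoBasis) : b.thetaRep 1 = L.weilRep :=
  b.isWeilRep_thetaRep.eq L.isWeilRep_weilRep

end EvenLattice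

namespace EvenLattice

variable {V : Type*} [AddCommGroup V] [Module ℚ V] (L : EvenLattice V)

/-! ### The projection `ℂ[A(m²)] → ℂ[A]` -/

theorem nsmul_mem_disc_iff {s D : ℕ} {x : V ⧸ L.lat} : D • x ∈ L.disc s ↔ x ∈ L.disc (s * D) := by
  obtain ⟨v, rfl⟩ := L.lat.mkQ_surjective x
  rw [← map_nsmul, mkQ_mem_disc, mkQ_mem_disc, mem_dual, mem_dual]
  refine forall₂_congr fun y _ => exists_congr fun n => ?_
  rw [← Nat.cast_smul_eq_nsmul ℚ, map_smul, LinearMap.smul_apply, smul_eq_mul]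
  push_cast
  rw [mul_assoc]

theorem disc_mono {s r : ℕ} (h : s ∣ r) : L.disc s ≤ L.disc r := by
  intro x hx
  obtain ⟨k, rfl⟩ := h
  exact L.nsmul_mem_disc_iff.1 ((L.disc s).smul_of_tower_mem k hx)

theorem mem_fiber {r n : ℕ} [NeZero r] {x : V ⧸ L.lat} {γ : L.disc r} :
    γ ∈ L.fiber r n x ↔ n • γ.1 = x := by
  simp [fiber]

/-- The solutions of `mγ = x` form a torsor under `(1/m)L/L`, of order `m^dim`. The hypothesis `m ∣
r` puts all of them into `A(r)`. -/
theorem card_fiber (r m : ℕ) [NeZero r] [hm : NeZero m] (hmr : m ∣ r) {x : V ⧸ L.lat}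
    (hx : x ∈ L.disc 1) : (L.fiber r m x).card = m ^ L.dim := by
  obtain ⟨B, hB⟩ := L.exists_latticeBasis
  have hm0 : (m : ℚ) ≠ 0 := by exact_mod_cast hm.out
  have hlat : ∀ v, v ∈ L.lat ↔ ∀ i, ∃ k : ℤ, B.repr v i = k := by
    intro v
    rw [← hB, Module.Basis.mem_span_iff_repr_mem]
    exact forall_congr' fun i => exists_congr fun k => eq_comm
  let u : (Fin L.dim → Fin m) → V := fun k =>
    (m : ℚ)⁻¹ • (L.lift x + ∑ i, ((k i : ℕ) : ℚ) • B i)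
  have hmu : ∀ k, m • L.lat.mkQ (u k) = x := by
    intro k
    rw [← map_nsmul, ← Nat.cast_smul_eq_nsmul ℚ, smul_inv_smul₀ hm0, map_add, mkQ_lift,
      add_eq_left, Submodule.mkQ_apply, Submodule.Quotient.mk_eq_zero, hlat]
    intro i
    exact ⟨(k i : ℕ), by rw [Module.Basis.repr_sum_self]; simp⟩
  have hmem : ∀ y : V ⧸ L.lat, m • y = x → y ∈ L.disc r := fun y hy =>
    L.disc_mono (by simpa using hmr) (L.nsmul_mem_disc_iff.1 (hy ▸ hx))
  have hrepr : ∀ k i, B.repr (u k) i = (B.repr (L.lift x) i + (k i : ℕ)) / m := by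
    intro k i
    rw [map_smul, map_add, Finsupp.smul_apply, Finsupp.add_apply, Module.Basis.repr_sum_self,
      smul_eq_mul]
    ring
  have hc : m ^ L.dim = (Finset.univ : Finset (Fin L.dim → Fin m)).card := by simp
  rw [hc]
  symm
  refine Finset.card_bij (fun k _ => ⟨L.lat.mkQ (u k), hmem _ (hmu k)⟩)
    (fun k _ => L.mem_fiber.2 (hmu k)) ?_ ?_
  · intro k _ k' _ h
    have h1 := L.mkQ_eq_iff.1 (congrArg Subtype.val h)
    rw [hlat] at h1
    funext i
    obtain ⟨n, hn⟩ := h1 i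
    rw [map_sub, Finsupp.sub_apply, hrepr, hrepr, ← sub_div, add_sub_add_left_eq_sub,
      div_eq_iff hm0] at hn
    have h2 : ((k i : ℕ) : ℤ) - (k' i : ℕ) = n * m := by exact_mod_cast hn
    have h3 : ((k i : ℕ) : ℤ) ≡ (k' i : ℕ) [ZMOD m] :=
      (Int.modEq_iff_dvd.2 ⟨n, by rw [h2, mul_comm]⟩).symm
    exact Fin.ext (Nat.ModEq.eq_of_lt_of_lt (Int.natCast_modEq_iff.1 h3) (k i).2 (k' i).2)
  · intro γ hγ
    have h1 : (m : ℚ) • L.lift γ.1 - L.lift x ∈ L.lat := by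
      rw [← mkQ_eq_iff, Nat.cast_smul_eq_nsmul, map_nsmul, mkQ_lift, mkQ_lift]
      exact L.mem_fiber.1 hγ
    rw [hlat] at h1
    choose a ha using h1
    have hmz : (0 : ℤ) < m := by exact_mod_cast Nat.pos_of_ne_zero hm.out
    refine ⟨fun i => ⟨(a i % m).toNat, ?_⟩, Finset.mem_univ _, Subtype.ext ?_⟩
    · have := Int.emod_lt_of_pos (a i) hmz
      have := Int.emod_nonneg (a i) hmz.ne'
      omega
    · rw [← L.mkQ_lift γ.1]
      change L.lat.mkQ (u _) = _
      rw [mkQ_eq_iff, hlat]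
      intro i
      refine ⟨-(a i / m), ?_⟩
      have h2 := ha i
      rw [map_sub, map_smul, Finsupp.sub_apply, Finsupp.smul_apply, smul_eq_mul] at h2
      have h3 : (((a i % m).toNat : ℕ) : ℚ) = a i - m * ((a i / m : ℤ) : ℚ) := by
        have h4 : (((a i % m).toNat : ℕ) : ℤ) = a i - m * (a i / m) := by
          rw [Int.toNat_of_nonneg (Int.emod_nonneg (a i) hmz.ne'), Int.emod_def]
        exact_mod_cast h4
      rw [map_sub, Finsupp.sub_apply, hrepr, h3, ← h2]
      push_cast
      field_simp
      ring

/-- The map `e_γ ↦ e_{mγ}` if `mγ ∈ A`, and `e_γ ↦ 0` otherwise. -/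
def projMap (r m : ℕ) [NeZero r] : (L.disc r → ℂ) →ₗ[ℂ] (L.disc 1 → ℂ) where
  toFun f ν := ∑ γ ∈ L.fiber r m ν, f γ
  map_add' f g := by funext ν; simp [Finset.sum_add_distrib]
  map_smul' a f := by funext ν; simp [Finset.mul_sum]

theorem projMap_apply (r m : ℕ) [NeZero r] (f : L.disc r → ℂ) (ν : L.disc 1) :
    L.projMap r m f ν = ∑ γ ∈ L.fiber r m ν, f γ := rfl

theorem e_q_nsmul {r m : ℕ} (hmr : m * m = r) {γ : V ⧸ L.lat} (h : m • γ ∈ L.disc 1) (k : ℤ) :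
    e (k * L.q r γ) = e (k * L.q 1 (m • γ)) := by
  obtain ⟨v, rfl⟩ := L.lat.mkQ_surjective γ
  have hv : v ∈ L.dual r := by
    rw [← mkQ_mem_disc]
    exact L.disc_mono ⟨m, by rw [one_mul, hmr]⟩ (L.nsmul_mem_disc_iff.1 h)
  rw [← map_nsmul] at h ⊢
  obtain ⟨a, ha⟩ := L.q_congr hv
  obtain ⟨c, hc⟩ := L.q_congr (L.mkQ_mem_disc.1 h)
  rw [ha, hc, ← e_add_int (k * (r * L.form v v / 2 + a)) (k * (c - a)), ← hmr]
  congr 1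
  rw [← Nat.cast_smul_eq_nsmul ℚ, map_smul, map_smul, LinearMap.smul_apply, smul_eq_mul, smul_eq_mul]
  push_cast
  ring

/-- The fibre is a torsor under the `m`-torsion `(1/m)L/L`. The character given by `μ` is trivial on
this group exactly when `mμ` lies in `A`, and is then constant on the fibre. -/
theorem sum_fiber_e_pair (r m : ℕ) [NeZero r] [hm : NeZero m] (hmr : m * m = r) (μ : L.disc r)
    (ν : L.disc 1) : ∑ γ ∈ L.fiber r m ν, e (-(r * L.pair μ γ)) =
      if m • μ.1 ∈ L.disc 1 then (m : ℂ) ^ L.dim * e (-(1 * L.pair (m • μ.1) ν)) else 0 := by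
  have hm0 : (m : ℚ) ≠ 0 := by exact_mod_cast hm.out
  have hrq : (r : ℚ) = m * m := by rw [← hmr]; push_cast; rfl
  set u := L.lift μ.1
  have hu : u ∈ L.dual r := L.lift_mem_dual.2 μ.2
  have hmu : L.lat.mkQ ((m : ℚ) • u) = m • μ.1 := by
    rw [Nat.cast_smul_eq_nsmul, map_nsmul, mkQ_lift]
  split_ifs with h
  · rw [Finset.sum_congr rfl fun γ hγ =>
      show _ = e (-(1 * L.pair (m • μ.1) ν)) from ?_, Finset.sum_const,
      L.card_fiber r m ⟨m, hmr.symm⟩ ν.2, nsmul_eq_mul]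
    · push_cast; rfl
    · have hmv : L.lat.mkQ ((m : ℚ) • L.lift γ.1) = ν := by
        rw [Nat.cast_smul_eq_nsmul, map_nsmul, mkQ_lift]
        exact L.mem_fiber.1 hγ
      have h1 := L.e_pair (r := 1) (u := (m : ℚ) • u) (v := (m : ℚ) • L.lift γ.1)
        (by rw [← mkQ_mem_disc, hmu]; exact h) (by rw [← mkQ_mem_disc, hmv]; exact ν.2)
      rw [hmu, hmv, Nat.cast_one] at h1
      rw [h1, pair, map_smul, map_smul, LinearMap.smul_apply, smul_eq_mul, smul_eq_mul, hrq]
      congr 1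
      ring
  · rw [← hmu, mkQ_mem_disc, mem_dual] at h
    push Not at h
    obtain ⟨t, ht, hne⟩ := h
    -- Since `mμ` is not in `A`, some `t` in `L` pairs non-integrally with `mμ`; then `t/m` is a
    -- torsion class on which the character is not `1`.
    have hs : (m : ℚ)⁻¹ • t ∈ L.dual r := by
      rw [mem_dual]
      intro y hy
      obtain ⟨n, hn⟩ := L.integral ht hy
      refine ⟨m * n, ?_⟩
      rw [map_smul, LinearMap.smul_apply, smul_eq_mul, hn, hrq]
      push_cast
      field_simp
    set s : L.disc r := ⟨L.lat.mkQ ((m : ℚ)⁻¹ • t), L.mkQ_mem_disc.2 hs⟩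
    have hms : m • s.1 = 0 := by
      change m • L.lat.mkQ ((m : ℚ)⁻¹ • t) = 0
      rw [← map_nsmul, ← Nat.cast_smul_eq_nsmul ℚ, smul_inv_smul₀ hm0, Submodule.mkQ_apply,
        Submodule.Quotient.mk_eq_zero]
      exact ht
    have hne1 : e (-(r * L.form u ((m : ℚ)⁻¹ • t))) ≠ 1 := by
      rw [Ne, e_eq_one_iff]
      rintro ⟨n, hn⟩
      apply hne (-n)
      rw [map_smul, smul_eq_mul, hrq] at hn
      rw [map_smul, LinearMap.smul_apply, smul_eq_mul]
      push_cast
      rw [← hn]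
      field_simp
    have hshift : ∀ γ : L.disc r, e (-(r * L.pair μ (γ + s : L.disc r))) =
        e (-(r * L.form u ((m : ℚ)⁻¹ • t))) * e (-(r * L.pair μ γ)) := by
      intro γ
      have hγ : L.lift γ.1 ∈ L.dual r := L.lift_mem_dual.2 γ.2
      have h1 := L.e_pair hu ((L.dual r).add_mem hγ hs)
      have h2 := L.e_pair hu hγ
      rw [map_add, mkQ_lift, mkQ_lift, map_add, mul_add, neg_add, e_add, ← h2, mkQ_lift,
        mkQ_lift] at h1
      exact h1.trans (mul_comm _ _)
    have hsum : ∑ γ ∈ L.fiber r m ν, e (-(r * L.pair μ γ)) =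
        e (-(r * L.form u ((m : ℚ)⁻¹ • t))) * ∑ γ ∈ L.fiber r m ν, e (-(r * L.pair μ γ)) := by
      rw [Finset.mul_sum]
      symm
      refine Finset.sum_equiv (Equiv.addRight s) (fun γ => ?_) fun γ _ => (hshift γ).symm
      rw [mem_fiber, mem_fiber, Equiv.coe_addRight, Submodule.coe_add, smul_add, hms, add_zero]
    have : (1 - e (-(r * L.form u ((m : ℚ)⁻¹ • t)))) *
        ∑ γ ∈ L.fiber r m ν, e (-(r * L.pair μ γ)) = 0 := by
      rw [sub_mul, one_mul, ← hsum, sub_self]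
    exact (mul_eq_zero.1 this).resolve_left (sub_ne_zero.2 hne1.symm)

namespace OrthoBasis

variable {L} (b : L.OrthoBasis)

theorem const_sq (r m : ℕ) [hm : NeZero m] (hmr : m * m = r) :
    (b.const r : ℂ) * (m : ℂ) ^ L.dim = b.const 1 := by
  have hm0 : (0 : ℝ) < m := by exact_mod_cast Nat.pos_of_ne_zero hm.out
  have h1 : ∏ i, Real.sqrt |b.weight r i| = m ^ L.dim * ∏ i, Real.sqrt |b.weight 1 i| := by
    have h0 : (m : ℝ) ^ L.dim = ∏ _i : Fin L.dim, (m : ℝ) := by simp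
    rw [h0, ← Finset.prod_mul_distrib]
    refine Finset.prod_congr rfl fun i _ => ?_
    rw [weight, weight, ← hmr]
    push_cast
    rw [one_mul, abs_mul, abs_of_nonneg (by positivity), Real.sqrt_mul (by positivity),
      Real.sqrt_mul_self hm0.le]
  have h2 : b.const r * m ^ L.dim = b.const 1 := by
    rw [const, const, h1]
    field_simp
  rw [← h2]
  push_cast
  rfl

/-- In `A(m²)` the `m`-torsion `H` is isotropic, its orthogonal complement consists of the `γ` with
`mγ` in `A`, and multiplication by `m` identifies `H^⊥/H` with `A`. Descent along an isotropic
subgroup commutes with the Weil action; it is checked on `S` and `T`. -/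
theorem projMap_comp_thetaRep (r m : ℕ) [NeZero r] [NeZero m] (hmr : m * m = r) (g : Mp2Z) :
    L.projMap r m ∘ₗ b.thetaRep r g = b.thetaRep 1 g ∘ₗ L.projMap r m := by
  have hg : g ∈ Subgroup.closure {mpS, mpT} := by rw [closure_mpS_mpT]; trivial
  induction hg using Subgroup.closure_induction with
  | mem g hg =>
    rcases hg with rfl | rfl
    · refine LinearMap.ext fun f => funext fun ν => ?_
      rw [LinearMap.comp_apply, LinearMap.comp_apply, thetaRep_mpS, projMap_apply]
      simp only [thetaRep_mpS, projMap_apply]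
      rw [← Finset.mul_sum, Finset.sum_comm]
      simp only [← Finset.mul_sum, L.sum_fiber_e_pair r m hmr]
      rw [← b.const_sq r m hmr]
      simp only [Finset.sum_mul]
      have h1 : ∀ x : L.disc 1, ∑ μ ∈ L.fiber r m x, f μ * e (-((1 : ℕ) * L.pair x ν)) =
          ∑ μ : L.disc r, if m • μ.1 = x then f μ * e (-(1 * L.pair (m • μ.1) ν)) else 0 := by
        intro x
        rw [fiber, Finset.sum_filter]
        refine Finset.sum_congr rfl fun μ _ => ?_
        split_ifs with h
        · rw [h, Nat.cast_one]
        · rfl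
      rw [Finset.sum_congr rfl fun x _ => h1 x, Finset.sum_comm, Finset.mul_sum, Finset.mul_sum]
      refine Finset.sum_congr rfl fun μ _ => ?_
      split_ifs with h
      · rw [Finset.sum_eq_single ⟨m • μ.1, h⟩]
        · rw [if_pos rfl]; ring
        · intro x _ hx
          rw [if_neg fun h2 => hx (Subtype.ext h2.symm)]
        · simp
      · rw [Finset.sum_eq_zero]
        · ring
        · intro x _
          rw [if_neg]
          intro h2
          exact h (h2 ▸ x.2)
    · refine LinearMap.ext fun f => funext fun ν => ?_
      rw [LinearMap.comp_apply, LinearMap.comp_apply, thetaRep_mpT, projMap_apply]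
      simp only [thetaRep_mpT, projMap_apply]
      rw [Finset.mul_sum]
      refine Finset.sum_congr rfl fun γ hγ => ?_
      have h1 := L.mem_fiber.1 hγ
      have h2 := L.e_q_nsmul hmr (γ := γ.1) (h1 ▸ ν.2) 1
      rw [h1] at h2
      simp only [Int.cast_one, one_mul] at h2
      rw [h2]
  | one => simp only [map_one]; rfl
  | mul x y _ _ hx hy =>
    rw [map_mul, map_mul, Module.End.mul_eq_comp, Module.End.mul_eq_comp, ← LinearMap.comp_assoc, hx,
      LinearMap.comp_assoc, hy, LinearMap.comp_assoc]
  | inv x _ hx =>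
    have h1 : b.thetaRep r x ∘ₗ b.thetaRep r x⁻¹ = LinearMap.id := by
      rw [← Module.End.mul_eq_comp, ← map_mul, mul_inv_cancel, map_one]; rfl
    have h2 : b.thetaRep 1 x⁻¹ ∘ₗ b.thetaRep 1 x = LinearMap.id := by
      rw [← Module.End.mul_eq_comp, ← map_mul, inv_mul_cancel, map_one]; rfl
    calc L.projMap r m ∘ₗ b.thetaRep r x⁻¹
        = (b.thetaRep 1 x⁻¹ ∘ₗ b.thetaRep 1 x) ∘ₗ L.projMap r m ∘ₗ b.thetaRep r x⁻¹ := by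
          rw [h2, LinearMap.id_comp]
      _ = b.thetaRep 1 x⁻¹ ∘ₗ (b.thetaRep 1 x ∘ₗ L.projMap r m) ∘ₗ b.thetaRep r x⁻¹ := rfl
      _ = b.thetaRep 1 x⁻¹ ∘ₗ (L.projMap r m ∘ₗ b.thetaRep r x) ∘ₗ b.thetaRep r x⁻¹ := by rw [hx]
      _ = b.thetaRep 1 x⁻¹ ∘ₗ L.projMap r m ∘ₗ (b.thetaRep r x ∘ₗ b.thetaRep r x⁻¹) := rfl
      _ = _ := by rw [h1, LinearMap.comp_id]

end OrthoBasis

/-! ### The extension of the Weil representation to the double coset -/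

/-- The extension by zero `ℂ[A] → ℂ[A(r)]`. -/
def inclMap (r : ℕ) : (L.disc 1 → ℂ) →ₗ[ℂ] (L.disc r → ℂ) where
  toFun f γ := L.coeff f γ
  map_add' f g := by funext ν; simp [OrthoBasis.coeff_add]
  map_smul' a f := by funext ν; simp [OrthoBasis.coeff_smul]

theorem alphaOp_basisVec (p l : ℕ) (μ : L.disc 1) :
    L.alphaOp p l (L.basisVec μ) = L.basisVec (p ^ l • μ) := by
  have : L.basisVec μ = Pi.basisFun ℂ (L.disc 1) μ := by
    rw [Pi.basisFun_apply]; rfl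
  rw [alphaOp, this, Module.Basis.constr_basis]

theorem coeff_basisVec_eq {r : ℕ} (μ : L.disc r) (x : V ⧸ L.lat) :
    L.coeff (L.basisVec μ) x = if x = μ then 1 else 0 := by
  rw [coeff, basisVec]
  by_cases h : x = μ
  · rw [if_pos h, dif_pos (h ▸ μ.2), Pi.single_apply, if_pos (Subtype.ext h)]
  · rw [if_neg h]
    split_ifs with h2
    · rw [Pi.single_apply, if_neg fun h3 => h (congrArg Subtype.val h3)]
    · rfl

/-- `ρ_L⁻¹(α)` factors through level `p^{2l}`: the inclusion is the slash by `α` on theta functions,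
the projection is equivariant. -/
theorem projMap_comp_inclMap (p l : ℕ) [NeZero p] :
    L.projMap (p ^ (2 * l)) (p ^ l) ∘ₗ L.inclMap (p ^ (2 * l)) = L.alphaOp p l := by
  refine L.linearMap_ext fun μ => funext fun ν => ?_
  rw [LinearMap.comp_apply, alphaOp_basisVec, projMap_apply, fiber, Finset.sum_filter]
  simp only [inclMap, LinearMap.coe_mk, AddHom.coe_mk, coeff_basisVec_eq]
  rw [Finset.sum_eq_single ⟨μ.1, L.disc_mono (one_dvd _) μ.2⟩]
  · rw [if_pos rfl, basisVec, Pi.single_apply]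
    refine if_congr ?_ rfl rfl
    rw [Subtype.ext_iff, eq_comm]
    rfl
  · intro γ _ hγ
    rw [if_neg fun h => hγ (Subtype.ext h), ite_self]
  · simp

theorem pow_mul_self_eq (p l : ℕ) : p ^ l * p ^ l = p ^ (2 * l) := by
  rw [two_mul, pow_add]

theorem OrthoBasis.theta_inclMap {L : EvenLattice V} (b : L.OrthoBasis) (p l : ℕ) [NeZero p]
    (f : L.disc 1 → ℂ) : b.theta (p ^ (2 * l)) (L.inclMap (p ^ (2 * l)) f) =
      (alpha p l).slash (b.weight 1) (b.theta 1 f) := by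
  rw [alpha, b.slash_tri_theta 1 (p ^ (2 * l)) 1 (p ^ (2 * l)) (by ring)]
  congr 1
  funext x
  simp [inclMap, e_zero]

/-- The right-hand side contains only the product `γαγ'`, so by injectivity of theta the vector on
the left does not depend on the factorisation. -/
theorem OrthoBasis.theta_thetaRep_inclMap {L : EvenLattice V} (b : L.OrthoBasis) (p l : ℕ) [NeZero p]
    (γ γ' : Mp2Z) (f : L.disc 1 → ℂ) :
    b.theta (p ^ (2 * l)) (b.thetaRep (p ^ (2 * l)) γ'⁻¹
      (L.inclMap (p ^ (2 * l)) (b.thetaRep 1 γ⁻¹ f))) =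
      (γ * alpha p l * γ' : MetaGL).slash (b.weight 1) (b.theta 1 f) := by
  rw [MetaGL.slash_mul, MetaGL.slash_mul, b.theta_thetaRep, b.theta_inclMap, b.theta_thetaRep,
    slashRep_apply, slashRep_apply]
  simp

/-- Equivariance of the projection moves `γ'⁻¹` from level `p^{2l}` down to level `1`. Any
coefficient vector `w` of the slashed theta function therefore determines the operator. -/
theorem OrthoBasis.comp_alphaOp_eq {L : EvenLattice V} (b : L.OrthoBasis) (p l : ℕ) [NeZero p]
    (γ γ' : Mp2Z) {f : L.disc 1 → ℂ} {w : L.disc (p ^ (2 * l)) → ℂ}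
    (h : b.theta (p ^ (2 * l)) w =
      (γ * alpha p l * γ' : MetaGL).slash (b.weight 1) (b.theta 1 f)) :
    (L.weilRep γ'⁻¹ ∘ₗ L.alphaOp p l ∘ₗ L.weilRep γ⁻¹) f = L.projMap (p ^ (2 * l)) (p ^ l) w := by
  have hw : w = b.thetaRep (p ^ (2 * l)) γ'⁻¹
      (L.inclMap (p ^ (2 * l)) (b.thetaRep 1 γ⁻¹ f)) := by
    exact b.theta_injective _ (by rw [h, b.theta_thetaRep_inclMap])
  rw [hw, ← LinearMap.comp_apply, b.projMap_comp_thetaRep _ _ (pow_mul_self_eq p l),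
    ← b.thetaRep_one, ← L.projMap_comp_inclMap]
  rfl

theorem weilInv_mul_alpha_mul (p l : ℕ) [NeZero p] (γ γ' : Mp2Z) :
    L.weilInv p l (γ * alpha p l * γ') =
      L.weilRep γ'⁻¹ ∘ₗ L.alphaOp p l ∘ₗ L.weilRep γ⁻¹ := by
  obtain ⟨b⟩ := L.exists_orthoBasis
  have h : ∃ g : Mp2Z × Mp2Z, (γ * alpha p l * γ' : MetaGL) = g.1 * alpha p l * g.2 := ⟨(γ, γ'), rfl⟩
  rw [weilInv, dif_pos h]
  have hs := h.choose_spec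
  refine LinearMap.ext fun f => ?_
  have hw := b.theta_thetaRep_inclMap p l γ γ' f
  rw [b.comp_alphaOp_eq p l γ γ' hw, b.comp_alphaOp_eq p l _ _ (hs ▸ hw)]

/-- Membership in the double coset is needed, but no explicit decomposition: the triangular formula
supplies the coefficient vector, and projecting it sums over a fibre. -/
theorem weilInv_tri (p l : ℕ) [NeZero p] (A D : ℕ) [NeZero A] [NeZero D] (h : A * D = p ^ (2 * l))
    (m : ℤ) (hD : ∃ g : Mp2Z × Mp2Z, MetaGL.tri A D m = g.1 * alpha p l * g.2)
    (f : L.disc 1 → ℂ) (ν : L.disc 1) :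
    L.weilInv p l (MetaGL.tri A D m) f ν = (((Real.sqrt D : ℝ) : ℂ) ^ L.dim)⁻¹ *
      ∑ γ ∈ L.fiber (p ^ (2 * l)) (p ^ l) ν, e (-m * L.q D γ) * L.coeff f (D • γ.1) := by
  obtain ⟨b⟩ := L.exists_orthoBasis
  obtain ⟨g, hg⟩ := hD
  have hw := b.slash_tri_theta 1 A D (p ^ (2 * l)) (by rw [mul_one, h]) m f
  have := b.comp_alphaOp_eq p l g.1 g.2 (hg ▸ hw.symm)
  rw [hg, weilInv_mul_alpha_mul, this, projMap_apply, Finset.mul_sum]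
  simp only [one_mul]

end EvenLattice

/-! ### The left cosets in the double coset of `α` -/

theorem mem_doubleCoset_alpha {p l : ℕ} [NeZero p] {δ : MetaGL} :
    δ ∈ DoubleCoset.doubleCoset (alpha p l) (Mp2Z : Set MetaGL) (Mp2Z : Set MetaGL) ↔
      ∃ g : Mp2Z × Mp2Z, δ = g.1 * alpha p l * g.2 := by
  rw [DoubleCoset.mem_doubleCoset]
  constructor
  · rintro ⟨x, hx, y, hy, h⟩
    exact ⟨(⟨x, hx⟩, ⟨y, hy⟩), h⟩
  · rintro ⟨⟨x, y⟩, h⟩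
    exact ⟨x, x.2, y, y.2, h⟩

/-- The integral matrix of an element of `SL₂(ℤ)`, with rational entries. -/
theorem mapGL_coe (g : SL(2, ℤ)) : (SpecialLinearGroup.mapGL ℚ g : Matrix (Fin 2) (Fin 2) ℚ) =
    (g : Matrix (Fin 2) (Fin 2) ℤ).map (Int.cast : ℤ → ℚ) := rfl

theorem map_intCast_of (a b c d : ℤ) : (!![a, b; c, d]).map (Int.cast : ℤ → ℚ) =
    !![(a : ℚ), (b : ℚ); (c : ℚ), (d : ℚ)] := by
  ext i j
  fin_cases i <;> fin_cases j <;> rfl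

theorem exists_mp2Z_of_mat_eq {g h : MetaGL} (A : SL(2, ℤ))
    (hm : (g.mat : Matrix (Fin 2) (Fin 2) ℚ) =
      (A : Matrix (Fin 2) (Fin 2) ℤ).map (Int.cast : ℤ → ℚ) * (h.mat : Matrix (Fin 2) (Fin 2) ℚ)) :
    ∃ k : Mp2Z, g = k * h := by
  obtain ⟨a, -, ha⟩ := exists_mp2Z_lift A
  have hmat : g.mat = (a.1 * h).mat := by
    refine Units.ext ?_
    rw [hm, MetaGL.mul_mat, ha, Units.val_mul, mapGL_coe]
  obtain ⟨k, -, hk⟩ := exists_eq_mul_of_mat_eq hmat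
  exact ⟨k * a, by rw [hk, Subgroup.coe_mul, mul_assoc]⟩

theorem exists_of_mat_eq_mul_alpha_mul {p l : ℕ} [NeZero p] {δ : MetaGL} (A B : SL(2, ℤ))
    (hm : (δ.mat : Matrix (Fin 2) (Fin 2) ℚ) =
      (A : Matrix (Fin 2) (Fin 2) ℤ).map (Int.cast : ℤ → ℚ) *
        (!![((p ^ (2 * l) : ℕ) : ℚ), 0; 0, 1] *
          (B : Matrix (Fin 2) (Fin 2) ℤ).map (Int.cast : ℤ → ℚ))) :
    ∃ g : Mp2Z × Mp2Z, δ = g.1 * alpha p l * g.2 := by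
  obtain ⟨b, -, hb⟩ := exists_mp2Z_lift B
  obtain ⟨k, hk⟩ := exists_mp2Z_of_mat_eq (g := δ) (h := alpha p l * b) A (by
    rw [hm, MetaGL.mul_mat, Units.val_mul, hb, mapGL_coe, alpha, MetaGL.tri_mat]
    simp)
  exact ⟨(k, b), by rw [hk, mul_assoc]⟩

theorem tri_mem_doubleCoset {p l A D : ℕ} [NeZero p] [NeZero A] [NeZero D]
    (h : A * D = p ^ (2 * l)) {m : ℤ} (hm : IsCoprime m (D : ℤ)) :
    ∃ g : Mp2Z × Mp2Z, MetaGL.tri A D m = g.1 * alpha p l * g.2 := by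
  -- Bézout completes the primitive column `(m, D)` to a matrix of `SL₂(ℤ)`, the left factor; the
  -- lower unipotent right factor then clears the first column.
  obtain ⟨x, y, hxy⟩ := hm
  refine exists_of_mat_eq_mul_alpha_mul
    ⟨!![y, m; -x, D], by rw [Matrix.det_fin_two_of]; linarith⟩
    ⟨!![1, 0; x * A, 1], by rw [Matrix.det_fin_two_of]; ring⟩ ?_
  have hq : (x * m + y * D : ℚ) = 1 := by exact_mod_cast hxy
  rw [MetaGL.tri_mat, ← h]
  simp only [map_intCast_of, Matrix.mul_fin_two]
  push_cast
  congr 2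
  · congr 1
    · linear_combination -(A : ℚ) * hq
    · congr 1
      ring
  · congr 2
    · ring
    · congr 1
      ring

/-- Here `m` may be divisible by `p`; the matrix is still primitive because its upper left entry is
`1`. -/
theorem gamma_mem_doubleCoset (p l : ℕ) [NeZero p] (m : ℤ) :
    ∃ g : Mp2Z × Mp2Z, gamma p l m = g.1 * alpha p l * g.2 := by
  refine exists_of_mat_eq_mul_alpha_mul
    ⟨!![0, 1; -1, 0], by rw [Matrix.det_fin_two_of]; ring⟩
    ⟨!![0, -1; 1, m], by rw [Matrix.det_fin_two_of]; ring⟩ ?_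
  rw [gamma, MetaGL.tri_mat]
  simp only [map_intCast_of, Matrix.mul_fin_two]
  simp

theorem alpha_mem_doubleCoset (p l : ℕ) [NeZero p] :
    ∃ g : Mp2Z × Mp2Z, alpha p l = g.1 * alpha p l * g.2 := ⟨(1, 1), by simp⟩

theorem pow_sub_mul_pow_eq (p : ℕ) {a n : ℕ} (h : a ≤ n) : p ^ (n - a) * p ^ a = p ^ n := by
  rw [← pow_add, Nat.sub_add_cancel h]

theorem beta_mem_doubleCoset (p l : ℕ) [NeZero p] {a : ℕ} (ha : a ≤ 2 * l) {m : ℤ}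
    (hm : IsCoprime m (p : ℤ)) : ∃ g : Mp2Z × Mp2Z, beta p l a m = g.1 * alpha p l * g.2 :=
  tri_mem_doubleCoset (pow_sub_mul_pow_eq p ha) (by push_cast; exact hm.pow_right)

theorem isCoprime_unit_val {p a : ℕ} [NeZero p] (ha : a ≠ 0) (u : (ZMod (p ^ a))ˣ) :
    IsCoprime (((u : ZMod (p ^ a)).val : ℕ) : ℤ) (p : ℤ) := by
  rw [Nat.isCoprime_iff_coprime]
  exact Nat.Coprime.coprime_dvd_right (dvd_pow_self p ha) (ZMod.val_coe_unit_coprime u)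

theorem cosetRep_mem (p l : ℕ) [NeZero p] (i) :
    ∃ g : Mp2Z × Mp2Z, cosetRep p l i = g.1 * alpha p l * g.2 := by
  rcases i with _ | ⟨a, u⟩ | u
  · exact alpha_mem_doubleCoset p l
  · have := Finset.mem_Ioo.1 a.2
    exact beta_mem_doubleCoset p l this.2.le (isCoprime_unit_val this.1.ne' u)
  · exact gamma_mem_doubleCoset p l _

/-- Upper triangular elements in the same left coset have the same diagonal and congruent
upper right entries. -/
theorem tri_eq_mul_tri {A D A' D' : ℕ} [hA : NeZero A] [hD : NeZero D] [hA' : NeZero A']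
    [hD' : NeZero D'] {m m' : ℤ} {h : Mp2Z} (heq : MetaGL.tri A D m = h * MetaGL.tri A' D' m') :
    D = D' ∧ m ≡ m' [ZMOD D] := by
  obtain ⟨g, hg⟩ := h.2
  have hg' : h.1.mat = SpecialLinearGroup.mapGL ℚ g := hg.symm
  have h1 := congrArg (fun δ : MetaGL => (δ.mat : Matrix (Fin 2) (Fin 2) ℚ)) heq
  simp only [MetaGL.mul_mat, hg', Units.val_mul, mapGL_coe, MetaGL.tri_mat] at h1
  have h00 := congrFun (congrFun h1 0) 0
  have h01 := congrFun (congrFun h1 0) 1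
  have h10 := congrFun (congrFun h1 1) 0
  have h11 := congrFun (congrFun h1 1) 1
  simp [Matrix.mul_apply, Fin.sum_univ_two] at h00 h01 h10 h11
  have hc : g 1 0 = 0 := h10.resolve_right hA'.out
  have hdet := g.det_coe
  rw [Matrix.det_fin_two, hc, mul_zero, sub_zero] at hdet
  have hApos : (0 : ℤ) < A := by exact_mod_cast Nat.pos_of_ne_zero hA.out
  have hApos' : (0 : ℤ) < A' := by exact_mod_cast Nat.pos_of_ne_zero hA'.out
  have h00' : (A : ℤ) = g 0 0 * A' := by exact_mod_cast h00
  -- The connecting matrix is upper triangular of determinant `1`. Positivity of `A` and `A'`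
  -- excludes diagonal entries `-1`, leaving a translation.
  have hpos : 0 < g 0 0 := by
    by_contra hneg
    nlinarith
  have ha : g 0 0 = 1 := by
    rcases Int.mul_eq_one_iff_eq_one_or_neg_one.1 hdet with h | h
    · exact h.1
    · omega
  rw [ha, one_mul] at hdet
  rw [hc, hdet] at h11
  rw [ha] at h01
  have hDD : D = D' := by simpa using h11
  refine ⟨hDD, ?_⟩
  have h01' : m = m' + g 0 1 * D' := by
    have : (m : ℚ) = m' + g 0 1 * D' := by simpa using h01
    exact_mod_cast this
  rw [h01', hDD]
  exact (Int.modEq_iff_dvd.2 ⟨-g 0 1, by ring⟩)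

/-- Hermite normal form. -/
theorem exists_hermite {r : ℤ} (hr : 0 < r) (N : FixedDetMatrix (Fin 2) ℤ r) :
    ∃ (g : SL(2, ℤ)) (a d m : ℤ), 0 < a ∧ 0 ≤ m ∧ m < d ∧ N.1 = g.1 * !![a, m; 0, d] := by
  induction N using FixedDetMatrices.induction_on hr.ne' with
  | h0 A h10 h00 h01 h2 =>
    have hdet := A.2
    rw [Matrix.det_fin_two, h10, mul_zero, sub_zero] at hdet
    have hd : 0 < A.1 1 1 := by
      by_contra h
      nlinarith
    refine ⟨1, A.1 0 0, A.1 1 1, A.1 0 1, h00, h01, ?_, ?_⟩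
    · rwa [abs_of_nonneg h01, abs_of_pos hd] at h2
    · change A.1 = (1 : Matrix (Fin 2) (Fin 2) ℤ) * _
      rw [one_mul, ← h10]
      exact Matrix.eta_fin_two A.1
  | hS B hB =>
    obtain ⟨g, a, d, m, h1, h2, h3, h4⟩ := hB
    refine ⟨ModularGroup.S * g, a, d, m, h1, h2, h3, ?_⟩
    rw [FixedDetMatrices.smul_coe, h4]
    exact (Matrix.mul_assoc _ _ _).symm
  | hT B hB =>
    obtain ⟨g, a, d, m, h1, h2, h3, h4⟩ := hB
    refine ⟨ModularGroup.T * g, a, d, m, h1, h2, h3, ?_⟩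
    rw [FixedDetMatrices.smul_coe, h4]
    exact (Matrix.mul_assoc _ _ _).symm

/-- Write `d = p^k`. The bound `m < d` forces `m = 0` for `k = 0`; for `0 < k < 2l` primitivity
makes `m` a unit modulo `p^k`; for `k = 2l` there is no condition, as `a = 1`. -/
theorem exists_cosetRep_mat (p l : ℕ) [hp : Fact p.Prime] {a d m : ℕ} (had : a * d = p ^ (2 * l))
    (hm : m < d) (hprim : ¬ (p ∣ a ∧ p ∣ d ∧ p ∣ m)) :
    ∃ i, ((cosetRep p l i).mat : Matrix (Fin 2) (Fin 2) ℚ) = !![(a : ℚ), (m : ℚ); 0, (d : ℚ)] := by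
  have hp0 : p ≠ 0 := hp.out.ne_zero
  obtain ⟨k, hk, rfl⟩ := (Nat.dvd_prime_pow hp.out).1 ⟨a, by rw [← had, mul_comm]⟩
  have ha : a = p ^ (2 * l - k) := by
    rw [← pow_sub_mul_pow_eq p hk] at had
    exact Nat.eq_of_mul_eq_mul_right (pow_pos hp.out.pos k) had
  rcases Nat.eq_zero_or_pos k with rfl | hk0
  · refine ⟨.inl (), ?_⟩
    have : m = 0 := by simpa using hm
    simp [cosetRep, alpha, MetaGL.tri_mat, ha, this]
  · rcases hk.lt_or_eq with hk1 | rfl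
    · have hpm : ¬ p ∣ m := fun h => hprim
        ⟨ha ▸ dvd_pow_self p (by omega), dvd_pow_self p hk0.ne', h⟩
      have hcop : m.Coprime (p ^ k) :=
        Nat.Coprime.pow_right k ((Nat.Prime.coprime_iff_not_dvd hp.out).2 hpm).symm
      refine ⟨.inr (.inl ⟨⟨k, Finset.mem_Ioo.2 ⟨hk0, hk1⟩⟩, ZMod.unitOfCoprime m hcop⟩), ?_⟩
      simp only [cosetRep, beta, MetaGL.tri_mat, ZMod.coe_unitOfCoprime, ZMod.val_natCast,
        Nat.mod_eq_of_lt hm, ha]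
      simp
    · refine ⟨.inr (.inr (m : ZMod (p ^ (2 * l)))), ?_⟩
      simp only [cosetRep, gamma, MetaGL.tri_mat, ZMod.val_natCast, Nat.mod_eq_of_lt hm, ha]
      simp

theorem exists_eq_mul_cosetRep (p l : ℕ) [hp : Fact p.Prime] (g g' : Mp2Z) :
    ∃ i, ∃ h : Mp2Z, (g * alpha p l * g' : MetaGL) = h * cosetRep p l i := by
  obtain ⟨B, hB⟩ := g'.2
  have hB' : g'.1.mat = SpecialLinearGroup.mapGL ℚ B := hB.symm
  have hr : (0 : ℤ) < (p ^ (2 * l) : ℕ) := by exact_mod_cast pow_pos hp.out.pos _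
  let N : FixedDetMatrix (Fin 2) ℤ ((p ^ (2 * l) : ℕ) : ℤ) :=
    ⟨!![((p ^ (2 * l) : ℕ) : ℤ), 0; 0, 1] * B.1, by
      rw [Matrix.det_mul, B.2, Matrix.det_fin_two_of]; ring⟩
  obtain ⟨A, a, d, m, ha, hm, hmd, hN⟩ := exists_hermite hr N
  have hd : 0 < d := lt_of_le_of_lt hm hmd
  lift a to ℕ using ha.le
  lift m to ℕ using hm
  lift d to ℕ using hd.le
  have hdet : a * d = p ^ (2 * l) := by
    have h1 := N.2
    rw [hN, Matrix.det_mul, A.2, Matrix.det_fin_two_of] at h1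
    have : (a * d : ℤ) = (p ^ (2 * l) : ℕ) := by rw [← h1]; ring
    exact_mod_cast this
  -- If `p` divided the normal form, it would divide the bottom row of `αg'`. That is the bottom row
  -- of `g'`, so `p` would divide `det g' = 1`.
  have hprim : ¬ (p ∣ a ∧ p ∣ d ∧ p ∣ m) := by
    rintro ⟨⟨a', rfl⟩, ⟨d', rfl⟩, ⟨m', rfl⟩⟩
    have hN' : !![((p ^ (2 * l) : ℕ) : ℤ), 0; 0, 1] * B.1 =
      A.1 * !![((p * a' : ℕ) : ℤ), ((p * m' : ℕ) : ℤ); 0, ((p * d' : ℕ) : ℤ)] := hN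
    have h10 := congrFun (congrFun hN' 1) 0
    have h11 := congrFun (congrFun hN' 1) 1
    simp [Matrix.mul_apply, Fin.sum_univ_two] at h10 h11
    have hdetB := B.2
    rw [Matrix.det_fin_two] at hdetB
    have : (p : ℤ) ∣ 1 := by
      rw [← hdetB]
      refine Int.dvd_sub (Dvd.dvd.mul_left ?_ _) (Dvd.dvd.mul_left ?_ _)
      · exact ⟨A.1 1 0 * m' + A.1 1 1 * d', by rw [h11]; ring⟩
      · exact ⟨A.1 1 0 * a', by rw [h10]; ring⟩
    exact hp.out.one_lt.ne' (by exact_mod_cast Int.eq_one_of_dvd_one (by positivity) this)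
  obtain ⟨i, hi⟩ := exists_cosetRep_mat p l hdet (by exact_mod_cast hmd) hprim
  obtain ⟨k, hk⟩ := exists_mp2Z_of_mat_eq (g := alpha p l * g') (h := cosetRep p l i) A (by
    have h1 := congrArg (fun M : Matrix (Fin 2) (Fin 2) ℤ => M.map (Int.cast : ℤ → ℚ)) hN
    have h2 : ∀ X Y : Matrix (Fin 2) (Fin 2) ℤ, (X * Y).map (Int.cast : ℤ → ℚ) =
        X.map (Int.cast : ℤ → ℚ) * Y.map (Int.cast : ℤ → ℚ) := fun X Y =>
      Matrix.map_mul (f := Int.castRingHom ℚ)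
    simp only [N, h2, map_intCast_of, Int.cast_natCast, Int.cast_zero, Int.cast_one] at h1
    rw [MetaGL.mul_mat, Units.val_mul, hB', mapGL_coe, alpha, MetaGL.tri_mat, hi]
    simpa using h1)
  exact ⟨i, g * k, by rw [mul_assoc, hk, Subgroup.coe_mul, mul_assoc]⟩

/-- The lower right entry, `1`, `p^a` or `p^{2l}`, is an invariant of the coset and separates the
families; `l > 0` keeps `α` apart from the `γ_b`. -/
theorem cosetRep_injective (p l : ℕ) [hp : Fact p.Prime] (hl : 0 < l) {i j} {h : Mp2Z}
    (heq : cosetRep p l i = h * cosetRep p l j) : i = j := by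
  have hinj : ∀ {a b : ℕ}, p ^ a = p ^ b → a = b := fun h => Nat.pow_right_injective hp.out.two_le h
  have hz : ∀ {n : ℕ} [NeZero n] {x y : ZMod n}, ((x.val : ℕ) : ℤ) ≡ ((y.val : ℕ) : ℤ) [ZMOD n] →
      x = y := by
    intro n _ x y h
    have := (ZMod.natCast_eq_natCast_iff _ _ _).2 (Int.natCast_modEq_iff.1 h)
    simpa using this
  rcases i with _ | ⟨⟨a, ha⟩, u⟩ | u <;> rcases j with _ | ⟨⟨a', ha'⟩, u'⟩ | u'
  · rfl
  · have h1 := (tri_eq_mul_tri heq).1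
    rw [Finset.mem_Ioo] at ha'
    have : 0 = a' := hinj ((pow_zero p).trans h1)
    omega
  · have h1 := (tri_eq_mul_tri heq).1
    have : 0 = 2 * l := hinj ((pow_zero p).trans h1)
    omega
  · have h1 := (tri_eq_mul_tri heq).1
    rw [Finset.mem_Ioo] at ha
    have : 0 = a := hinj ((pow_zero p).trans h1.symm)
    omega
  · obtain ⟨h1, h2⟩ := tri_eq_mul_tri heq
    obtain rfl := hinj h1
    have := Units.ext (hz h2)
    rw [this]
  · have h1 : a = 2 * l := hinj (tri_eq_mul_tri heq).1
    rw [Finset.mem_Ioo] at ha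
    omega
  · have h1 := (tri_eq_mul_tri heq).1
    have : 0 = 2 * l := hinj ((pow_zero p).trans h1.symm)
    omega
  · have h1 : 2 * l = a' := hinj (tri_eq_mul_tri heq).1
    rw [Finset.mem_Ioo] at ha'
    omega
  · rw [hz (tri_eq_mul_tri heq).2]

theorem isCosetSystem_cosetRep (p l : ℕ) [hp : Fact p.Prime] (hl : 0 < l) :
    IsCosetSystem p l (cosetRep p l) := by
  refine ⟨fun i => mem_doubleCoset_alpha.2 (cosetRep_mem p l i), fun δ hδ => ?_⟩
  obtain ⟨⟨g, g'⟩, rfl⟩ := mem_doubleCoset_alpha.1 hδ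
  obtain ⟨i, h, hi⟩ := exists_eq_mul_cosetRep p l g g'
  refine ⟨i, ⟨h, hi⟩, ?_⟩
  rintro j ⟨h', hj⟩
  refine cosetRep_injective p l hl (h := h'⁻¹ * h) ?_
  have h1 := hj.symm.trans hi
  rw [Subgroup.coe_mul, Subgroup.coe_inv, mul_assoc, ← h1, inv_mul_cancel_left]

/-! ### Powers -/

theorem rp_add (n : ℕ) [hn : NeZero n] (x y : ℝ) : rp n (x + y) = rp n x * rp n y := by
  have : (0 : ℝ) < n := by exact_mod_cast Nat.pos_of_ne_zero hn.out
  rw [rp, Real.rpow_add this, Complex.ofReal_mul, rp, rp]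

theorem rp_neg (n : ℕ) (x : ℝ) : rp n (-x) = (rp n x)⁻¹ := by
  rw [rp, Real.rpow_neg n.cast_nonneg, Complex.ofReal_inv, rp]

theorem rp_zpow (n : ℕ) (x : ℝ) (k : ℤ) : rp n x ^ k = rp n (x * k) := by
  rw [rp, rp, Real.rpow_mul n.cast_nonneg, Real.rpow_intCast, Complex.ofReal_zpow]

theorem rp_natPow (n : ℕ) (x : ℝ) (k : ℕ) : rp n x ^ k = rp n (x * k) := by
  simpa using rp_zpow n x k

theorem rp_pow (n k : ℕ) (x : ℝ) : rp (n ^ k) x = rp n (k * x) := by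
  rw [rp, rp, Real.rpow_mul n.cast_nonneg, Real.rpow_natCast, Nat.cast_pow]

theorem natCast_pow_eq_rp (n k : ℕ) : ((n ^ k : ℕ) : ℂ) = rp n k := by
  rw [rp, Real.rpow_natCast]
  push_cast
  rfl

theorem sqrt_pow_eq_rp (n k : ℕ) : ((Real.sqrt (n ^ k : ℕ) : ℝ) : ℂ) = rp n (k / 2) := by
  rw [rp, Real.sqrt_eq_rpow, Nat.cast_pow, ← Real.rpow_natCast, ← Real.rpow_mul n.cast_nonneg]
  congr 2
  ring

namespace EvenLattice

variable {V : Type*} [AddCommGroup V] [Module ℚ V] (L : EvenLattice V)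

/-! ### Sums over fibres -/

/-- Fibres in `A(r)` for different `r` are finsets of different types. Writing their sums over all
of `(L ⊗ ℚ)/L` makes them comparable term by term. -/
theorem sum_fiber_eq_finsum (r n : ℕ) [NeZero r] (x : V ⧸ L.lat) (F : V ⧸ L.lat → ℂ) :
    ∑ γ ∈ L.fiber r n x, F γ.1 = ∑ᶠ y, if y ∈ L.disc r ∧ n • y = x then F y else 0 := by
  rw [finsum_eq_sum_of_support_subset (s := (L.fiber r n x).map (Function.Embedding.subtype _)),
    Finset.sum_map]
  · refine Finset.sum_congr rfl fun γ hγ => ?_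
    rw [if_pos]
    · rfl
    · exact ⟨γ.2, L.mem_fiber.1 hγ⟩
  · intro y hy
    have hy' : y ∈ L.disc r ∧ n • y = x := by
      by_contra h
      exact hy (if_neg h)
    simp only [Finset.coe_map, Set.mem_image, Finset.mem_coe]
    exact ⟨⟨y, hy'.1⟩, L.mem_fiber.2 hy'.2, rfl⟩

theorem q_eq_mul {r s t : ℕ} (h : r * s = t) (x : V ⧸ L.lat) : L.q t x = r * L.q s x := by
  rw [q, q, ← h]
  push_cast
  ring

theorem Δ_eq {r k n : ℕ} (h : k * n = r) (hk : 0 < k) (x : V ⧸ L.lat) :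
    L.Δ r k x = if n • x ∈ L.disc 1 then 1 else 0 := by
  rw [Δ, ← h, Nat.mul_div_cancel_left _ hk]
  simp only [L.nsmul_mem_disc_iff, one_mul]

/-! ### Values of the extension of the Weil representation -/

theorem weilInv_alpha (p l : ℕ) [NeZero p] (μ : L.disc 1) :
    L.weilInv p l (alpha p l) (L.basisVec μ) = L.basisVec (p ^ l • μ) := by
  have h := L.weilInv_mul_alpha_mul p l 1 1
  simp only [Subgroup.coe_one, one_mul, mul_one, inv_one, map_one] at h
  rw [h, ← L.alphaOp_basisVec]
  rfl

theorem sum_fiber_smul_basisVec_apply {r n : ℕ} [NeZero r] (x : V ⧸ L.lat) (c : L.disc r → ℂ)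
    (ν : L.disc r) : (∑ μ ∈ L.fiber r n x, c μ • L.basisVec μ) ν =
      if n • ν.1 = x then c ν else 0 := by
  simp [Finset.sum_apply, basisVec, Pi.single_apply, mem_fiber]

/-- On the fibre `p^l γ = ν` the summand depends only on `ν`, since `q_{p^{2l}}(γ) = q(ν)` modulo
`ℤ` and `p^{2l}γ = p^l ν`. The `p^{l dim}` fibre points cancel the normalising factor. -/
theorem weilInv_gamma (p l : ℕ) [NeZero p] (b : ℤ) (μ : L.disc 1) :
    L.weilInv p l (gamma p l b) (L.basisVec μ) =
      ∑ ν ∈ L.fiber 1 (p ^ l) μ, e (-b * L.q 1 ν) • L.basisVec ν := by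
  funext ν
  have hp : (p : ℂ) ≠ 0 := by exact_mod_cast NeZero.ne p
  have hs : ((Real.sqrt ((p ^ (2 * l) : ℕ) : ℝ) : ℝ) : ℂ) = ((p ^ l : ℕ) : ℂ) := by
    rw [← pow_mul_self_eq, Nat.cast_mul, Real.sqrt_mul_self (Nat.cast_nonneg _)]
    simp
  rw [gamma, L.weilInv_tri p l 1 (p ^ (2 * l)) (one_mul _) b (gamma_mem_doubleCoset p l b),
    L.sum_fiber_smul_basisVec_apply, hs]
  have h1 : ∀ γ ∈ L.fiber (p ^ (2 * l)) (p ^ l) ν,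
      e (-b * L.q (p ^ (2 * l)) γ) * L.coeff (L.basisVec μ) (p ^ (2 * l) • γ.1) =
      if p ^ l • ν.1 = μ.1 then e (-b * L.q 1 ν) else 0 := by
    intro γ hγ
    rw [L.mem_fiber] at hγ
    have h2 := L.e_q_nsmul (pow_mul_self_eq p l) (γ := γ.1) (hγ ▸ ν.2) (-b)
    rw [Int.cast_neg, hγ] at h2
    have h3 : p ^ (2 * l) • γ.1 = p ^ l • ν.1 := by rw [← hγ, ← mul_smul, pow_mul_self_eq]
    rw [h2, coeff_basisVec_eq, h3, mul_ite, mul_one, mul_zero]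
  rw [Finset.sum_congr rfl h1, Finset.sum_const, L.card_fiber _ _ ⟨p ^ l, (pow_mul_self_eq p l).symm⟩
    ν.2, nsmul_eq_mul, Nat.cast_pow (p ^ l), inv_mul_cancel_left₀]
  push_cast
  exact pow_ne_zero _ (pow_ne_zero _ hp)

/-- The sum runs over `γ` with `p^a γ = μ` and `p^l γ = ν`. For `a ≤ l` the first equation implies
`ν = p^{l-a}μ`, so a single basis vector survives. -/
theorem weilInv_beta_of_le (p l : ℕ) [NeZero p] {a : ℕ} (ha : a ≤ l) {b : ℤ}
    (hb : IsCoprime b (p : ℤ)) (μ : L.disc 1) :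
    L.weilInv p l (beta p l a b) (L.basisVec μ) =
      rp p (-((a : ℝ) / 2 * L.dim)) •
        ∑ δ ∈ L.fiber (p ^ a) (p ^ a) μ,
          e (-b * L.q (p ^ a) δ) • L.basisVec (p ^ (l - a) • μ) := by
  have ha2 : a ≤ 2 * l := by omega
  funext ν
  rw [beta, L.weilInv_tri p l _ _ (pow_sub_mul_pow_eq p ha2) b (beta_mem_doubleCoset p l ha2 hb),
    Pi.smul_apply, Finset.sum_apply, smul_eq_mul, rp_neg, sqrt_pow_eq_rp, rp_natPow]
  congr 1
  have h1 := L.sum_fiber_eq_finsum (p ^ (2 * l)) (p ^ l) ν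
    fun γ => e (-b * L.q (p ^ a) γ) * L.coeff (L.basisVec μ) (p ^ a • γ)
  have h2 := L.sum_fiber_eq_finsum (p ^ a) (p ^ a) μ
    fun γ => e (-b * L.q (p ^ a) γ) * L.basisVec (p ^ (l - a) • μ) ν
  refine h1.trans (Eq.trans ?_ h2.symm)
  refine finsum_congr fun γ => ?_
  rw [coeff_basisVec_eq]
  by_cases h : p ^ a • γ = μ.1
  · have h3 : γ ∈ L.disc (p ^ a) := by
      have := L.nsmul_mem_disc_iff.1 (h ▸ μ.2 : p ^ a • γ ∈ L.disc 1)
      rwa [one_mul] at this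
    have h4 : γ ∈ L.disc (p ^ (2 * l)) := L.disc_mono (pow_dvd_pow p ha2) h3
    have h5 : p ^ l • γ = p ^ (l - a) • μ.1 := by
      rw [← h, ← mul_smul, pow_sub_mul_pow_eq p ha]
    have h6 : (p ^ (l - a) • μ.1 = ν.1) = (ν = p ^ (l - a) • μ) :=
      propext ⟨fun h => Subtype.ext h.symm, fun h => (congrArg Subtype.val h).symm⟩
    simp only [h, h3, h4, h5, h6, true_and, and_true, if_true, basisVec, Pi.single_apply, mul_one,
      mul_ite, mul_zero]
  · simp only [h, and_false, if_false, mul_zero, ite_self]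

/-- For `a ≥ l` the roles are reversed: `p^l γ = ν` gives `p^a γ = p^{a-l}ν`, so the condition
involving `μ` concerns `ν` alone, and `q_{p^a} = p^{a-l} q_{p^l}`. -/
theorem weilInv_beta_of_ge (p l : ℕ) [NeZero p] {a : ℕ} (ha : l ≤ a) (ha2 : a ≤ 2 * l) {b : ℤ}
    (hb : IsCoprime b (p : ℤ)) (μ : L.disc 1) :
    L.weilInv p l (beta p l a b) (L.basisVec μ) =
      rp p (-((a : ℝ) / 2 * L.dim)) •
        ∑ ν ∈ L.fiber 1 (p ^ (a - l)) μ,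
          ∑ δ ∈ L.fiber (p ^ l) (p ^ l) ν,
            e (-b * p ^ (a - l) * L.q (p ^ l) δ) • L.basisVec ν := by
  funext ν
  simp_rw [← Finset.sum_smul]
  rw [beta, L.weilInv_tri p l _ _ (pow_sub_mul_pow_eq p ha2) b (beta_mem_doubleCoset p l ha2 hb),
    Pi.smul_apply, L.sum_fiber_smul_basisVec_apply, smul_eq_mul, rp_neg, sqrt_pow_eq_rp, rp_natPow]
  congr 1
  have h1 := L.sum_fiber_eq_finsum (p ^ (2 * l)) (p ^ l) ν
    fun γ => e (-b * L.q (p ^ a) γ) * L.coeff (L.basisVec μ) (p ^ a • γ)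
  have h2 := L.sum_fiber_eq_finsum (p ^ l) (p ^ l) ν
    fun γ => e (-b * p ^ (a - l) * L.q (p ^ l) γ)
  refine h1.trans ?_
  rw [h2]
  have h3 : ∀ γ : V ⧸ L.lat, (if γ ∈ L.disc (p ^ (2 * l)) ∧ p ^ l • γ = ν.1 then
      e (-b * L.q (p ^ a) γ) * L.coeff (L.basisVec μ) (p ^ a • γ) else 0) =
      if p ^ (a - l) • ν.1 = μ.1 then (if γ ∈ L.disc (p ^ l) ∧ p ^ l • γ = ν.1 then
        e (-b * p ^ (a - l) * L.q (p ^ l) γ) else 0) else 0 := by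
    intro γ
    by_cases h : p ^ l • γ = ν.1
    · have h3 : γ ∈ L.disc (p ^ l) := by
        have := L.nsmul_mem_disc_iff.1 (h ▸ ν.2 : p ^ l • γ ∈ L.disc 1)
        rwa [one_mul] at this
      have h4 : γ ∈ L.disc (p ^ (2 * l)) := L.disc_mono (pow_dvd_pow p (by omega)) h3
      have h5 : p ^ a • γ = p ^ (a - l) • ν.1 := by
        rw [← h, ← mul_smul, pow_sub_mul_pow_eq p ha]
      have h6 : -(b : ℚ) * L.q (p ^ a) γ = -b * p ^ (a - l) * L.q (p ^ l) γ := by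
        rw [L.q_eq_mul (pow_sub_mul_pow_eq p ha)]
        push_cast
        ring
      rw [coeff_basisVec_eq, h5, h6]
      simp only [h, h3, h4, and_self, if_true, mul_ite, mul_one, mul_zero]
    · simp only [h, and_false, if_false, ite_self]
  rw [finsum_congr h3]
  split_ifs with h
  · rfl
  · exact finsum_zero

/-! ### The contributions of the cosets -/

theorem bsTerm_eq_weilInv (p l : ℕ) [NeZero p] (w : ℤ) (δ : MetaGL) (ψ : ℍ → L.disc 1 → ℂ) (τ : ℍ) :
    L.bsTerm p l w δ ψ τ = (rp p (2 * l * ((w : ℝ) / 2 - 1)) * δ.φ τ ^ (-w)) •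
      L.weilInv p l δ (ψ (δ • τ)) := by
  conv_rhs => rw [L.eq_sum_basisVec (ψ (δ • τ)), map_sum]
  simp only [bsTerm, map_smul, mul_smul, Finset.smul_sum]

/-- Both `Δ` factors are automatic: the first is `1` on a fibre over `A`, and the second says `p^a γ
∈ A`, which the extension of `ψ` by zero already enforces. The rest is a comparison of powers of
`p`. -/
theorem bsTerm_tri (p l : ℕ) [NeZero p] (w : ℤ) (A D : ℕ) [NeZero A] [NeZero D] {a : ℕ}
    (ha : a ≤ 2 * l) (hA : A = p ^ (2 * l - a)) (hD : D = p ^ a) {b : ℤ}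
    (hmem : ∃ g : Mp2Z × Mp2Z, MetaGL.tri A D b = g.1 * alpha p l * g.2)
    (ψ : ℍ → L.disc 1 → ℂ) (τ : ℍ) :
    L.bsTerm p l w (MetaGL.tri A D b) ψ τ = L.heckeTerm p l w a b ψ τ := by
  subst hA hD
  funext ν
  have hp0 : (p : ℚ) ≠ 0 := by exact_mod_cast NeZero.ne p
  have hpN : 0 < p := Nat.pos_of_ne_zero (NeZero.ne p)
  rw [bsTerm_eq_weilInv, Pi.smul_apply, smul_eq_mul,
    L.weilInv_tri p l _ _ (pow_sub_mul_pow_eq p ha) b hmem, heckeTerm, MetaGL.tri_φ, ← mul_assoc]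
  congr 1
  · rw [sqrt_pow_eq_rp, rp_zpow, rp_natPow, ← rp_neg, ← rp_add, ← rp_add]
    congr 1
    push_cast
    ring
  · refine Finset.sum_congr rfl fun γ hγ => ?_
    rw [L.mem_fiber] at hγ
    have h1 : L.Δ (p ^ (2 * l)) (p ^ l) γ = 1 := by
      rw [L.Δ_eq (pow_mul_self_eq p l) (pow_pos hpN l), if_pos (hγ ▸ ν.2)]
    have h2 := L.Δ_eq (pow_sub_mul_pow_eq p ha) (pow_pos hpN _) γ.1
    have h3 : ofComplex (((p : ℂ) ^ (2 * l - a) * (τ : ℂ) + b) / (p : ℂ) ^ a) =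
        MetaGL.tri (p ^ (2 * l - a)) (p ^ a) b • τ := by
      rw [← ofComplex_apply (MetaGL.tri (p ^ (2 * l - a)) (p ^ a) b • τ), MetaGL.coe_tri_smul]
      push_cast
      rfl
    have h4 : -((b : ℚ) / (p : ℚ) ^ (2 * l - a)) * L.q (p ^ (2 * l)) γ = -b * L.q (p ^ a) γ := by
      rw [L.q_eq_mul (pow_sub_mul_pow_eq p ha)]
      push_cast
      field_simp
    rw [h1, h2, h3, h4]
    by_cases h : p ^ a • γ.1 ∈ L.disc 1
    · rw [if_pos h]; ring
    · rw [if_neg h, coeff, dif_neg h]; ring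

theorem bsTerm_alpha (p l : ℕ) [NeZero p] (w : ℤ) (ψ : ℍ → L.disc 1 → ℂ) (τ : ℍ) :
    L.bsTerm p l w (alpha p l) ψ τ = L.heckeTerm p l w 0 0 ψ τ :=
  L.bsTerm_tri p l w _ _ (Nat.zero_le _) rfl (pow_zero p).symm (alpha_mem_doubleCoset p l) ψ τ

theorem bsTerm_beta (p l : ℕ) [NeZero p] (w : ℤ) {a : ℕ} (ha : a ≤ 2 * l) {b : ℤ}
    (hb : IsCoprime b (p : ℤ)) (ψ : ℍ → L.disc 1 → ℂ) (τ : ℍ) :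
    L.bsTerm p l w (beta p l a b) ψ τ = L.heckeTerm p l w a b ψ τ :=
  L.bsTerm_tri p l w _ _ ha rfl rfl (beta_mem_doubleCoset p l ha hb) ψ τ

theorem bsTerm_gamma (p l : ℕ) [NeZero p] (w : ℤ) (b : ℤ) (ψ : ℍ → L.disc 1 → ℂ) (τ : ℍ) :
    L.bsTerm p l w (gamma p l b) ψ τ = L.heckeTerm p l w (2 * l) b ψ τ :=
  L.bsTerm_tri p l w _ _ le_rfl (by simp) rfl (gamma_mem_doubleCoset p l b) ψ τ

/-! ### Independence of the representatives -/

/-- Modularity turns `ψ(hδτ)` into `φ_h^w ρ_L(h) ψ(δτ)`, which cancels `φ_h^{-w}` and the factor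
`ρ_L(h⁻¹)` of `ρ_L⁻¹(hδ)`. -/
theorem bsTerm_mul {p l : ℕ} [NeZero p] {w : ℤ} {ψ : ℍ → L.disc 1 → ℂ} (hψ : L.IsModularForm w ψ)
    (h : Mp2Z) {δ : MetaGL} (hδ : ∃ g : Mp2Z × Mp2Z, δ = g.1 * alpha p l * g.2) (τ : ℍ) :
    L.bsTerm p l w (h * δ) ψ τ = L.bsTerm p l w δ ψ τ := by
  obtain ⟨⟨g, g'⟩, rfl⟩ := hδ
  set δ : MetaGL := g * alpha p l * g' with hδ
  have h1 : L.weilInv p l (h * δ) = L.weilInv p l δ ∘ₗ L.weilRep h⁻¹ := by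
    have h2 : (h * δ : MetaGL) = (h * g : Mp2Z) * alpha p l * g' := by
      rw [hδ, Subgroup.coe_mul]
      simp only [mul_assoc]
    rw [h2, weilInv_mul_alpha_mul, hδ, weilInv_mul_alpha_mul, _root_.mul_inv_rev, map_mul,
      Module.End.mul_eq_comp, LinearMap.comp_assoc, LinearMap.comp_assoc]
  have h3 : (h.1 * δ) • τ = h.1 • (δ • τ) := by
    simp only [MetaGL.smul_def, MetaGL.mul_real, mul_smul]
  have h4 : (h.1 * δ).φ τ = h.1.φ (δ • τ) * δ.φ τ := rfl
  have h5 : L.weilRep h⁻¹ (L.weilRep h (ψ (δ • τ))) = ψ (δ • τ) :=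
    Representation.inv_self_apply _ _ _
  have h6 := zpow_ne_zero w (h.1.φ_ne_zero (δ • τ))
  rw [bsTerm_eq_weilInv, bsTerm_eq_weilInv, h1, h3, h4, hψ.modular, LinearMap.comp_apply, map_smul,
    map_smul, h5, smul_smul]
  congr 1
  rw [mul_zpow, _root_.zpow_neg, _root_.zpow_neg]
  field_simp

theorem bsHecke_congr {p l : ℕ} [NeZero p] {w : ℤ} {ψ : ℍ → L.disc 1 → ℂ}
    (hψ : L.IsModularForm w ψ) {ι κ : Type*} [Fintype ι] [Fintype κ] {δ : ι → MetaGL}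
    {ε : κ → MetaGL} (hδ : IsCosetSystem p l δ) (hε : IsCosetSystem p l ε) :
    L.bsHecke p l w δ ψ = L.bsHecke p l w ε ψ := by
  funext τ
  choose f hf hf' using fun i => hε.2 (δ i) (hδ.1 i)
  choose h hh using hf
  have hmove : ∀ {x y : MetaGL} {k : Mp2Z}, x = k * y → y = (k⁻¹ : Mp2Z) * x := by
    rintro x y k rfl
    rw [Subgroup.coe_inv, inv_mul_cancel_left]
  refine Fintype.sum_bijective f ⟨fun i j hij => ?_, fun k => ?_⟩ _ _ fun i => ?_
  · refine (hδ.2 (δ i) (hδ.1 i)).unique ⟨1, by simp⟩ ⟨h i * (h j)⁻¹, ?_⟩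
    rw [Subgroup.coe_mul, mul_assoc, ← hmove (hh j), ← hij]
    exact hh i
  · obtain ⟨i, ⟨k', hk'⟩, -⟩ := hδ.2 (ε k) (hε.1 k)
    exact ⟨i, (hf' i k ⟨k'⁻¹, hmove hk'⟩).symm⟩
  · rw [hh i]
    exact L.bsTerm_mul hψ (h i) (mem_doubleCoset_alpha.1 (hε.1 (f i))) τ

/-! ### The decomposition of the operator `ℋ` -/

theorem heckeH_eq_sum (p l : ℕ) [hp : Fact p.Prime] (w : ℤ) (ψ : ℍ → L.disc 1 → ℂ) (τ : ℍ) :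
    L.heckeH (p ^ l) w ψ τ = ∑ a ∈ Finset.range (2 * l + 1),
      ∑ s ∈ Finset.range (p ^ a) with Nat.gcd (Nat.gcd (p ^ (2 * l - a)) (p ^ a)) s = 1,
        L.heckeTerm p l w a s ψ τ := by
  funext μ
  -- The operator lives on `A((p^l)²)` and the terms on `A(p^{2l})`, which are different types; a
  -- free `r` with an equation allows the substitution.
  have key : ∀ (r : ℕ) [NeZero r], r = p ^ (2 * l) →
      (((p ^ l : ℕ) : ℂ) ^ L.dim)⁻¹ * ∑ γ ∈ L.fiber r (p ^ l) μ,
        L.Δ r (p ^ l) γ * L.heckeT r w ψ τ γ = ∑ a ∈ Finset.range (2 * l + 1),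
      ∑ s ∈ Finset.range (p ^ a) with Nat.gcd (Nat.gcd (p ^ (2 * l - a)) (p ^ a)) s = 1,
        L.heckeTerm p l w a s ψ τ μ := by
    rintro r _ rfl
    simp only [heckeT]
    have h1 : ∀ F : ℕ → ℕ → ℂ, ∑ mn ∈ (p ^ (2 * l)).divisorsAntidiagonal, F mn.1 mn.2 =
        ∑ a ∈ Finset.range (2 * l + 1), F (p ^ (2 * l - a)) (p ^ a) := by
      intro F
      rw [Nat.sum_divisorsAntidiagonal' F, Nat.sum_divisors_prime_pow hp.out]
      refine Finset.sum_congr rfl fun a ha => ?_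
      rw [Nat.pow_div (by simpa [Nat.lt_succ_iff] using ha) hp.out.pos]
    have h2 := fun γ : L.disc (p ^ (2 * l)) => h1 fun m n =>
      rp n (-((w : ℝ) / 2 + (L.dim : ℝ) / 2)) *
        ∑ s ∈ Finset.range n with Nat.gcd (Nat.gcd m n) s = 1,
          L.Δ (p ^ (2 * l)) m γ * e (-((s : ℚ) / m) * L.q (p ^ (2 * l)) γ) *
            L.coeff (ψ (ofComplex ((m * (τ : ℂ) + s) / n))) (n • (γ : V ⧸ L.lat))
    beta_reduce at h2
    simp only [h2]
    simp only [Finset.mul_sum]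
    rw [Finset.sum_comm]
    refine Finset.sum_congr rfl fun a ha => ?_
    rw [Finset.sum_comm]
    refine Finset.sum_congr rfl fun s hs => ?_
    rw [heckeTerm, Finset.mul_sum]
    refine Finset.sum_congr rfl fun γ hγ => ?_
    have hc : (((p ^ l : ℕ) : ℂ) ^ L.dim)⁻¹ * (rp (p ^ (2 * l)) ((w : ℝ) / 2 + (L.dim : ℝ) / 2 - 1) *
        rp (p ^ a) (-((w : ℝ) / 2 + (L.dim : ℝ) / 2))) =
        rp p ((2 * l - a) * ((w : ℝ) / 2) - 2 * l - (a : ℝ) / 2 * L.dim) := by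
      rw [natCast_pow_eq_rp, rp_natPow, rp_pow, rp_pow, ← rp_neg, ← rp_add, ← rp_add]
      congr 1
      push_cast
      ring
    rw [← hc]
    push_cast
    ring
  rw [Finset.sum_apply]
  simp only [Finset.sum_apply]
  exact key _ (by rw [← pow_mul, mul_comm])

/-- With both exponents positive the inner gcd is a positive power of `p`, so the primitivity
condition says that `s` is prime to `p`. For the extreme terms `α` and `γ_b` it is empty. -/
theorem sum_units_zmod_pow {M : Type*} [AddCommMonoid M] (p : ℕ) [hp : Fact p.Prime] {a c : ℕ}
    (ha : a ≠ 0) (hc : c ≠ 0) (F : ℕ → M) :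
    ∑ s ∈ Finset.range (p ^ a) with Nat.gcd (Nat.gcd (p ^ c) (p ^ a)) s = 1, F s =
      ∑ b : (ZMod (p ^ a))ˣ, F (b : ZMod (p ^ a)).val := by
  have hgcd : ∀ s, Nat.gcd (Nat.gcd (p ^ c) (p ^ a)) s = 1 ↔ s.Coprime (p ^ a) := by
    intro s
    have h1 : Nat.gcd (p ^ c) (p ^ a) = p ^ min c a := by
      rcases le_total c a with h | h
      · rw [Nat.gcd_eq_left (pow_dvd_pow p h), min_eq_left h]
      · rw [Nat.gcd_eq_right (pow_dvd_pow p h), min_eq_right h]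
    rw [h1, Nat.coprime_pow_right_iff (Nat.pos_of_ne_zero ha), Nat.coprime_comm]
    exact Nat.coprime_pow_left_iff (by omega) _ _
  symm
  refine Finset.sum_bij (fun b _ => (b : ZMod (p ^ a)).val) (fun b _ => ?_) (fun b _ b' _ h => ?_)
    (fun s hs => ?_) fun _ _ => rfl
  · rw [Finset.mem_filter, Finset.mem_range, hgcd]
    exact ⟨ZMod.val_lt _, ZMod.val_coe_unit_coprime b⟩
  · exact Units.ext (ZMod.val_injective _ h)
  · rw [Finset.mem_filter, Finset.mem_range, hgcd] at hs
    exact ⟨ZMod.unitOfCoprime s hs.2, Finset.mem_univ _, by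
      rw [ZMod.coe_unitOfCoprime, ZMod.val_natCast, Nat.mod_eq_of_lt hs.1]⟩

theorem heckeH_eq (p l : ℕ) [hp : Fact p.Prime] (hl : 0 < l) (w : ℤ) (ψ : ℍ → L.disc 1 → ℂ)
    (τ : ℍ) : L.heckeH (p ^ l) w ψ τ =
      L.heckeTerm p l w 0 0 ψ τ +
        ∑ a ∈ Finset.Ioo 0 (2 * l), ∑ b : (ZMod (p ^ a))ˣ,
          L.heckeTerm p l w a (b : ZMod (p ^ a)).val ψ τ +
        ∑ b ∈ Finset.range (p ^ (2 * l)), L.heckeTerm p l w (2 * l) b ψ τ := by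
  rw [heckeH_eq_sum, Finset.sum_range_succ, Finset.range_eq_Ico,
    Finset.sum_eq_sum_Ico_succ_bot (by omega)]
  congr 1
  · congr 1
    · simp
    · have : Finset.Ico (0 + 1) (2 * l) = Finset.Ioo 0 (2 * l) := by
        ext x
        simp [Nat.succ_le_iff]
      rw [this]
      refine Finset.sum_congr rfl fun a ha => ?_
      rw [Finset.mem_Ioo] at ha
      exact sum_units_zmod_pow p (by omega) (by omega) fun s => L.heckeTerm p l w a s ψ τ
  · simp

theorem bsHecke_cosetRep (p l : ℕ) [hp : Fact p.Prime] (hl : 0 < l) (w : ℤ)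
    (ψ : ℍ → L.disc 1 → ℂ) : L.bsHecke p l w (cosetRep p l) ψ = L.heckeH (p ^ l) w ψ := by
  funext τ
  rw [heckeH_eq L p l hl, bsHecke, Fintype.sum_sum_type, Fintype.sum_sum_type, ← add_assoc]
  congr 1
  · congr 1
    · simp only [cosetRep, Finset.univ_unique, Finset.sum_singleton]
      exact L.bsTerm_alpha p l w ψ τ
    · rw [Fintype.sum_sigma, ← Finset.sum_coe_sort (Finset.Ioo 0 (2 * l))]
      refine Finset.sum_congr rfl fun a _ => Finset.sum_congr rfl fun u _ => ?_
      have ha := Finset.mem_Ioo.1 a.2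
      exact L.bsTerm_beta p l w ha.2.le (isCoprime_unit_val ha.1.ne' u) ψ τ
  · refine Finset.sum_bij (fun b _ => b.val) (fun b _ => Finset.mem_range.2 (ZMod.val_lt b))
      (fun b _ b' _ h => ZMod.val_injective _ h) (fun s hs => ⟨(s : ZMod _), Finset.mem_univ _, ?_⟩)
      fun b _ => L.bsTerm_gamma p l w b.val ψ τ
    rw [ZMod.val_natCast, Nat.mod_eq_of_lt (Finset.mem_range.1 hs)]

end EvenLattice

end WeilHecke

end

theorem mainTheorem9 {V : Type*} [AddCommGroup V] [Module ℚ V] (L : EvenLattice V)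
    (p l : ℕ) [Fact p.Prime] (hp : p ≠ 2) (hl : 0 < l) :
    -- the Weil representation exists and is determined by its values at `S` and `T`
    (L.IsWeilRep L.weilRep ∧ ∀ ρ, L.IsWeilRep ρ → ρ = L.weilRep) ∧
    -- its extension to the double coset is well defined
    (∀ γ γ' : Mp2Z, L.weilInv p l (γ * alpha p l * γ') =
      L.weilRep γ'⁻¹ ∘ₗ L.alphaOp p l ∘ₗ L.weilRep γ⁻¹) ∧
    -- the left coset decomposition
    IsCosetSystem p l (cosetRep p l) ∧
    -- the values of the extension at `α`, `γ_b` and `β_{b,a}`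
    (∀ μ : L.disc 1, L.weilInv p l (alpha p l) (L.basisVec μ) = L.basisVec (p ^ l • μ)) ∧
    (∀ (b : ℤ) (μ : L.disc 1), L.weilInv p l (gamma p l b) (L.basisVec μ) =
      ∑ ν ∈ L.fiber 1 (p ^ l) μ, e (-b * L.q 1 ν) • L.basisVec ν) ∧
    (∀ (a : ℕ) (b : ℤ) (μ : L.disc 1), 0 < a → a ≤ l → IsCoprime b (p : ℤ) →
      L.weilInv p l (beta p l a b) (L.basisVec μ) =
        rp p (-((a : ℝ) / 2 * L.dim)) •
          ∑ δ ∈ L.fiber (p ^ a) (p ^ a) μ,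
            e (-b * L.q (p ^ a) δ) • L.basisVec (p ^ (l - a) • μ)) ∧
    (∀ (a : ℕ) (b : ℤ) (μ : L.disc 1), l < a → a < 2 * l → IsCoprime b (p : ℤ) →
      L.weilInv p l (beta p l a b) (L.basisVec μ) =
        rp p (-((a : ℝ) / 2 * L.dim)) •
          ∑ ν ∈ L.fiber 1 (p ^ (a - l)) μ,
            ∑ δ ∈ L.fiber (p ^ l) (p ^ l) ν,
              e (-b * p ^ (a - l) * L.q (p ^ l) δ) • L.basisVec ν) ∧
    -- for every holomorphic modular form `ψ` of weight `w / 2` and type `ρ_L`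
    ∀ (w : ℤ) (ψ : ℍ → L.disc 1 → ℂ), L.IsModularForm w ψ →
      -- the decomposition of `ℋ`
      (∀ τ, L.heckeH (p ^ l) w ψ τ =
        L.heckeTerm p l w 0 0 ψ τ +
        ∑ a ∈ Finset.Ioo 0 (2 * l), ∑ b : (ZMod (p ^ a))ˣ,
          L.heckeTerm p l w a (b : ZMod (p ^ a)).val ψ τ +
        ∑ b ∈ Finset.range (p ^ (2 * l)), L.heckeTerm p l w (2 * l) b ψ τ) ∧
      -- the match coset by coset
      (∀ τ, L.bsTerm p l w (alpha p l) ψ τ = L.heckeTerm p l w 0 0 ψ τ) ∧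
      (∀ (a : ℕ) (b : ℤ) τ, 0 < a → a < 2 * l → IsCoprime b (p : ℤ) →
        L.bsTerm p l w (beta p l a b) ψ τ = L.heckeTerm p l w a b ψ τ) ∧
      (∀ (b : ℤ) τ, L.bsTerm p l w (gamma p l b) ψ τ = L.heckeTerm p l w (2 * l) b ψ τ) ∧
      -- the operators coincide, for every choice of coset representatives
      (∀ (ι : Type*) [Fintype ι] (δ : ι → MetaGL), IsCosetSystem p l δ →
        L.bsHecke p l w δ ψ = L.heckeH (p ^ l) w ψ) := by
  refine ⟨⟨L.isWeilRep_weilRep, fun ρ h => h.eq L.isWeilRep_weilRep⟩, L.weilInv_mul_alpha_mul p l,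
    isCosetSystem_cosetRep p l hl, L.weilInv_alpha p l, L.weilInv_gamma p l,
    fun a b μ _ ha hb => L.weilInv_beta_of_le p l ha hb μ,
    fun a b μ ha ha' hb => L.weilInv_beta_of_ge p l ha.le ha'.le hb μ,
    fun w ψ hψ => ⟨L.heckeH_eq p l hl w ψ, L.bsTerm_alpha p l w ψ,
      fun a b τ _ ha hb => L.bsTerm_beta p l w ha.le hb ψ τ, fun b τ => L.bsTerm_gamma p l w b ψ τ,
      fun ι _ δ hδ => ?_⟩⟩
  -- Modularity enters only here, to replace the given system by the standard triangular one, for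
  -- which the operators agree term by term.
  rw [L.bsHecke_congr hψ hδ (isCosetSystem_cosetRep p l hl), L.bsHecke_cosetRep p l hl]
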